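/- **Theorem.** Let $\Gamma$ be a finite connected simple graph that is *modular* (every three vertices $a,b,c$ have a median, i.e. a vertex $m$ with $d_\Gamma(x,y)=d_\Gamma(x,m)+d_\Gamma(m,y)$ for all distinct $x,y$ among $a,b,c$). Let $o$ be an *admissible orientation* of $\Gamma$: writing $p\swarrow_o q$ if the edge $pq$ is oriented from $q$ to $p$, every 4-cycle $uv,vv',v'u',u'u$ satisfies $u\swarrow_o v\iff u'\swarrow_o v'$. Let $h$ be a positive *orbit-invariant* function on the edges of $\Gamma$: $h$ is constant on each class of the equivalence relation generated by relating opposite edges of 4-cycles. Then $\mathbf\Gamma=(\Gamma,o,h)$ is called a *modular complex*. Let $d_{\Gamma,h}$ be its shortest path metric with respect to the edge length $h$. Let $n\ge 0$ and let $V=V_\Gamma\sqcup\{1,\dots,n\}$ with a cost $c:\binom V2\to\mathbb Q_{\ge0}$. Then the $n$-fold Cartesian product $\mathbf\Gamma^n$ (each edge of $\Gamma^n$ changes one coordinate along an edge of $\Gamma$, from which it inherits its orientation and length) is a modular complex, and the multifacility location function $$(c\cdot d_{\Gamma,h})(\rho)=\sum_{s\in V_\Gamma}\sum_{1\le j\le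 n}c(sj)\,d_{\Gamma,h}(s,\rho_j)+\sum_{1\le i<j\le n}c(ij)\,d_{\Gamma,h}(\rho_i,\rho_j)\qquad(\rho\in V_\Gamma^n)$$ is an L-convex function on $\mathbf\Gamma^n$. *L-convexity.* Let $\mathbf\Gamma=(\Gamma,o,h)$ be any modular complex. - A pair $(p,q)$ of vertices is *Boolean* if $p=q$, or if $p$ and $q$ are the minimum and the maximum of some cube subgraph of $\Gamma$, which $o$ orients as the Hasse diagram of a Boolean lattice. A Boolean pair $(p,q)$ is written $q/p$. - The *2-subdivision* $\mathbf\Gamma^*=(\Gamma^*,o^*,h^*)$ has the Boolean pairs as vertices. Its edges join $q/p$ and $q'/p$ when $qq'$ is an edge of $\Gamma$, with length $h(qq')/2$ and with $q/p\swarrow_{o^*}q'/p$ iff $q\swarrow_o q'$; and they join $q/p$ and $q/p'$ when $pp'$ is an edge of $\Gamma$, with length $h(pp')/2$ and with $q/p\swarrow_{o^*}q/p'$ iff $p'\swarrow_o p$. - For a vertex $p$, $\mathcal L^*_p$ is the set of the vertices $x$ of $\Gamma^*$ such that $(p/p,x)$ is a Boolean pair of $\mathbf\Gamma^*$, ordered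 by the reflexive transitive closure of $\swarrow_{o^*}$, with the valuation $v^*_p(x)=d_{\Gamma^*,h^*}(x,p/p)$. - A function $g:V_\Gamma\to\mathbb R$ is *L-convex* on $\mathbf\Gamma$ if for each vertex $p$ the function $q/p'\mapsto (g(p')+g(q))/2$ is submodular on $\mathcal L^*_p$ with respect to $v^*_p$. *Submodularity.* A finite meet-semilattice $\mathcal L$ is *modular* if all its principal ideals are modular lattices and $a\vee b\vee c$ exists whenever $a\vee b$, $b\vee c$, $c\vee a$ exist. A *valuation* is a strictly increasing $v:\mathcal L\to\mathbb R$ with $v(p)+v(q)=v(p\wedge q)+v(p\vee q)$ for all pairs $p,q$ with a common upper bound. A function $f:\mathcal L\to\mathbb R$ is *submodular* with respect to $v$ (which includes that $\mathcal L$ is a modular semilattice and that $v$ is a valuation) if $$f(p)+f(q)\ \ge\ f(p\wedge q)+\sum_{u\in\mathcal E(p,q)}[C(u;p,q)]\,f(u)\qquad(p,q\in\mathcal L).$$ Here $I(p,q)=\{u: d(p,u)+d(u,q)=d(p,q)\}$, where $d$ is the shortest path metric of the covering graph of $\mathcal L$ with length $v(b)-v(a)$ for an edge $ab$ with $b$ covering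 $a$; $v(u;p,q)=(v(u\wedge p)-v(p\wedge q),\,v(u\wedge q)-v(p\wedge q))\in\mathbb R^2$; $\mathcal E(p,q)$ is the set of the $u\in I(p,q)$ for which $z=v(u;p,q)$ is an extreme point of $K=\operatorname{conv}\{v(u';p,q):u'\in I(p,q)\}$ with $z+\varepsilon\notin K$ for all $\varepsilon$ with two positive coordinates; $C(u;p,q)$ is the cone of the $w\in\mathbb R^2_{\ge0}$ with $\langle w,v(u;p,q)\rangle=\max_{u'\in I(p,q)}\langle w,v(u';p,q)\rangle$; and $$[C]=\frac{\sin\alpha}{\cos\alpha+\sin\alpha}-\frac{\sin\beta}{\cos\beta+\sin\beta}$$ for the closed convex cone $C=\{(x,y)\in\mathbb R^2_{\ge0}: -x\sin\alpha+y\cos\alpha\le0\le -x\sin\beta+y\cos\beta\}$ with $0\le\beta\le\alpha\le\pi/2$, while $[\{0\}]=0$. -/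

import Mathlib

namespace LConvexity

/-! ### Shortest path distances in a graph with edge lengths -/

/-- The shortest path distance `d_{G,h}` with respect to the edge length `h`
(only the values of `h` on edges of `G` matter). -/
noncomputable def weightedDist {V : Type*} (G : SimpleGraph V) (h : Sym2 V → ℝ) (p q : V) : ℝ :=
  ⨅ w : G.Walk p q, (w.edges.map h).sum

/-! ### Modular graphs, admissible orientations, orbits -/

/-- `m` is a median of `a`, `b`, `c`. -/
def IsMedian {V : Type*} (G : SimpleGraph V) (a b c m : V) : Prop :=
  G.dist a m + G.dist m b = G.dist a b ∧
  G.dist b m + G.dist m c = G.dist b c ∧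
  G.dist c m + G.dist m a = G.dist c a

/-- A modular graph: connected, and every triple of vertices has a median. -/
def IsModularGraph {V : Type*} (G : SimpleGraph V) : Prop :=
  G.Connected ∧ ∀ a b c : V, ∃ m : V, IsMedian G a b c m

/-- `u v v' u'` is a 4-cycle, with edges `uv`, `vv'`, `v'u'`, `u'u`. -/
def IsFourCycle {V : Type*} (G : SimpleGraph V) (u v v' u' : V) : Prop :=
  G.Adj u v ∧ G.Adj v v' ∧ G.Adj v' u' ∧ G.Adj u' u ∧ u ≠ v' ∧ v ≠ u'

/-- `arc` is an orientation of `G`; `arc p q` means that the edge `pq` is oriented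
from `q` to `p` (so `q` is the upper end). -/
def IsOrientation {V : Type*} (G : SimpleGraph V) (arc : V → V → Prop) : Prop :=
  (∀ p q, arc p q → G.Adj p q) ∧ (∀ p q, G.Adj p q → Xor (arc p q) (arc q p))

/-- Admissible orientations: opposite edges of a 4-cycle are oriented in the same way. -/
def IsAdmissible {V : Type*} (G : SimpleGraph V) (arc : V → V → Prop) : Prop :=
  IsOrientation G arc ∧ ∀ u v v' u', IsFourCycle G u v v' u' → (arc u v ↔ arc u' v')

/-- `e` and `e'` are opposite (vertex-disjoint) edges of a common 4-cycle. -/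
def Opposite {V : Type*} (G : SimpleGraph V) (e e' : Sym2 V) : Prop :=
  ∃ u v v' u', IsFourCycle G u v v' u' ∧ e = s(u, v) ∧ e' = s(u', v')

/-- Projectivity of edges; its classes are the orbits. -/
def Projective {V : Type*} (G : SimpleGraph V) (e e' : Sym2 V) : Prop :=
  Relation.ReflTransGen (Opposite G) e e'

/-- Orbit-invariance of an edge length: it is constant on each orbit. -/
def IsOrbitInvariant {V : Type*} (G : SimpleGraph V) (h : Sym2 V → ℝ) : Prop :=
  ∀ e ∈ G.edgeSet, ∀ e' ∈ G.edgeSet, Projective G e e' → h e = h e'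

/-! ### Modular semilattices and submodular functions

The order is only required to be a preorder; antisymmetry is part of `IsModularSemilattice`. -/

section Semilattice

variable {L : Type*} [Preorder L]

open Classical in
/-- The meet of `a` and `b` (meaningful if it exists). -/
noncomputable def meet (a b : L) : L :=
  if h : ∃ m, IsGLB {a, b} m then h.choose else a

open Classical in
/-- The join of `a` and `b` (meaningful if it exists). -/
noncomputable def join (a b : L) : L :=
  if h : ∃ m, IsLUB {a, b} m then h.choose else a

variable (L) in
/-- Modular semilattices: a meet-semilattice in which every principal ideal is a modular lattice,
and in which three elements have a join as soon as any two of them have one. -/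
structure IsModularSemilattice : Prop where
  antisymm : ∀ a b : L, a ≤ b → b ≤ a → a = b
  exists_meet : ∀ a b : L, ∃ m, IsGLB {a, b} m
  exists_join : ∀ p a b : L, a ≤ p → b ≤ p → ∃ j, IsLUB {a, b} j
  modular : ∀ p a b c : L, a ≤ p → b ≤ p → c ≤ p → a ≤ c →
    join a (meet b c) = meet (join a b) c
  exists_join_triple : ∀ a b c : L, (∃ j, IsLUB {a, b} j) → (∃ j, IsLUB {b, c} j) →
    (∃ j, IsLUB {c, a} j) → ∃ j, IsLUB {a, b, c} j

/-- (Positive) valuations. -/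
structure IsValuation (v : L → ℝ) : Prop where
  pos : ∀ p q : L, p < q → 0 < v q - v p
  modular : ∀ p q : L, BddAbove {p, q} → v p + v q = v (meet p q) + v (join p q)

/-- The distance of the covering graph of `L`, where an edge `pq` with `q` covering `p`
has length `v q - v p`. -/
noncomputable def latticeDist (v : L → ℝ) (p q : L) : ℝ :=
  weightedDist (SimpleGraph.hasse L)
    (Sym2.lift ⟨fun a b => |v a - v b|, fun a b => abs_sub_comm (v a) (v b)⟩) p q

/-- The metric interval `I(p,q)`. -/
def interval (v : L → ℝ) (p q : L) : Set L :=
  {u | latticeDist v p u + latticeDist v u q = latticeDist v p q}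

/-- The vector `v(u;p,q) = (v[p ∧ q, u ∧ p], v[p ∧ q, u ∧ q])`. -/
noncomputable def vec (v : L → ℝ) (p q u : L) : ℝ × ℝ :=
  (v (meet u p) - v (meet p q), v (meet u q) - v (meet p q))

/-- `Conv I(p,q)`. -/
def convInterval (v : L → ℝ) (p q : L) : Set (ℝ × ℝ) :=
  convexHull ℝ (vec v p q '' interval v p q)

/-- The `(p,q)`-envelope: the elements of `I(p,q)` sent to maximal extreme points of
`Conv I(p,q)`. -/
def envelope (v : L → ℝ) (p q : L) : Set L :=
  {u | u ∈ interval v p q ∧ vec v p q u ∈ (convInterval v p q).extremePoints ℝ ∧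
    ∀ ε : ℝ × ℝ, 0 < ε.1 → 0 < ε.2 → vec v p q u + ε ∉ convInterval v p q}

/-- The closed convex cone of the vectors in the nonnegative quadrant with angle
between `β` and `α`. -/
def sector (α β : ℝ) : Set (ℝ × ℝ) :=
  {z | 0 ≤ z.1 ∧ 0 ≤ z.2 ∧ -z.1 * Real.sin α + z.2 * Real.cos α ≤ 0 ∧
    0 ≤ -z.1 * Real.sin β + z.2 * Real.cos β}

/-- `(α, β)` are the bounding angles of the cone `C` in the nonnegative quadrant. -/
def IsAnglePair (C : Set (ℝ × ℝ)) (t : ℝ × ℝ) : Prop :=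
  0 ≤ t.2 ∧ t.2 ≤ t.1 ∧ t.1 ≤ Real.pi / 2 ∧ C = sector t.1 t.2

open Classical in
/-- The value `[C]` of a closed convex cone `C` in the nonnegative quadrant. The bounding angles
of `C` are unique (see `coneValue_sector`); the cone `{0}` has none and gets the value `0`. -/
noncomputable def coneValue (C : Set (ℝ × ℝ)) : ℝ :=
  if h : ∃ t, IsAnglePair C t then
    Real.sin h.choose.1 / (Real.cos h.choose.1 + Real.sin h.choose.1) -
      Real.sin h.choose.2 / (Real.cos h.choose.2 + Real.sin h.choose.2)
  else 0

/-- The cone `C(u;p,q)` of the nonnegative `w` such that `u` maximizes `⟨w, v(·;p,q)⟩`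
over `I(p,q)`. -/
def normalCone (v : L → ℝ) (p q u : L) : Set (ℝ × ℝ) :=
  {w | 0 ≤ w.1 ∧ 0 ≤ w.2 ∧ ∀ u' ∈ interval v p q,
    w.1 * (vec v p q u').1 + w.2 * (vec v p q u').2 ≤
      w.1 * (vec v p q u).1 + w.2 * (vec v p q u).2}

/-- `f` is submodular on the modular semilattice `L` with respect to the valuation `v`. -/
structure IsSubmodular (v f : L → ℝ) : Prop where
  semilattice : IsModularSemilattice L
  valuation : IsValuation v
  submodular : ∀ p q : L,
    f (meet p q) + ∑ᶠ u ∈ envelope v p q, coneValue (normalCone v p q u) * f u ≤ f p + f q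

end Semilattice

theorem sector_subset {α β α' β' : ℝ} (h₀ : 0 ≤ β) (h₁ : β ≤ α) (h₂ : α ≤ Real.pi / 2)
    (h₀' : 0 ≤ β') (h₁' : β' ≤ α') (h₂' : α' ≤ Real.pi / 2) (h : sector α β ⊆ sector α' β') :
    α ≤ α' ∧ β' ≤ β := by
  have key : ∀ x y : ℝ, 0 ≤ x → x ≤ Real.pi / 2 → 0 ≤ y → y ≤ Real.pi / 2 →
      (0 ≤ Real.sin (x - y) ↔ y ≤ x) := by
    intro x y hx hx' hy hy'
    constructor
    · intro hs
      by_contra hc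
      have : Real.sin (x - y) < 0 :=
        Real.sin_neg_of_neg_of_neg_pi_lt (by linarith) (by linarith [Real.pi_pos])
      linarith
    · intro hs
      exact Real.sin_nonneg_of_nonneg_of_le_pi (by linarith) (by linarith [Real.pi_pos])
  have mem : ∀ x a b : ℝ, 0 ≤ x → x ≤ Real.pi / 2 → 0 ≤ b → b ≤ a → a ≤ Real.pi / 2 →
      ((Real.cos x, Real.sin x) ∈ sector a b ↔ x ≤ a ∧ b ≤ x) := by
    intro x a b hx hx' hb hba ha
    have e1 := key a x (by linarith) ha hx hx'
    have e2 := key x b hx hx' hb (by linarith)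
    have c : 0 ≤ Real.cos x := Real.cos_nonneg_of_mem_Icc ⟨by linarith, hx'⟩
    have s : 0 ≤ Real.sin x :=
      Real.sin_nonneg_of_nonneg_of_le_pi hx (by linarith [Real.pi_pos])
    rw [Real.sin_sub] at e1 e2
    rw [← e1, ← e2]
    simp only [sector, Set.mem_ofPred_eq]
    constructor
    · rintro ⟨-, -, h3, h4⟩
      exact ⟨by linarith, by linarith⟩
    · rintro ⟨h3, h4⟩
      exact ⟨c, s, by linarith, by linarith⟩
  have m1 := (mem α α β (by linarith) h₂ h₀ h₁ h₂).2 ⟨le_rfl, h₁⟩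
  have m2 := (mem β α β h₀ (by linarith) h₀ h₁ h₂).2 ⟨h₁, le_rfl⟩
  exact ⟨((mem α α' β' (by linarith) h₂ h₀' h₁' h₂').1 (h m1)).1,
    ((mem β α' β' h₀ (by linarith) h₀' h₁' h₂').1 (h m2)).2⟩

/-- The value of a cone does not depend on the choice of its bounding angles. -/
theorem coneValue_sector {α β : ℝ} (h₀ : 0 ≤ β) (h₁ : β ≤ α) (h₂ : α ≤ Real.pi / 2) :
    coneValue (sector α β) = Real.sin α / (Real.cos α + Real.sin α) -
      Real.sin β / (Real.cos β + Real.sin β) := by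
  have h : ∃ t, IsAnglePair (sector α β) t := ⟨(α, β), h₀, h₁, h₂, rfl⟩
  obtain ⟨g₀, g₁, g₂, g⟩ := h.choose_spec
  obtain ⟨a1, a2⟩ := sector_subset h₀ h₁ h₂ g₀ g₁ g₂ g.subset
  obtain ⟨b1, b2⟩ := sector_subset g₀ g₁ g₂ h₀ h₁ h₂ g.symm.subset
  rw [coneValue, dif_pos h, le_antisymm b1 a1, le_antisymm a2 b2]

/-! ### Modular complexes -/

/-- The data of a modular complex: a graph, a relation on its vertices (the orientation,
`arc p q` for the edge `pq` oriented from `q` to `p`) and an edge length. -/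
structure ComplexData (V : Type*) where
  graph : SimpleGraph V
  arc : V → V → Prop
  len : Sym2 V → ℝ

namespace ComplexData

variable {V : Type*} (Γ : ComplexData V)

/-- A modular complex: a modular graph with an admissible orientation and a positive
orbit-invariant edge length. -/
structure IsModularComplex : Prop where
  modular : IsModularGraph Γ.graph
  admissible : IsAdmissible Γ.graph Γ.arc
  orbitInvariant : IsOrbitInvariant Γ.graph Γ.len
  pos : ∀ e ∈ Γ.graph.edgeSet, 0 < Γ.len e

/-- The distance `d_{Γ,h}`. -/
noncomputable def dist (p q : V) : ℝ := weightedDist Γ.graph Γ.len p q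

/-- The relation `⪯`, the reflexive transitive closure of the orientation. -/
def le (p q : V) : Prop := Relation.ReflTransGen Γ.arc p q

/-- `(p,q)` is a Boolean pair: `p` and `q` are the minimum and the maximum of a cube subgraph
which is oriented as the Hasse diagram of a Boolean lattice. The `0`-cube gives `(p,p)`. -/
def IsBoolean (p q : V) : Prop :=
  ∃ (k : ℕ) (f : Finset (Fin k) → V), Function.Injective f ∧
    (∀ S T, S ⋖ T → Γ.arc (f S) (f T)) ∧ f ∅ = p ∧ f Finset.univ = q

theorem isBoolean_refl (p : V) : Γ.IsBoolean p p := by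
  refine ⟨0, fun _ => p, fun S T _ => Subsingleton.elim S T, fun S T h => ?_, rfl, rfl⟩
  exact absurd (Subsingleton.elim S T) h.1.ne

/-- A Boolean pair `(lo, hi)`, written `hi / lo`. -/
@[ext] structure BooleanPair where
  lo : V
  hi : V
  isBoolean : Γ.IsBoolean lo hi

/-- The Boolean pair `p / p`. -/
def vertexPair (p : V) : Γ.BooleanPair := ⟨p, p, Γ.isBoolean_refl p⟩

open Classical in
/-- The 2-subdivision of `Γ`. Its edges are the `{q/p, q'/p}` with `qq'` an edge of `Γ`, of length
half that of `qq'`, and the `{q/p, q/p'}` with `pp'` an edge of `Γ`, of length half that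
of `pp'`. -/
noncomputable def subdivision : ComplexData Γ.BooleanPair where
  graph :=
    { Adj := fun x y => (x.lo = y.lo ∧ Γ.graph.Adj x.hi y.hi) ∨
        (x.hi = y.hi ∧ Γ.graph.Adj x.lo y.lo)
      symm := ⟨by
        rintro x y (⟨h, h'⟩ | ⟨h, h'⟩)
        · exact Or.inl ⟨h.symm, h'.symm⟩
        · exact Or.inr ⟨h.symm, h'.symm⟩⟩
      loopless := ⟨by
        rintro x (⟨-, h⟩ | ⟨-, h⟩)
        · exact Γ.graph.loopless.irrefl _ h
        · exact Γ.graph.loopless.irrefl _ h⟩ }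
  arc := fun x y => (x.lo = y.lo ∧ Γ.arc x.hi y.hi) ∨ (x.hi = y.hi ∧ Γ.arc y.lo x.lo)
  len := Sym2.lift ⟨fun x y =>
      if x.lo = y.lo then Γ.len s(x.hi, y.hi) / 2 else Γ.len s(x.lo, y.lo) / 2, by
    intro x y
    simp only [eq_comm (a := x.lo), Sym2.eq_swap (a := x.hi), Sym2.eq_swap (a := x.lo)]⟩

/-- The neighborhood semilattice at `p`: the Boolean pairs `x` of `Γ` such that `(p/p, x)` is
a Boolean pair of the 2-subdivision. -/
def Neighborhood (p : V) : Type _ :=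
  {x : Γ.BooleanPair // Γ.subdivision.IsBoolean (Γ.vertexPair p) x}

/-- The neighborhood semilattice is ordered by the order of the 2-subdivision. -/
instance (p : V) : Preorder (Γ.Neighborhood p) where
  le x y := Γ.subdivision.le x.1 y.1
  le_refl _ := Relation.ReflTransGen.refl
  le_trans _ _ _ h h' := Relation.ReflTransGen.trans h h'

/-- The valuation of the neighborhood semilattice at `p`: the distance from `p/p` in the
2-subdivision. -/
noncomputable def nbhdValuation (p : V) (x : Γ.Neighborhood p) : ℝ :=
  Γ.subdivision.dist x.1 (Γ.vertexPair p)

/-- The restriction to the neighborhood semilattice at `p` of the extension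
`q/p ↦ (g p + g q) / 2` of `g` to the 2-subdivision. -/
noncomputable def extend (g : V → ℝ) (p : V) (x : Γ.Neighborhood p) : ℝ :=
  (g x.1.lo + g x.1.hi) / 2

/-- L-convex functions. -/
def IsLConvex (g : V → ℝ) : Prop :=
  ∀ p : V, IsSubmodular (Γ.nbhdValuation p) (Γ.extend g p)

open Classical in
/-- The `n`-fold Cartesian product. If `ρ` and `σ` are adjacent, then the sum in the definition
of the edge length has exactly one nonzero term, the length of the edge in the coordinate
where `ρ` and `σ` differ. -/
noncomputable def pow (n : ℕ) : ComplexData (Fin n → V) where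
  graph :=
    { Adj := fun ρ σ => ∃ i, Γ.graph.Adj (ρ i) (σ i) ∧ ∀ j, j ≠ i → ρ j = σ j
      symm := ⟨by
        rintro ρ σ ⟨i, h, h'⟩
        exact ⟨i, h.symm, fun j hj => (h' j hj).symm⟩⟩
      loopless := ⟨by
        rintro ρ ⟨i, h, -⟩
        exact Γ.graph.loopless.irrefl _ h⟩ }
  arc := fun ρ σ => ∃ i, Γ.arc (ρ i) (σ i) ∧ ∀ j, j ≠ i → ρ j = σ j
  len := Sym2.lift ⟨fun ρ σ => ∑ i, if ρ i = σ i then 0 else Γ.len s(ρ i, σ i), by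
    intro ρ σ
    refine Finset.sum_congr rfl fun i _ => ?_
    simp only [eq_comm (a := ρ i), Sym2.eq_swap (a := ρ i)]⟩

/-- The multifacility location function `c · d_{Γ,h}`, for costs `c` on the unordered pairs of
existing facilities (the vertices of `Γ`) and new facilities `1, …, n`. -/
noncomputable def multifacility [Fintype V] {n : ℕ} (c : Sym2 (V ⊕ Fin n) → ℚ≥0)
    (ρ : Fin n → V) : ℝ :=
  (∑ s : V, ∑ j : Fin n, (c s(Sum.inl s, Sum.inr j) : ℝ) * Γ.dist s (ρ j)) +
    ∑ j : Fin n, ∑ i ∈ Finset.Iio j, (c s(Sum.inr i, Sum.inr j) : ℝ) * Γ.dist (ρ i) (ρ j)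

end ComplexData

end LConvexity

namespace LConvexity

/-! ### Modular graphs -/

section Graph

variable {V : Type*} {G : SimpleGraph V}

/-! Write Γ* for the 2-subdivision. The proof moves the problem to a product of stars in Γ*, where
every term of the cost is a distance controlled by gates, and then verifies a local form of
submodularity.

Geometry. In a modular graph, convex sets have gates, and edges joined by a ladder of 4-cycles carry
the same orientation and length. Hence principal filters and ideals of a modular complex are convex,
medians produce meets and joins (`exists_isMeet`), and Boolean pairs are exactly the complemented
intervals (`isBoolean_iff_isComplemented`). In these terms Γ* is again a modular complex
(`IsModularComplex.subdivision`), with distance the mean of the distances of the lower and of the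
upper ends (`subdivision_dist`). The extension of c·d to Boolean pairs is therefore the same kind of
sum for the metric of Γ* (`extend_multifacility`), and the neighborhood of ρ in the power is a
product of stars of Γ* (`neighborhoodPow`). A star is convex, so on it d(x,z) = v(x) - 2 v(x ∧ g(z))
+ k(z) with a monotone gate map g (`exists_gate_star`).

Submodularity. Normalize directions in the quadrant to (1-t, t). The parameters t at which u is
optimal form an interval [τ₀, τ₁], the cone of u has value τ₁ - τ₀, and the nondegenerate intervals
tile [0,1]. The potential -(1-t) f(u ∧ p) + t f(u ∧ q) starts at -f(p), ends at f(q), and grows on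
the tile of u by (τ₁ - τ₀)(f(u ∧ p) + f(u ∧ q)). So two conditions suffice: ordinary submodularity
for pairs with an upper bound, and no drop of the potential where one tile passes to the next
(`isSubmodular_of_isLocallySubmodular`). Both survive nonnegative combinations, optimal exchanges in
a product are optimal in each coordinate (`IsOptimalExchange.apply`), and for the gate formula the
conditions follow from `bounded_gate` and `exchange_gate`. -/

theorem exists_adj_dist_add_one (hG : G.Connected) {x z : V} (h : x ≠ z) :
    ∃ y, G.Adj x y ∧ G.dist y z + 1 = G.dist x z := by
  obtain ⟨w, hw⟩ := hG.exists_walk_length_eq_dist x z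
  cases w with
  | nil => exact absurd rfl h
  | @cons _ y _ hxy w =>
    refine ⟨y, hxy, ?_⟩
    have h1 := SimpleGraph.dist_le w
    have h2 := hG.dist_triangle (u := x) (v := y) (w := z)
    rw [SimpleGraph.dist_eq_one_iff_adj.2 hxy] at h2
    rw [SimpleGraph.Walk.length_cons] at hw
    omega

/-- Computation of graph distances to `z` by a descent function. -/
theorem reachable_and_dist_eq_of_descent {δ : V → ℕ} {z : V}
    (h0 : ∀ x, δ x = 0 → x = z) (hz : δ z = 0)
    (hadj : ∀ x y, G.Adj x y → δ x ≤ δ y + 1)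
    (hstep : ∀ x, x ≠ z → ∃ y, G.Adj x y ∧ δ y + 1 = δ x) (x : V) :
    G.Reachable x z ∧ G.dist x z = δ x := by
  have hw : ∀ n x, δ x = n → ∃ w : G.Walk x z, w.length = n := by
    intro n
    induction n with
    | zero => intro x hx; obtain rfl := h0 x hx; exact ⟨.nil, rfl⟩
    | succ n ih =>
      intro x hx
      have hne : x ≠ z := by rintro rfl; omega
      obtain ⟨y, hxy, hy⟩ := hstep x hne
      obtain ⟨w, hw⟩ := ih y (by omega)
      exact ⟨.cons hxy w, by simp [hw]⟩
  have hlb : ∀ x (w : G.Walk x z), δ x ≤ w.length := by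
    have : ∀ x y (w : G.Walk x y), δ x ≤ w.length + δ y := by
      intro x y w
      induction w with
      | nil => simp
      | cons h w ih =>
        have := hadj _ _ h
        rw [SimpleGraph.Walk.length_cons]
        omega
    intro x w
    have := this x z w
    omega
  obtain ⟨w, hw'⟩ := hw _ x rfl
  refine ⟨w.reachable, le_antisymm (hw' ▸ SimpleGraph.dist_le w) ?_⟩
  obtain ⟨w', hw''⟩ := w.reachable.exists_walk_length_eq_dist
  exact hw'' ▸ hlb x w'

/-- Adjacent vertices have different distances to any vertex. -/
theorem IsModularGraph.dist_adj (hG : IsModularGraph G) {u v : V} (h : G.Adj u v) (z : V) :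
    G.dist u z = G.dist v z + 1 ∨ G.dist v z = G.dist u z + 1 := by
  obtain ⟨m, h1, h2, h3⟩ := hG.2 u v z
  rw [SimpleGraph.dist_eq_one_iff_adj.2 h] at h1
  have e1 : G.dist m u = G.dist u m := SimpleGraph.dist_comm
  have e2 : G.dist v m = G.dist m v := SimpleGraph.dist_comm
  have e3 : G.dist z u = G.dist u z := SimpleGraph.dist_comm
  have e4 : G.dist m z = G.dist z m := SimpleGraph.dist_comm
  omega

theorem IsModularGraph.dist_adj' (hG : IsModularGraph G) {u v : V} (h : G.Adj u v) (z : V) :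
    G.dist z u = G.dist z v + 1 ∨ G.dist z v = G.dist z u + 1 := by
  simpa only [SimpleGraph.dist_comm] using hG.dist_adj h z

/-- The median of u, v and z serves: u and v are at distance 2, since adjacent vertices are never
equidistant from z. -/
theorem IsModularGraph.quadrangle (hG : IsModularGraph G) {u v w z : V} (hu : G.Adj w u)
    (hv : G.Adj w v) (huv : u ≠ v) (h1 : G.dist u z + 1 = G.dist w z)
    (h2 : G.dist v z + 1 = G.dist w z) :
    ∃ w', G.Adj u w' ∧ G.Adj v w' ∧ G.dist w' z + 1 = G.dist u z := by
  have hd : G.dist u v = 2 := by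
    have h3 := hG.1.dist_triangle (u := u) (v := w) (w := v)
    have h4 := hG.1.pos_dist_of_ne huv
    rw [SimpleGraph.dist_eq_one_iff_adj.2 hu.symm, SimpleGraph.dist_eq_one_iff_adj.2 hv] at h3
    have h5 : G.dist u v ≠ 1 := by
      intro h
      have := hG.dist_adj (SimpleGraph.dist_eq_one_iff_adj.1 h) z
      omega
    omega
  obtain ⟨m, m1, m2, m3⟩ := hG.2 u v z
  have e1 : G.dist m u = G.dist u m := SimpleGraph.dist_comm
  have e2 : G.dist v m = G.dist m v := SimpleGraph.dist_comm
  have e3 : G.dist z u = G.dist u z := SimpleGraph.dist_comm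
  have e4 : G.dist m z = G.dist z m := SimpleGraph.dist_comm
  refine ⟨m, SimpleGraph.dist_eq_one_iff_adj.1 (by omega),
    SimpleGraph.dist_eq_one_iff_adj.1 (by omega), by omega⟩

/-- A connected bipartite graph with the quadrangle condition is modular. -/
theorem isModularGraph_of_quadrangle (hG : G.Connected)
    (hb : ∀ u v z, G.Adj u v → G.dist u z ≠ G.dist v z)
    (hq : ∀ u v w z, G.Adj w u → G.Adj w v → u ≠ v → G.dist u z + 1 = G.dist w z →
      G.dist v z + 1 = G.dist w z →
      ∃ w', G.Adj u w' ∧ G.Adj v w' ∧ G.dist w' z + 1 = G.dist u z) :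
    IsModularGraph G := by
  have adj1 : ∀ {u v}, G.Adj u v → ∀ z, G.dist u z = G.dist v z + 1 ∨
      G.dist v z = G.dist u z + 1 := by
    intro u v h z
    have h1 := hG.dist_triangle (u := u) (v := v) (w := z)
    have h2 := hG.dist_triangle (u := v) (v := u) (w := z)
    rw [SimpleGraph.dist_eq_one_iff_adj.2 h] at h1
    rw [SimpleGraph.dist_eq_one_iff_adj.2 h.symm] at h2
    have := hb u v z h
    omega
  have comm : ∀ u v, G.dist u v = G.dist v u := fun u v => SimpleGraph.dist_comm
  -- From b or from c, one step comes closer to the other of the two and to a at once. Such steps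
  -- shorten the perimeter of the triple, on which the existence of medians is proved by induction.
  have claim : ∀ a n b c, G.dist b c = n + 1 →
      (∃ b', G.Adj b b' ∧ G.dist b' c + 1 = G.dist b c ∧ G.dist b' a + 1 = G.dist b a) ∨
      (∃ c', G.Adj c c' ∧ G.dist c' b + 1 = G.dist c b ∧ G.dist c' a + 1 = G.dist c a) := by
    intro a n
    induction n with
    | zero =>
      intro b c h
      have hbc : G.Adj b c := SimpleGraph.dist_eq_one_iff_adj.1 (by omega)
      have := comm b c
      rcases adj1 hbc a with h' | h'
      · exact Or.inl ⟨c, hbc, by simp [h], by omega⟩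
      · exact Or.inr ⟨b, hbc.symm, by simp; omega, by omega⟩
    | succ n ih =>
      intro b c h
      have hbc : b ≠ c := by rintro rfl; simp at h
      obtain ⟨b1, h1, h1'⟩ := exists_adj_dist_add_one hG hbc
      rcases adj1 h1 a with h2 | h2
      · exact Or.inl ⟨b1, h1, h1', by omega⟩
      rcases ih b1 c (by omega) with ⟨b2, h3, h4, h5⟩ | ⟨c', h3, h4, h5⟩
      · have hne : b ≠ b2 := by rintro rfl; omega
        obtain ⟨w, w1, w2, w3⟩ := hq b b2 b1 a h1.symm h3 hne (by omega) (by omega)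
        refine Or.inl ⟨w, w1, ?_, w3⟩
        have := adj1 w1 c
        have := adj1 w2 c
        omega
      · refine Or.inr ⟨c', h3, ?_, h5⟩
        have h6 := hG.dist_triangle (u := c') (v := b1) (w := b)
        have := SimpleGraph.dist_eq_one_iff_adj.2 h1.symm
        have := adj1 h3 b
        have := comm b c
        have := comm b1 c
        omega
  refine ⟨hG, ?_⟩
  have main : ∀ n a b c, G.dist a b + G.dist b c + G.dist c a = n → ∃ m, IsMedian G a b c m := by
    intro n
    induction n using Nat.strong_induction_on with
    | _ n ih =>
      intro a b c hn
      have step : ∀ a b c a', G.Adj a a' → G.dist a' b + 1 = G.dist a b →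
          G.dist a' c + 1 = G.dist a c → (∃ m, IsMedian G a' b c m) →
          ∃ m, IsMedian G a b c m := by
        rintro a b c a' h h1 h2 ⟨m, m1, m2, m3⟩
        refine ⟨m, ?_, m2, ?_⟩
        · have := hG.dist_triangle (u := a) (v := a') (w := m)
          have := hG.dist_triangle (u := a) (v := m) (w := b)
          have := SimpleGraph.dist_eq_one_iff_adj.2 h
          omega
        · have := hG.dist_triangle (u := a) (v := a') (w := m)
          have := hG.dist_triangle (u := a) (v := m) (w := c)
          have := SimpleGraph.dist_eq_one_iff_adj.2 h
          have := comm m a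
          have := comm m a'
          have := comm c m
          have := comm c a
          have := comm c a'
          omega
      have rot : ∀ a b c, (∃ m, IsMedian G a b c m) → ∃ m, IsMedian G b c a m := by
        rintro a b c ⟨m, m1, m2, m3⟩
        exact ⟨m, m2, m3, m1⟩
      by_cases hbc : b = c
      · subst hbc
        exact ⟨b, by simp, by simp, by simp⟩
      · obtain ⟨k, hk⟩ := Nat.exists_eq_succ_of_ne_zero (hG.pos_dist_of_ne hbc).ne'
        rcases claim a k b c hk with ⟨b', h1, h2, h3⟩ | ⟨c', h1, h2, h3⟩
        · refine rot _ _ _ (rot _ _ _ (step b c a b' h1 h2 h3 (ih _ ?_ b' c a rfl)))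
          have := comm a b
          have := comm a b'
          omega
        · refine rot _ _ _ (step c a b c' h1 h3 h2 (ih _ ?_ c' a b rfl))
          have := comm c b
          have := comm c' b
          omega
  exact fun a b c => main _ a b c rfl

/-- A property of edges which is preserved by taking opposite edges of 4-cycles is preserved
along ladders. -/
theorem IsModularGraph.ladder (hG : IsModularGraph G) {P : V → V → Prop}
    (hP : ∀ u v v' u', IsFourCycle G u v v' u' → (P u v ↔ P u' v')) {u u' z z' : V}
    (hu : G.Adj u u') (hz : G.Adj z z') (h1 : G.dist u z = G.dist u' z')
    (h2 : G.dist u z' = G.dist u z + 1) (h3 : G.dist u' z = G.dist u z + 1) :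
    P u u' ↔ P z z' := by
  induction hk : G.dist u z generalizing u u' with
  | zero =>
    rw [hk] at h1
    obtain rfl := hG.1.dist_eq_zero_iff.1 hk
    obtain rfl := hG.1.dist_eq_zero_iff.1 h1.symm
    rfl
  | succ k ih =>
    have hne : u ≠ z := by rintro rfl; simp at hk
    obtain ⟨w, hw, hw'⟩ := exists_adj_dist_add_one hG.1 hne
    have hwu' : u' ≠ w := by rintro rfl; omega
    have e1 : G.dist w z' + 1 = G.dist u z' := by
      have := hG.dist_adj hw z'
      have := hG.dist_adj' hz w
      omega
    -- The square u u' w' w is the first piece of the ladder; the rest leads from ww' to zz'.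
    obtain ⟨w', a1, a2, a3⟩ := hG.quadrangle hu hw hwu' (z := z') (by omega) (by omega)
    have e2 : G.dist w' z = k + 1 := by
      have := hG.dist_adj a1 z
      have := hG.dist_adj a2 z
      omega
    have hne' : u ≠ w' := by rintro rfl; omega
    rw [hP u u' w' w ⟨hu, a1, a2.symm, hw.symm, hne', hwu'⟩]
    exact ih a2 (by omega) (by omega) (by omega) (by omega)

/-! ### Convex sets and gates. -/

/-- Convex sets of vertices. -/
def IsConvexSet (G : SimpleGraph V) (S : Set V) : Prop :=
  ∀ x ∈ S, ∀ y ∈ S, ∀ r, G.dist x r + G.dist r y = G.dist x y → r ∈ S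

/-- `g` is the gate of `z` in `S`. -/
def IsGate (G : SimpleGraph V) (S : Set V) (z g : V) : Prop :=
  g ∈ S ∧ ∀ x ∈ S, G.dist x g + G.dist g z = G.dist x z

theorem IsConvexSet.inter {S T : Set V} (hS : IsConvexSet G S) (hT : IsConvexSet G T) :
    IsConvexSet G (S ∩ T) :=
  fun x hx y hy r h => ⟨hS x hx.1 y hy.1 r h, hT x hx.2 y hy.2 r h⟩

/-- A vertex g of S nearest to z: the median of x, g and z lies in S by convexity, so minimality
forces it to be g. -/
theorem IsModularGraph.exists_isGate (hG : IsModularGraph G) {S : Set V} (hS : IsConvexSet G S)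
    (hne : S.Nonempty) (z : V) : ∃ g, IsGate G S z g := by
  obtain ⟨g, hg, hmin⟩ : ∃ g ∈ S, ∀ x ∈ S, G.dist g z ≤ G.dist x z := by
    obtain ⟨g, hg, h⟩ := (measure fun x => G.dist x z).wf.has_min S hne
    exact ⟨g, hg, fun x hx => not_lt.1 (h x hx)⟩
  refine ⟨g, hg, fun x hx => ?_⟩
  obtain ⟨m, m1, m2, m3⟩ := hG.2 x g z
  have hm := hmin m (hS x hx g hg m m1)
  have e1 : G.dist m x = G.dist x m := SimpleGraph.dist_comm
  have e2 : G.dist m z = G.dist z m := SimpleGraph.dist_comm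
  have e3 : G.dist z x = G.dist x z := SimpleGraph.dist_comm
  have : G.dist g m = 0 := by omega
  obtain rfl := hG.1.dist_eq_zero_iff.1 this
  omega

theorem IsGate.eq (hG : G.Connected) {S : Set V} {z g g' : V} (h : IsGate G S z g)
    (h' : IsGate G S z g') : g = g' := by
  have h1 := h.2 g' h'.1
  have h2 := h'.2 g h.1
  exact hG.dist_eq_zero_iff.1 (by omega)

/-- The gates of adjacent vertices are equal, or adjacent with a ladder between the edges. -/
theorem IsModularGraph.isGate_adj (hG : IsModularGraph G) {P : V → V → Prop}
    (hP : ∀ u v v' u', IsFourCycle G u v v' u' → (P u v ↔ P u' v')) {S : Set V} {z z' g g' : V}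
    (hz : G.Adj z z') (h : IsGate G S z g) (h' : IsGate G S z' g') :
    g = g' ∨ (G.Adj g g' ∧ (P g g' ↔ P z z')) := by
  have h1 := h.2 g' h'.1
  have h2 := h'.2 g h.1
  have h3 := hG.dist_adj' hz g
  have h4 := hG.dist_adj' hz g'
  have e : G.dist g g' = G.dist g' g := SimpleGraph.dist_comm
  by_cases hgg : G.dist g g' = 0
  · exact Or.inl (hG.1.dist_eq_zero_iff.1 hgg)
  · have ha : G.Adj g g' := SimpleGraph.dist_eq_one_iff_adj.1 (by omega)
    exact Or.inr ⟨ha, hG.ladder hP ha hz (by omega) (by omega) (by omega)⟩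

end Graph

end LConvexity

namespace LConvexity

namespace ComplexData

variable {V : Type*} {Γ : ComplexData V}

/-! ### The order of a modular complex -/

/-- The opposite complex. -/
def op (Γ : ComplexData V) : ComplexData V := ⟨Γ.graph, fun p q => Γ.arc q p, Γ.len⟩

theorem op_le {p q : V} : Γ.op.le p q ↔ Γ.le q p := Relation.reflTransGen_swap

theorem IsModularComplex.op (hΓ : Γ.IsModularComplex) : Γ.op.IsModularComplex where
  modular := hΓ.modular
  admissible := by
    refine ⟨⟨fun p q h => (hΓ.admissible.1.1 q p h).symm, fun p q h =>
      hΓ.admissible.1.2 q p h.symm⟩, ?_⟩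
    rintro u v v' u' ⟨h1, h2, h3, h4, h5, h6⟩
    exact hΓ.admissible.2 v u u' v' ⟨h1.symm, h4.symm, h3.symm, h2.symm, h6, h5⟩
  orbitInvariant := hΓ.orbitInvariant
  pos := hΓ.pos

theorem IsModularComplex.connected (hΓ : Γ.IsModularComplex) : Γ.graph.Connected := hΓ.modular.1

theorem IsModularComplex.adj_of_arc (hΓ : Γ.IsModularComplex) {p q : V} (h : Γ.arc p q) :
    Γ.graph.Adj p q := hΓ.admissible.1.1 p q h

theorem IsModularComplex.dist_of_arc (hΓ : Γ.IsModularComplex) {p q : V} (h : Γ.arc p q) :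
    Γ.graph.dist p q = 1 := SimpleGraph.dist_eq_one_iff_adj.2 (hΓ.adj_of_arc h)

theorem IsModularComplex.arc_or_arc (hΓ : Γ.IsModularComplex) {p q : V} (h : Γ.graph.Adj p q) :
    Γ.arc p q ∨ Γ.arc q p := (hΓ.admissible.1.2 p q h).or

theorem IsModularComplex.not_arc (hΓ : Γ.IsModularComplex) {p q : V} (h : Γ.arc p q) :
    ¬ Γ.arc q p := by
  rcases hΓ.admissible.1.2 p q (hΓ.adj_of_arc h) with h' | h'
  · exact h'.2
  · exact absurd h h'.2

theorem le_refl (p : V) : Γ.le p p := Relation.ReflTransGen.refl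

theorem le_trans {p q r : V} (h : Γ.le p q) (h' : Γ.le q r) : Γ.le p r :=
  Relation.ReflTransGen.trans h h'

theorem le_of_arc {p q : V} (h : Γ.arc p q) : Γ.le p q := Relation.ReflTransGen.single h

theorem exists_arcs_of_le {p q : V} (h : Γ.le p q) :
    ∃ (n : ℕ) (c : ℕ → V), c 0 = p ∧ c n = q ∧ ∀ i < n, Γ.arc (c i) (c (i + 1)) := by
  induction h with
  | refl => exact ⟨0, fun _ => p, rfl, rfl, fun i hi => absurd hi (Nat.not_lt_zero i)⟩
  | @tail q r _ hqr ih =>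
    obtain ⟨n, c, h0, hn, hc⟩ := ih
    refine ⟨n + 1, fun i => if i ≤ n then c i else r, by simp [h0], by simp, fun i hi => ?_⟩
    rcases Nat.lt_succ_iff_lt_or_eq.1 hi with h | rfl
    · simpa [h.le, Nat.succ_le_of_lt h] using hc i h
    · simpa [hn] using hqr

/-- Directed paths are geodesics. -/
theorem IsModularComplex.dist_of_arcs (hΓ : Γ.IsModularComplex) {n : ℕ} {c : ℕ → V}
    (hc : ∀ i < n, Γ.arc (c i) (c (i + 1))) :
    ∀ m i, i + m ≤ n → Γ.graph.dist (c i) (c (i + m)) = m := by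
  intro m
  induction m using Nat.twoStepInduction with
  | zero => intro i _; simp
  | one => intro i hi; exact hΓ.dist_of_arc (hc i (by omega))
  | more m ih1 ih2 =>
    intro i hi
    have h1 := ih2 i (by omega)
    have h2 := ih2 (i + 1) (by omega)
    have h3 := ih1 (i + 1) (by omega)
    have a1 := hc i (by omega)
    have a2 := hc (i + (m + 1)) (by omega)
    rw [show i + 1 + (m + 1) = i + (m + 2) by omega] at h2
    rw [show i + 1 + m = i + (m + 1) by omega] at h3
    rw [show i + (m + 1) + 1 = i + (m + 2) by omega] at a2
    rcases hΓ.modular.dist_adj (hΓ.adj_of_arc a1) (c (i + (m + 2))) with h | h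
    · omega
    -- Otherwise the path turns back, and the ladder between its first and last edges would reverse
    -- the last arc.
    · have := (hΓ.modular.ladder hΓ.admissible.2 (hΓ.adj_of_arc a1) (hΓ.adj_of_arc a2).symm
        (by omega) (by omega) (by omega)).1 a1
      exact absurd a2 (hΓ.not_arc this)

theorem IsModularComplex.dist_arc_right (hΓ : Γ.IsModularComplex) {p q r : V} (h : Γ.le p q)
    (h' : Γ.arc q r) : Γ.graph.dist p r = Γ.graph.dist p q + 1 := by
  obtain ⟨n, c, rfl, rfl, hc⟩ := exists_arcs_of_le (h.tail h')
  have h1 := hΓ.dist_of_arcs hc n 0 (by omega)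
  obtain ⟨m, e, he0, hem, he⟩ := exists_arcs_of_le h
  have h2 := hΓ.dist_of_arcs he m 0 (by omega)
  rw [Nat.zero_add, he0, hem] at h2
  rw [Nat.zero_add] at h1
  have h3 : ∀ i < m + 1, Γ.arc ((fun i => if i ≤ m then e i else c n) i)
      ((fun i => if i ≤ m then e i else c n) (i + 1)) := by
    intro i hi
    rcases Nat.lt_succ_iff_lt_or_eq.1 hi with h | rfl
    · simpa [h.le, Nat.succ_le_of_lt h] using he i h
    · simpa [hem] using h'
  have h4 := hΓ.dist_of_arcs h3 (m + 1) 0 (by omega)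
  simp [he0] at h4
  omega

theorem IsModularComplex.dist_add_of_le (hΓ : Γ.IsModularComplex) {p q r : V} (h : Γ.le p q)
    (h' : Γ.le q r) : Γ.graph.dist p q + Γ.graph.dist q r = Γ.graph.dist p r := by
  induction h' with
  | refl => simp
  | tail h1 h2 ih =>
    have := hΓ.dist_arc_right h1 h2
    have := hΓ.dist_arc_right (le_trans h h1) h2
    omega

theorem IsModularComplex.le_antisymm (hΓ : Γ.IsModularComplex) {p q : V} (h : Γ.le p q)
    (h' : Γ.le q p) : p = q := by
  have := hΓ.dist_add_of_le h h'
  rw [SimpleGraph.dist_self] at this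
  exact hΓ.connected.dist_eq_zero_iff.1 (by omega)

theorem IsModularComplex.eq_of_le_of_dist (hΓ : Γ.IsModularComplex) {p q r : V} (h : Γ.le p q)
    (h' : Γ.le q r) (hd : Γ.graph.dist p r ≤ Γ.graph.dist p q) : q = r := by
  have := hΓ.dist_add_of_le h h'
  exact hΓ.connected.dist_eq_zero_iff.1 (by omega)

theorem IsModularComplex.arc_of_le (hΓ : Γ.IsModularComplex) {p q : V} (h : Γ.le p q)
    (hd : Γ.graph.dist p q = 1) : Γ.arc p q := by
  rcases hΓ.arc_or_arc (SimpleGraph.dist_eq_one_iff_adj.1 hd) with h' | h'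
  · exact h'
  · obtain rfl := hΓ.le_antisymm h (le_of_arc h')
    simp at hd

/-- The quadrangle condition completes r, q and the predecessor q' on a directed path to a square
with a vertex s. Induction treats the edge sq', and admissibility carries orientations to opposite
edges. -/
theorem IsModularComplex.arc_and_le_of_adj (hΓ : Γ.IsModularComplex) {p q r : V} (h : Γ.le p q)
    (hr : Γ.graph.Adj r q) (hd : Γ.graph.dist p r + 1 = Γ.graph.dist p q) :
    Γ.arc r q ∧ Γ.le p r := by
  induction h generalizing r with
  | refl => simp at hd
  | @tail q' q h1 h2 ih =>
    by_cases hrq : r = q'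
    · subst hrq; exact ⟨h2, h1⟩
    · have e0 := hΓ.dist_arc_right h1 h2
      have e1 : Γ.graph.dist p r = Γ.graph.dist r p := SimpleGraph.dist_comm
      have e2 : Γ.graph.dist p q = Γ.graph.dist q p := SimpleGraph.dist_comm
      have e3 : Γ.graph.dist p q' = Γ.graph.dist q' p := SimpleGraph.dist_comm
      have hq := hΓ.adj_of_arc h2
      obtain ⟨s, s1, s2, s3⟩ := hΓ.modular.quadrangle hq.symm hr.symm (Ne.symm hrq) (z := p)
        (by omega) (by omega)
      have e4 : Γ.graph.dist p s = Γ.graph.dist s p := SimpleGraph.dist_comm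
      obtain ⟨h3, h4⟩ := ih s1.symm (by omega)
      have hsq : s ≠ q := by rintro rfl; omega
      have h5 := hΓ.admissible.2 s q' q r ⟨s1.symm, hq, hr.symm, s2, hsq, Ne.symm hrq⟩
      have h6 := hΓ.admissible.2 s r q q' ⟨s2.symm, hr, hq.symm, s1, hsq, hrq⟩
      exact ⟨h5.1 h3, h4.tail (h6.2 h2)⟩

theorem IsModularComplex.le_of_between (hΓ : Γ.IsModularComplex) {p q r : V} (h : Γ.le p q)
    (hr : Γ.graph.dist p r + Γ.graph.dist r q = Γ.graph.dist p q) : Γ.le p r ∧ Γ.le r q := by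
  induction hn : Γ.graph.dist r q generalizing q with
  | zero =>
    obtain rfl := hΓ.connected.dist_eq_zero_iff.1 hn
    exact ⟨h, le_refl r⟩
  | succ n ih =>
    have hne : q ≠ r := by rintro rfl; simp at hn
    obtain ⟨q', h1, h2⟩ := exists_adj_dist_add_one hΓ.connected hne
    have e1 : Γ.graph.dist r q = Γ.graph.dist q r := SimpleGraph.dist_comm
    have e2 : Γ.graph.dist r q' = Γ.graph.dist q' r := SimpleGraph.dist_comm
    have h3 := hΓ.connected.dist_triangle (u := p) (v := r) (w := q')
    have h4 := hΓ.modular.dist_adj' h1 p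
    obtain ⟨h5, h6⟩ := hΓ.arc_and_le_of_adj h h1.symm (by omega)
    obtain ⟨h7, h8⟩ := ih h6 (by omega) (by omega)
    exact ⟨h7, h8.tail h5⟩

/-- If `c ⪯ b`, and `c` and `b` are closer to `a` and `r`, respectively, then the edge `ar` is
oriented from `r` to `a`. -/
theorem IsModularComplex.arc_of_closer (hΓ : Γ.IsModularComplex) {a b c r : V} (h : Γ.le c b)
    (har : Γ.graph.Adj a r) (hc : Γ.graph.dist c a + 1 = Γ.graph.dist c r)
    (hb : Γ.graph.dist b r + 1 = Γ.graph.dist b a) : Γ.arc a r := by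
  induction h using Relation.ReflTransGen.head_induction_on with
  | refl => omega
  | @head c c1 h1 h2 ih =>
    rcases hΓ.modular.dist_adj' har c1 with h3 | h3
    · have e1 := hΓ.modular.dist_adj (hΓ.adj_of_arc h1) a
      have e2 := hΓ.modular.dist_adj (hΓ.adj_of_arc h1) r
      exact (hΓ.modular.ladder hΓ.admissible.2 (hΓ.adj_of_arc h1) har
        (by omega) (by omega) (by omega)).1 h1
    · exact ih h3.symm

/-- Follow a geodesic from a towards b. An upward step stays in the filter; a downward step that
comes closer to c stays between c and a; one that leads away from c is excluded by `arc_of_closer`,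
as c ⪯ b. -/
theorem IsModularComplex.isConvexSet_filter (hΓ : Γ.IsModularComplex) (c : V) :
    IsConvexSet Γ.graph {x | Γ.le c x} := by
  have key : ∀ n a b r, Γ.le c a → Γ.le c b → Γ.graph.dist a r = n →
      Γ.graph.dist a r + Γ.graph.dist r b = Γ.graph.dist a b → Γ.le c r := by
    intro n
    induction n with
    | zero =>
      intro a b r ha _ hn _
      obtain rfl := hΓ.connected.dist_eq_zero_iff.1 hn
      exact ha
    | succ n ih =>
      intro a b r ha hb hn hr
      have hne : a ≠ r := by rintro rfl; simp at hn
      obtain ⟨a', h1, h2⟩ := exists_adj_dist_add_one hΓ.connected hne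
      have h3 := hΓ.connected.dist_triangle (u := a') (v := r) (w := b)
      have h4 := hΓ.modular.dist_adj h1 b
      refine ih a' b r ?_ hb (by omega) (by omega)
      rcases hΓ.arc_or_arc h1 with h5 | h5
      · exact ha.tail h5
      · rcases hΓ.modular.dist_adj' h1 c with h6 | h6
        · exact (hΓ.arc_and_le_of_adj ha h1.symm h6.symm).2
        · have e1 : Γ.graph.dist b a = Γ.graph.dist a b := SimpleGraph.dist_comm
          have e2 : Γ.graph.dist b a' = Γ.graph.dist a' b := SimpleGraph.dist_comm
          exact absurd (hΓ.arc_of_closer hb h1 h6.symm (by omega)) (hΓ.not_arc h5)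
  exact fun a ha b hb r hr => key _ a b r ha hb rfl hr

theorem IsModularComplex.isConvexSet_ideal (hΓ : Γ.IsModularComplex) (c : V) :
    IsConvexSet Γ.graph {x | Γ.le x c} := by
  intro a ha b hb r hr
  exact op_le.1 (hΓ.op.isConvexSet_filter c a (op_le.2 ha) b (op_le.2 hb) r hr)

/-- The interval `[p,q]`. -/
def Icc (Γ : ComplexData V) (p q : V) : Set V := {x | Γ.le p x ∧ Γ.le x q}

theorem op_Icc {p q : V} : Γ.op.Icc q p = Γ.Icc p q := by
  ext x
  exact ⟨fun h => ⟨op_le.1 h.2, op_le.1 h.1⟩, fun h => ⟨op_le.2 h.2, op_le.2 h.1⟩⟩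

theorem IsModularComplex.isConvexSet_Icc (hΓ : Γ.IsModularComplex) (p q : V) :
    IsConvexSet Γ.graph (Γ.Icc p q) :=
  (hΓ.isConvexSet_filter p).inter (hΓ.isConvexSet_ideal q)

/-! ### Meets, joins and upper bounds. -/

/-- `m` is the meet of `a` and `b`. -/
def IsMeet (Γ : ComplexData V) (a b m : V) : Prop :=
  Γ.le m a ∧ Γ.le m b ∧ ∀ c, Γ.le c a → Γ.le c b → Γ.le c m

/-- `j` is the join of `a` and `b`. -/
def IsJoin (Γ : ComplexData V) (a b j : V) : Prop :=
  Γ.le a j ∧ Γ.le b j ∧ ∀ c, Γ.le a c → Γ.le b c → Γ.le j c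

theorem op_isMeet {a b m : V} : Γ.op.IsMeet a b m ↔ Γ.IsJoin a b m := by
  simp only [IsMeet, IsJoin, op_le]

theorem op_isJoin {a b m : V} : Γ.op.IsJoin a b m ↔ Γ.IsMeet a b m := by
  simp only [IsMeet, IsJoin, op_le]

theorem IsModularComplex.isMeet_unique (hΓ : Γ.IsModularComplex) {a b m m' : V}
    (h : Γ.IsMeet a b m) (h' : Γ.IsMeet a b m') : m = m' :=
  hΓ.le_antisymm (h'.2.2 m h.1 h.2.1) (h.2.2 m' h'.1 h'.2.1)

theorem IsModularComplex.isMeet_of_between (hΓ : Γ.IsModularComplex) {a b m : V}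
    (h1 : Γ.le m a) (h2 : Γ.le m b)
    (h : Γ.graph.dist a m + Γ.graph.dist m b = Γ.graph.dist a b) : Γ.IsMeet a b m :=
  ⟨h1, h2, fun c hc hc' => hΓ.isConvexSet_filter c a hc b hc' m h⟩

/-- The median of p, a and b is a lower bound of a and b that lies between them; filters being
convex, it is above every common lower bound. -/
theorem IsModularComplex.exists_isMeet (hΓ : Γ.IsModularComplex) {p a b : V} (ha : Γ.le p a)
    (hb : Γ.le p b) : ∃ m, Γ.IsMeet a b m ∧
      Γ.graph.dist a m + Γ.graph.dist m b = Γ.graph.dist a b := by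
  obtain ⟨m, m1, m2, m3⟩ := hΓ.modular.2 p a b
  have e1 : Γ.graph.dist p m = Γ.graph.dist m p := SimpleGraph.dist_comm
  have e2 : Γ.graph.dist p b = Γ.graph.dist b p := SimpleGraph.dist_comm
  have e3 : Γ.graph.dist b m = Γ.graph.dist m b := SimpleGraph.dist_comm
  exact ⟨m, hΓ.isMeet_of_between (hΓ.le_of_between ha m1).2
    (hΓ.le_of_between hb (r := m) (by omega)).2 m2, m2⟩

theorem IsModularComplex.isMeet_between (hΓ : Γ.IsModularComplex) {a b m : V}
    (h : Γ.IsMeet a b m) : Γ.graph.dist a m + Γ.graph.dist m b = Γ.graph.dist a b := by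
  obtain ⟨m', h1, h2⟩ := hΓ.exists_isMeet h.1 h.2.1
  rwa [hΓ.isMeet_unique h h1]

theorem IsModularComplex.exists_isJoin (hΓ : Γ.IsModularComplex) {q a b : V} (ha : Γ.le a q)
    (hb : Γ.le b q) : ∃ j, Γ.IsJoin a b j := by
  obtain ⟨j, h, -⟩ := hΓ.op.exists_isMeet (op_le.2 ha) (op_le.2 hb)
  exact ⟨j, op_isMeet.1 h⟩

theorem IsModularComplex.isJoin_between (hΓ : Γ.IsModularComplex) {a b j : V}
    (h : Γ.IsJoin a b j) : Γ.graph.dist a j + Γ.graph.dist j b = Γ.graph.dist a b :=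
  hΓ.op.isMeet_between (op_isMeet.2 h)

theorem IsModularComplex.isJoin_of_between (hΓ : Γ.IsModularComplex) {a b m : V}
    (h1 : Γ.le a m) (h2 : Γ.le b m)
    (h : Γ.graph.dist a m + Γ.graph.dist m b = Γ.graph.dist a b) : Γ.IsJoin a b m :=
  op_isMeet.1 (hΓ.op.isMeet_of_between (op_le.2 h1) (op_le.2 h2) h)

/-- Opposite sides of the square formed by `a`, `b`, their meet and their join have the same
length. -/
theorem IsModularComplex.dist_isMeet_isJoin (hΓ : Γ.IsModularComplex) {a b m j : V}
    (hm : Γ.IsMeet a b m) (hj : Γ.IsJoin a b j) :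
    Γ.graph.dist m a = Γ.graph.dist b j ∧ Γ.graph.dist m b = Γ.graph.dist a j := by
  have h1 := hΓ.isMeet_between hm
  have h2 := hΓ.isJoin_between hj
  have h3 := hΓ.dist_add_of_le hm.1 hj.1
  have h4 := hΓ.dist_add_of_le hm.2.1 hj.2.1
  have e1 : Γ.graph.dist m a = Γ.graph.dist a m := SimpleGraph.dist_comm
  have e2 : Γ.graph.dist b j = Γ.graph.dist j b := SimpleGraph.dist_comm
  omega

/-- If any two of `a`, `b`, `c` have an upper bound, then so do all three. -/
theorem IsModularComplex.exists_upper_bound (hΓ : Γ.IsModularComplex) {a b c x y z : V}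
    (h1 : Γ.le a x) (h2 : Γ.le b x) (h3 : Γ.le b y) (h4 : Γ.le c y) (h5 : Γ.le c z)
    (h6 : Γ.le a z) : ∃ u, Γ.le a u ∧ Γ.le b u ∧ Γ.le c u := by
  -- Each of a, b, c lies below two of x, y, z, so convexity of its filter puts the median above it.
  obtain ⟨m, m1, m2, m3⟩ := hΓ.modular.2 x y z
  exact ⟨m, hΓ.isConvexSet_filter a z h6 x h1 m m3, hΓ.isConvexSet_filter b x h2 y h3 m m1,
    hΓ.isConvexSet_filter c y h4 z h5 m m2⟩

/-- Along a directed path the gate either rests or moves along an edge joined to the current arc by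
a ladder, hence oriented like it. -/
theorem IsModularComplex.isGate_mono (hΓ : Γ.IsModularComplex) {S : Set V}
    (hS : IsConvexSet Γ.graph S) {z z' g g' : V} (h : Γ.le z z') (hg : IsGate Γ.graph S z g)
    (hg' : IsGate Γ.graph S z' g') : Γ.le g g' := by
  induction h generalizing g' with
  | refl => rw [hg.eq hΓ.connected hg']; exact le_refl _
  | @tail y z' h1 h2 ih =>
    obtain ⟨k, hk⟩ := hΓ.modular.exists_isGate hS ⟨g, hg.1⟩ y
    rcases hΓ.modular.isGate_adj hΓ.admissible.2 (hΓ.adj_of_arc h2) hk hg' with rfl | ⟨-, h3⟩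
    · exact ih hk
    · exact (ih hk).tail (h3.2 h2)

end ComplexData

end LConvexity

namespace LConvexity

namespace ComplexData

variable {V : Type*} {Γ : ComplexData V}

/-! ### Boolean pairs -/

/-- `q` is the join of the elements of `[p,q]` that cover `p`. -/
def IsAtomJoin (Γ : ComplexData V) (p q : V) : Prop :=
  Γ.le p q ∧ ∀ u, Γ.le p u → Γ.le u q → (∀ a, Γ.arc p a → Γ.le a q → Γ.le a u) → u = q

/-- The interval `[p,q]` is complemented. -/
def IsComplemented (Γ : ComplexData V) (p q : V) : Prop :=
  Γ.le p q ∧ ∀ r ∈ Γ.Icc p q, ∃ y ∈ Γ.Icc p q, Γ.IsMeet r y p ∧ Γ.IsJoin r y q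

theorem op_isComplemented {p q : V} : Γ.op.IsComplemented q p ↔ Γ.IsComplemented p q := by
  simp only [IsComplemented, op_le, op_Icc, op_isMeet, op_isJoin, and_comm]

theorem exists_arc_of_le {p q : V} (h : Γ.le p q) (hne : p ≠ q) :
    ∃ a, Γ.arc p a ∧ Γ.le a q := by
  rcases Relation.ReflTransGen.cases_head h with h | h
  · exact absurd h hne
  · exact h

namespace IsModularComplex

variable (hΓ : Γ.IsModularComplex)
include hΓ

theorem not_le_of_arc {p a : V} (h : Γ.arc p a) : ¬ Γ.le a p := fun h' => by
  obtain rfl := hΓ.le_antisymm (le_of_arc h) h'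
  exact (hΓ.adj_of_arc h).ne rfl

theorem eq_or_eq_of_arc {p a r : V} (h : Γ.arc p a) (h1 : Γ.le p r) (h2 : Γ.le r a) :
    r = p ∨ r = a := by
  have h3 := hΓ.dist_add_of_le h1 h2
  rw [hΓ.dist_of_arc h] at h3
  by_cases h0 : Γ.graph.dist p r = 0
  · exact Or.inl (hΓ.connected.dist_eq_zero_iff.1 h0).symm
  · exact Or.inr (hΓ.connected.dist_eq_zero_iff.1 (by omega))

theorem isMeet_atom {p a y : V} (h : Γ.arc p a) (hy : Γ.le p y) (ha : ¬ Γ.le a y) :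
    Γ.IsMeet a y p := by
  obtain ⟨m, hm, -⟩ := hΓ.exists_isMeet (le_of_arc h) hy
  rcases hΓ.eq_or_eq_of_arc h (hm.2.2 p (le_of_arc h) hy) hm.1 with rfl | rfl
  · exact hm
  · exact absurd hm.2.1 ha

theorem isMeet_atoms {p a b : V} (h : Γ.arc p a) (h' : Γ.arc p b) (hab : a ≠ b) :
    Γ.IsMeet a b p := by
  refine hΓ.isMeet_atom h (le_of_arc h') fun hle => ?_
  rcases hΓ.eq_or_eq_of_arc h' (le_of_arc h) hle with rfl | rfl
  · exact (hΓ.adj_of_arc h).ne rfl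
  · exact hab rfl

theorem arc_isJoin_atom {p a y j : V} (h : Γ.arc p a) (hy : Γ.le p y) (ha : ¬ Γ.le a y)
    (hj : Γ.IsJoin a y j) : Γ.arc y j := by
  refine hΓ.arc_of_le hj.2.1 ?_
  rw [← (hΓ.dist_isMeet_isJoin (hΓ.isMeet_atom h hy ha) hj).1, hΓ.dist_of_arc h]

/-- A highest y in [p,q] with r ∧ y = p is a complement of r: if r ∨ y ≠ q, some atom a is not below
r ∨ y, and then a ∨ y still meets r in p. -/
theorem isComplemented_of_isAtomJoin {p q : V} (h : Γ.IsAtomJoin p q) :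
    Γ.IsComplemented p q := by
  refine ⟨h.1, fun r hr => ?_⟩
  obtain ⟨y, ⟨hy, hm⟩, hmax⟩ : ∃ y, (y ∈ Γ.Icc p q ∧ Γ.IsMeet r y p) ∧
      ∀ y', (y' ∈ Γ.Icc p q ∧ Γ.IsMeet r y' p) → Γ.graph.dist p y' ≤ Γ.graph.dist p y := by
    obtain ⟨y, hy, hmin⟩ := (measure fun y => Γ.graph.dist p q - Γ.graph.dist p y).wf.has_min
      {y | y ∈ Γ.Icc p q ∧ Γ.IsMeet r y p}
      ⟨p, ⟨le_refl p, h.1⟩, hr.1, le_refl p, fun c _ hc => hc⟩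
    refine ⟨y, hy, fun y' hy' => ?_⟩
    have h1 : ¬ (Γ.graph.dist p q - Γ.graph.dist p y' < Γ.graph.dist p q - Γ.graph.dist p y) :=
      hmin y' hy'
    have h2 := hΓ.dist_add_of_le hy'.1.1 hy'.1.2
    omega
  refine ⟨y, hy, hm, ?_⟩
  obtain ⟨j, hj⟩ := hΓ.exists_isJoin hr.2 hy.2
  have hjq := hj.2.2 q hr.2 hy.2
  by_cases hne : j = q
  · exact hne ▸ hj
  exfalso
  obtain ⟨a, ha, haq, haj⟩ : ∃ a, Γ.arc p a ∧ Γ.le a q ∧ ¬ Γ.le a j := by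
    by_contra hcon
    push Not at hcon
    exact hne (h.2 j (le_trans hy.1 hj.2.1) hjq hcon)
  have hay : ¬ Γ.le a y := fun h' => haj (le_trans h' hj.2.1)
  obtain ⟨y', hy'⟩ := hΓ.exists_isJoin haq hy.2
  have harc := hΓ.arc_isJoin_atom ha hy.1 hay hy'
  have hd := hΓ.dist_arc_right hy.1 harc
  have hyq := hy'.2.2 q haq hy.2
  obtain ⟨x, hx, -⟩ := hΓ.exists_isMeet hr.1 (le_trans hy.1 hy'.2.1)
  have hpx := hx.2.2 p hr.1 (le_trans hy.1 hy'.2.1)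
  have hxy : Γ.IsMeet x y p := ⟨hpx, hy.1, fun c h1 h2 => hm.2.2 c (le_trans h1 hx.1) h2⟩
  obtain ⟨k, hk⟩ := hΓ.exists_isJoin hx.2.1 hy'.2.1
  have hkd := (hΓ.dist_isMeet_isJoin hxy hk).1
  -- The join of x and y is y or its cover y'. The first gives x = p, against maximality; the second
  -- puts a below r ∨ y.
  rcases hΓ.eq_or_eq_of_arc harc hk.2.1 (hk.2.2 _ hx.2.1 hy'.2.1) with rfl | rfl
  · rw [SimpleGraph.dist_self] at hkd
    obtain rfl := hΓ.connected.dist_eq_zero_iff.1 hkd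
    have := hmax y' ⟨⟨le_trans hy.1 hy'.2.1, hyq⟩, hx⟩
    omega
  · exact haj (le_trans hy'.1 (hk.2.2 j (le_trans hx.1 hj.1) hj.2.1))

/-- If y is a complement of u in [p,q], then y ∧ r is one in [p,r]. That u ∨ (y ∧ r) reaches r is a
count of lengths, the metric form of the modular law. -/
theorem isComplemented_lower {p q r : V} (h : Γ.IsComplemented p q) (hr : r ∈ Γ.Icc p q) :
    Γ.IsComplemented p r := by
  refine ⟨hr.1, fun u hu => ?_⟩
  obtain ⟨y, hy, hm, hj⟩ := h.2 u ⟨hu.1, le_trans hu.2 hr.2⟩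
  obtain ⟨w, hw, -⟩ := hΓ.exists_isMeet hy.1 hr.1
  have hpw := hw.2.2 p hy.1 hr.1
  have hm' : Γ.IsMeet u w p := ⟨hu.1, hpw, fun c h1 h2 => hm.2.2 c h1 (le_trans h2 hw.1)⟩
  obtain ⟨j, hj'⟩ := hΓ.exists_isJoin hu.2 hw.2.1
  have hjr := hj'.2.2 r hu.2 hw.2.1
  have hk : Γ.IsJoin y r q :=
    ⟨hy.2, hr.2, fun c h1 h2 => hj.2.2 c (le_trans hu.2 h2) h1⟩
  have d1 := hΓ.dist_isMeet_isJoin hm' hj'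
  have d2 := hΓ.dist_isMeet_isJoin hw hk
  have d3 := hΓ.dist_isMeet_isJoin hm hj
  have d4 := hΓ.dist_add_of_le hu.1 hj'.1
  have d5 := hΓ.dist_add_of_le hpw hw.2.1
  obtain rfl := hΓ.eq_of_le_of_dist (le_trans hu.1 hj'.1) hjr (by omega)
  exact ⟨w, ⟨hpw, hw.2.1⟩, hm', hj'⟩

theorem isComplemented_upper {p q r : V} (h : Γ.IsComplemented p q) (hr : r ∈ Γ.Icc p q) :
    Γ.IsComplemented r q :=
  op_isComplemented.1 (hΓ.op.isComplemented_lower (op_isComplemented.2 h) (op_Icc ▸ hr))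

theorem isAtomJoin_of_isComplemented {p q : V} (h : Γ.IsComplemented p q) :
    Γ.IsAtomJoin p q := by
  refine ⟨h.1, fun u hu hu' ha => ?_⟩
  obtain ⟨y, hy, hm, hj⟩ := h.2 u ⟨hu, hu'⟩
  by_cases hpy : p = y
  · subst hpy
    exact hΓ.le_antisymm hu' (hj.2.2 u (le_refl u) hu)
  · obtain ⟨a, h1, h2⟩ := exists_arc_of_le hy.1 hpy
    exact absurd (hm.2.2 a (ha a h1 (le_trans h2 hy.2)) h2) (hΓ.not_le_of_arc h1)

/-- The images of the singletons cover p, and f {i} is not below f S for i ∉ S, so f S ∨ f {i} = f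
(S ∪ {i}). The top is therefore a join of atoms, even if [p,q] is larger than the cube. -/
theorem isAtomJoin_of_isBoolean {p q : V} (h : Γ.IsBoolean p q) : Γ.IsAtomJoin p q := by
  obtain ⟨k, f, hf, harc, rfl, rfl⟩ := h
  have hins : ∀ (S : Finset (Fin k)) i, i ∉ S → Γ.arc (f S) (f (insert i S)) :=
    fun S i hi => harc _ _ (Finset.covBy_insert hi)
  have hunion : ∀ S U : Finset (Fin k), Γ.le (f S) (f (U ∪ S)) := by
    intro S U
    induction U using Finset.induction_on with
    | empty => rw [Finset.empty_union]; exact le_refl _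
    | insert i U hi ih =>
      rw [Finset.insert_union]
      by_cases h : i ∈ U ∪ S
      · rwa [Finset.insert_eq_of_mem h]
      · exact ih.tail (hins _ i h)
  have hsup : ∀ S T : Finset (Fin k), S ⊆ T → Γ.le (f S) (f T) := fun S T h =>
    Finset.union_eq_left.2 h ▸ hunion S T
  have hnot : ∀ (S : Finset (Fin k)) i, i ∉ S → ¬ Γ.le (f {i}) (f S) := by
    intro S
    induction S using Finset.induction_on with
    | empty => exact fun i hi => hΓ.not_le_of_arc (hins ∅ i hi)
    | insert j S hj ih =>
      intro i hi hle'
      rw [Finset.mem_insert, not_or] at hi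
      refine ih i hi.2 ((hΓ.isMeet_atoms (hins S j hj) (hins S i hi.2) fun h => ?_).2.2 _ hle' ?_)
      · have : i ∈ insert j S := by rw [hf h]; exact Finset.mem_insert_self i S
        exact (Finset.mem_insert.1 this).elim hi.1 hi.2
      · exact hsup _ _ (by simp)
  refine ⟨hsup _ _ (Finset.empty_subset _), fun u hu hu' ha => ?_⟩
  have key : ∀ S, Γ.le (f S) u := by
    intro S
    induction S using Finset.induction_on with
    | empty => exact hu
    | insert i S hi ih =>
      have h1 : Γ.le (f {i}) (f (insert i S)) := hsup _ _ (by simp)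
      obtain ⟨j, hj⟩ := hΓ.exists_isJoin h1 (le_of_arc (hins S i hi))
      have h2 := hj.2.2 _ h1 (le_of_arc (hins S i hi))
      rcases hΓ.eq_or_eq_of_arc (hins S i hi) hj.2.1 h2 with rfl | h3
      · exact absurd hj.1 (hnot S i hi)
      · rw [← h3]
        exact hj.2.2 u (ha _ (hins ∅ i (Finset.notMem_empty i))
          (hsup _ _ (Finset.subset_univ _))) ih
  exact hΓ.le_antisymm hu' (key _)

/-- An atom a not below the top r of a cube doubles it: x ↦ a ∨ x produces a parallel copy, because
a ∨ x covers x when a is not below x. The dimension equals the distance from p to the top, so a cube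
of dimension d(p,q) reaches q. -/
theorem exists_cube {p q : V} (h : Γ.IsAtomJoin p q) : ∀ n ≤ Γ.graph.dist p q,
    ∃ f : Finset (Fin n) → V, Function.Injective f ∧ (∀ S T, S ⋖ T → Γ.arc (f S) (f T)) ∧
      f ∅ = p ∧ Γ.le (f Finset.univ) q ∧ Γ.graph.dist p (f Finset.univ) = n ∧
      ∀ S, Γ.le p (f S) ∧ Γ.le (f S) (f Finset.univ) := by
  intro n
  induction n with
  | zero =>
    intro _
    refine ⟨fun _ => p, fun S T _ => Subsingleton.elim S T, fun S T h => ?_, rfl, h.1,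
      SimpleGraph.dist_self, fun S => ⟨le_refl p, le_refl p⟩⟩
    exact absurd (Subsingleton.elim S T) h.1.ne
  | succ n ih =>
    intro hn
    obtain ⟨f, hf, harc, h0, hq, hrd, hS⟩ := ih (by omega)
    set r := f Finset.univ with hr
    have hne : r ≠ q := by rintro hrq; rw [hrq] at hrd; omega
    obtain ⟨a, ha, haq, har⟩ : ∃ a, Γ.arc p a ∧ Γ.le a q ∧ ¬ Γ.le a r := by
      by_contra hcon
      push Not at hcon
      exact hne (h.2 r (hS _).1 hq hcon)
    have hJ : ∀ x, ∃ j, Γ.le x q → Γ.IsJoin a x j := by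
      intro x
      by_cases hx : Γ.le x q
      · obtain ⟨j, hj⟩ := hΓ.exists_isJoin haq hx
        exact ⟨j, fun _ => hj⟩
      · exact ⟨x, fun h => absurd h hx⟩
    choose J hJ using hJ
    have hfJ : ∀ S, Γ.IsJoin a (f S) (J (f S)) := fun S => hJ _ (le_trans (hS S).2 hq)
    have haf : ∀ S, ¬ Γ.le a (f S) := fun S h' => har (le_trans h' (hS S).2)
    have hfa : ∀ S, Γ.arc (f S) (J (f S)) := fun S =>
      hΓ.arc_isJoin_atom ha (hS S).1 (haf S) (hfJ S)
    have hdJ : ∀ S, Γ.graph.dist p (J (f S)) = Γ.graph.dist p (f S) + 1 := fun S =>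
      hΓ.dist_arc_right (hS S).1 (hfa S)
    let pre : Finset (Fin (n + 1)) → Finset (Fin n) := fun S =>
      Finset.univ.filter fun i => i.castSucc ∈ S
    have mem_pre : ∀ S i, i ∈ pre S ↔ i.castSucc ∈ S := fun S i => by simp [pre]
    have pre_last : ∀ S, pre (insert (Fin.last n) S) = pre S := fun S => by
      ext i; simp [mem_pre, Fin.castSucc_ne_last]
    have pre_cast : ∀ S i, pre (insert (Fin.castSucc i) S) = insert i (pre S) := fun S i => by
      ext j; simp [mem_pre]
    have pre_univ : pre Finset.univ = Finset.univ := by ext i; simp [mem_pre]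
    have pre_empty : pre ∅ = ∅ := by ext i; simp [mem_pre]
    let g : Finset (Fin (n + 1)) → V := fun S =>
      if Fin.last n ∈ S then J (f (pre S)) else f (pre S)
    have g_mem : ∀ S, Fin.last n ∈ S → g S = J (f (pre S)) := fun S h => if_pos h
    have g_not : ∀ S, Fin.last n ∉ S → g S = f (pre S) := fun S h => if_neg h
    have hag : ∀ S, Γ.le a (g S) ↔ Fin.last n ∈ S := by
      intro S
      by_cases hl : Fin.last n ∈ S
      · rw [g_mem S hl]; exact iff_of_true (hfJ _).1 hl
      · rw [g_not S hl]; exact iff_of_false (haf _) hl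
    have harc_ins : ∀ S i, i ∉ S → Γ.arc (g S) (g (insert i S)) := by
      intro S i
      refine Fin.lastCases (fun hi => ?_) (fun i hi => ?_) i
      · rw [g_mem _ (Finset.mem_insert_self _ S), g_not S hi, pre_last]
        exact hfa _
      · have hi' : i ∉ pre S := fun h => hi ((mem_pre S i).1 h)
        have h1 := harc _ _ (Finset.covBy_insert hi')
        by_cases hl : Fin.last n ∈ S
        · rw [g_mem S hl, g_mem _ (Finset.mem_insert_of_mem hl), pre_cast]
          have h2 : Γ.le (J (f (pre S))) (J (f (insert i (pre S)))) :=
            (hfJ _).2.2 _ (hfJ _).1 ((le_of_arc h1).trans (hfJ _).2.1)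
          have h3 := hΓ.dist_add_of_le (le_trans (hS _).1 (hfJ (pre S)).2.1) h2
          rw [hdJ, hdJ, hΓ.dist_arc_right (hS _).1 h1] at h3
          exact hΓ.arc_of_le h2 (by omega)
        · have hl' : Fin.last n ∉ insert i.castSucc S := by
            rw [Finset.mem_insert, not_or]
            exact ⟨(Fin.castSucc_ne_last i).symm, hl⟩
          rw [g_not S hl, g_not _ hl', pre_cast]
          exact h1
    -- Meeting with the old top r recovers f S from a ∨ f S; this gives injectivity of the doubled
    -- cube.
    have hmeet : ∀ S, Γ.IsMeet (J (f S)) r (f S) := by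
      intro S
      obtain ⟨m, hm, -⟩ := hΓ.exists_isMeet (hfJ S).2.1 (hS S).2
      rcases hΓ.eq_or_eq_of_arc (hfa S) (hm.2.2 _ (hfJ S).2.1 (hS S).2) hm.1 with h1 | h1
      · exact h1 ▸ hm
      · exact absurd (le_trans (hfJ S).1 (h1 ▸ hm.2.1)) har
    have hg_univ : g Finset.univ = J r := by
      rw [g_mem _ (Finset.mem_univ _), pre_univ]
    refine ⟨g, fun S T hST => ?_, fun S T hST => ?_, ?_, ?_, ?_, fun S => ?_⟩
    · have hl : Fin.last n ∈ S ↔ Fin.last n ∈ T := by rw [← hag, ← hag, hST]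
      have hpre : pre S = pre T := by
        by_cases hS' : Fin.last n ∈ S
        · rw [g_mem S hS', g_mem T (hl.1 hS')] at hST
          exact hf (hΓ.isMeet_unique (hmeet _) (hST ▸ hmeet _))
        · rw [g_not S hS', g_not T fun h => hS' (hl.2 h)] at hST
          exact hf hST
      ext i
      refine Fin.lastCases hl (fun i => ?_) i
      rw [← mem_pre, ← mem_pre, hpre]
    · obtain ⟨i, hi, rfl⟩ := Finset.covBy_iff_exists_insert.1 hST
      exact harc_ins S i hi
    · rw [g_not _ (Finset.notMem_empty _), pre_empty, h0]
    · rw [hg_univ]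
      exact (hfJ Finset.univ).2.2 q haq hq
    · rw [hg_univ, hdJ, hrd]
    · rw [hg_univ]
      by_cases hl : Fin.last n ∈ S
      · rw [g_mem S hl]
        exact ⟨le_trans (hS _).1 (hfJ _).2.1, (hfJ _).2.2 _ (hfJ Finset.univ).1
          (le_trans (hS _).2 (hfJ Finset.univ).2.1)⟩
      · rw [g_not S hl]
        exact ⟨(hS _).1, le_trans (hS _).2 (hfJ Finset.univ).2.1⟩

theorem isBoolean_of_isAtomJoin {p q : V} (h : Γ.IsAtomJoin p q) : Γ.IsBoolean p q := by
  obtain ⟨f, hf, harc, h0, hq, hd, hS⟩ := hΓ.exists_cube h _ le_rfl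
  exact ⟨_, f, hf, harc, h0, hΓ.eq_of_le_of_dist (hS _).1 hq hd.ge⟩

theorem isBoolean_iff_isComplemented {p q : V} : Γ.IsBoolean p q ↔ Γ.IsComplemented p q :=
  ⟨fun h => hΓ.isComplemented_of_isAtomJoin (hΓ.isAtomJoin_of_isBoolean h),
    fun h => hΓ.isBoolean_of_isAtomJoin (hΓ.isAtomJoin_of_isComplemented h)⟩

theorem le_of_isBoolean {p q : V} (h : Γ.IsBoolean p q) : Γ.le p q :=
  (hΓ.isAtomJoin_of_isBoolean h).1

theorem op_isBoolean {p q : V} : Γ.op.IsBoolean q p ↔ Γ.IsBoolean p q := by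
  rw [hΓ.isBoolean_iff_isComplemented, hΓ.op.isBoolean_iff_isComplemented, op_isComplemented]

theorem isBoolean_of_mem_Icc {p q r s : V} (h : Γ.IsBoolean p q) (hpr : Γ.le p r)
    (hrs : Γ.le r s) (hsq : Γ.le s q) : Γ.IsBoolean r s := by
  rw [hΓ.isBoolean_iff_isComplemented] at h ⊢
  exact hΓ.isComplemented_upper (hΓ.isComplemented_lower h ⟨le_trans hpr hrs, hsq⟩) ⟨hpr, hrs⟩

/-- Joins of atoms are closed under joins: the atoms below x and those below y together generate j.
-/
theorem isBoolean_of_isJoin {p x y j : V} (hx : Γ.IsBoolean p x) (hy : Γ.IsBoolean p y)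
    (hj : Γ.IsJoin x y j) : Γ.IsBoolean p j := by
  have hx' := hΓ.isAtomJoin_of_isBoolean hx
  have hy' := hΓ.isAtomJoin_of_isBoolean hy
  refine hΓ.isBoolean_of_isAtomJoin ⟨le_trans hx'.1 hj.1, fun u hu huj ha => ?_⟩
  have key : ∀ z, Γ.IsAtomJoin p z → Γ.le z j → Γ.le z u := by
    intro z hz hzj
    obtain ⟨m, hm, -⟩ := hΓ.exists_isMeet hu hz.1
    have := hz.2 m (hm.2.2 p hu hz.1) hm.2.1 fun a h1 h2 =>
      hm.2.2 a (ha a h1 (le_trans h2 hzj)) h2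
    exact this ▸ hm.1
  exact hΓ.le_antisymm huj (hj.2.2 u (key x hx' hj.1) (key y hy' hj.2.1))

theorem isBoolean_of_isMeet {q x y m : V} (hx : Γ.IsBoolean x q) (hy : Γ.IsBoolean y q)
    (hm : Γ.IsMeet x y m) : Γ.IsBoolean m q :=
  hΓ.op_isBoolean.1 (hΓ.op.isBoolean_of_isJoin (hΓ.op_isBoolean.2 hx) (hΓ.op_isBoolean.2 hy)
    (op_isJoin.2 hm))

theorem isBoolean_of_arc {p q : V} (h : Γ.arc p q) : Γ.IsBoolean p q := by
  refine hΓ.isBoolean_of_isAtomJoin ⟨le_of_arc h, fun u _ huq ha => ?_⟩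
  exact hΓ.le_antisymm huq (ha q h (le_refl q))

end IsModularComplex

end ComplexData

end LConvexity

namespace LConvexity

/-! ### Weighted distances -/

theorem weightedDist_le_of_walk {V : Type*} {G : SimpleGraph V} {h : Sym2 V → ℝ}
    (hpos : ∀ e ∈ G.edgeSet, 0 ≤ h e) {p q : V} (w : G.Walk p q) :
    weightedDist G h p q ≤ (w.edges.map h).sum := by
  refine ciInf_le ⟨0, ?_⟩ w
  rintro _ ⟨w, rfl⟩
  refine List.sum_nonneg fun x hx => ?_
  obtain ⟨e, he, rfl⟩ := List.mem_map.1 hx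
  exact hpos e (w.edges_subset_edgeSet he)

namespace ComplexData

variable {V : Type*} {Γ : ComplexData V}

namespace IsModularComplex

variable (hΓ : Γ.IsModularComplex)
include hΓ

theorem len_opposite {u v v' u' : V} (h : IsFourCycle Γ.graph u v v' u') :
    Γ.len s(u, v) = Γ.len s(u', v') :=
  hΓ.orbitInvariant _ h.1 _ h.2.2.1.symm (Relation.ReflTransGen.single ⟨u, v, v', u', h, rfl, rfl⟩)

theorem len_pos {u v : V} (h : Γ.graph.Adj u v) : 0 < Γ.len s(u, v) := hΓ.pos _ h

/-- Geodesics with different first steps are both compared with one through the vertex that closes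
the square of these steps; opposite sides of the square have equal length. -/
theorem sum_len_geodesic_unique {p q : V} (w w' : Γ.graph.Walk p q)
    (hw : w.length = Γ.graph.dist p q) (hw' : w'.length = Γ.graph.dist p q) :
    (w.edges.map Γ.len).sum = (w'.edges.map Γ.len).sum := by
  induction hn : Γ.graph.dist p q generalizing p with
  | zero =>
    rw [hn] at hw hw'
    obtain rfl := hΓ.connected.dist_eq_zero_iff.1 hn
    rw [SimpleGraph.Walk.eq_nil_iff_nil.2 (SimpleGraph.Walk.length_eq_zero_iff.1 hw),
      SimpleGraph.Walk.eq_nil_iff_nil.2 (SimpleGraph.Walk.length_eq_zero_iff.1 hw')]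
  | succ n ih =>
    cases w with
    | nil => simp at hn
    | @cons _ p1 _ h1 w1 =>
      cases w' with
      | nil => simp at hn
      | @cons _ p2 _ h2 w2 =>
        rw [SimpleGraph.Walk.length_cons] at hw hw'
        have l1 := SimpleGraph.dist_le w1
        have l2 := SimpleGraph.dist_le w2
        have a1 := hΓ.modular.dist_adj h1 q
        have a2 := hΓ.modular.dist_adj h2 q
        simp only [SimpleGraph.Walk.edges_cons, List.map_cons, List.sum_cons]
        by_cases hp : p1 = p2
        · subst hp
          rw [ih w1 w2 (by omega) (by omega) (by omega)]
        · obtain ⟨s, s1, s2, s3⟩ := hΓ.modular.quadrangle h1 h2 hp (z := q) (by omega) (by omega)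
          obtain ⟨g, hg⟩ := hΓ.connected.exists_walk_length_eq_dist s q
          have hps : p ≠ s := by rintro rfl; omega
          rw [ih w1 (.cons s1 g) (by omega) (by simp; omega) (by omega),
            ih w2 (.cons s2 g) (by omega) (by simp; omega) (by omega)]
          simp only [SimpleGraph.Walk.edges_cons, List.map_cons, List.sum_cons]
          have e1 := hΓ.len_opposite ⟨h1, s1, s2.symm, h2.symm, hps, hp⟩
          have e2 := hΓ.len_opposite ⟨h2, s2, s1.symm, h1.symm, hps, Ne.symm hp⟩
          linarith

/-- Induction on w: a first step towards q prolongs a geodesic from p1 to one from p, while after a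
step away from q the geodesic from p1 may be taken to return through p, so it already contains w'.
-/
theorem sum_len_geodesic_le {p q : V} (w w' : Γ.graph.Walk p q)
    (hw' : w'.length = Γ.graph.dist p q) :
    (w'.edges.map Γ.len).sum ≤ (w.edges.map Γ.len).sum := by
  induction w with
  | nil =>
    rw [SimpleGraph.dist_self] at hw'
    rw [SimpleGraph.Walk.eq_nil_iff_nil.2 (SimpleGraph.Walk.length_eq_zero_iff.1 hw')]
  | @cons p p1 q h1 w1 ih =>
    obtain ⟨g, hg⟩ := hΓ.connected.exists_walk_length_eq_dist p1 q
    have h2 := ih g hg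
    have h3 := hΓ.len_pos h1
    simp only [SimpleGraph.Walk.edges_cons, List.map_cons, List.sum_cons]
    rcases hΓ.modular.dist_adj h1 q with h | h
    · rw [hΓ.sum_len_geodesic_unique w' (.cons h1 g) hw' (by simp; omega)]
      simp only [SimpleGraph.Walk.edges_cons, List.map_cons, List.sum_cons]
      linarith
    · rw [hΓ.sum_len_geodesic_unique g (.cons h1.symm w') hg (by simp; omega)] at h2
      simp only [SimpleGraph.Walk.edges_cons, List.map_cons, List.sum_cons] at h2
      rw [Sym2.eq_swap] at h2
      linarith

theorem dist_eq_sum_len {p q : V} (w : Γ.graph.Walk p q) (hw : w.length = Γ.graph.dist p q) :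
    Γ.dist p q = (w.edges.map Γ.len).sum := by
  refine _root_.le_antisymm (weightedDist_le_of_walk (fun e he => (hΓ.pos e he).le) w) ?_
  have : Nonempty (Γ.graph.Walk p q) := ⟨w⟩
  exact le_ciInf fun w' => hΓ.sum_len_geodesic_le w' w hw

theorem dist_self (p : V) : Γ.dist p p = 0 := by
  rw [hΓ.dist_eq_sum_len (.nil : Γ.graph.Walk p p) (by simp)]
  simp

theorem dist_comm (p q : V) : Γ.dist p q = Γ.dist q p := by
  obtain ⟨w, hw⟩ := hΓ.connected.exists_walk_length_eq_dist p q
  rw [hΓ.dist_eq_sum_len w hw, hΓ.dist_eq_sum_len w.reverse (by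
    rw [SimpleGraph.Walk.length_reverse, hw, SimpleGraph.dist_comm])]
  simp

theorem dist_step {p p' z : V} (h : Γ.graph.Adj p p')
    (hd : Γ.graph.dist p' z + 1 = Γ.graph.dist p z) :
    Γ.dist p z = Γ.len s(p, p') + Γ.dist p' z := by
  obtain ⟨w, hw⟩ := hΓ.connected.exists_walk_length_eq_dist p' z
  rw [hΓ.dist_eq_sum_len w hw, hΓ.dist_eq_sum_len (.cons h w) (by simp; omega)]
  simp

/-- Computation of `Γ.dist` by a function with the same increments. -/
theorem dist_eq_of_step {z : V} {f : V → ℝ} (h0 : f z = 0)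
    (hf : ∀ p p', Γ.graph.Adj p p' → Γ.graph.dist p' z + 1 = Γ.graph.dist p z →
      f p = Γ.len s(p, p') + f p') (p : V) : Γ.dist p z = f p := by
  induction hn : Γ.graph.dist p z generalizing p with
  | zero =>
    obtain rfl := hΓ.connected.dist_eq_zero_iff.1 hn
    rw [hΓ.dist_self, h0]
  | succ n ih =>
    have hne : p ≠ z := by rintro rfl; simp at hn
    obtain ⟨p', h1, h2⟩ := exists_adj_dist_add_one hΓ.connected hne
    rw [hΓ.dist_step h1 h2, hf p p' h1 h2, ih p' (by omega)]

theorem dist_add_of_between {p r q : V}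
    (h : Γ.graph.dist p r + Γ.graph.dist r q = Γ.graph.dist p q) :
    Γ.dist p r + Γ.dist r q = Γ.dist p q := by
  obtain ⟨w, hw⟩ := hΓ.connected.exists_walk_length_eq_dist p r
  obtain ⟨w', hw'⟩ := hΓ.connected.exists_walk_length_eq_dist r q
  rw [hΓ.dist_eq_sum_len w hw, hΓ.dist_eq_sum_len w' hw', hΓ.dist_eq_sum_len (w.append w') (by
    rw [SimpleGraph.Walk.length_append]; omega)]
  simp [SimpleGraph.Walk.edges_append]

theorem dist_pos {p q : V} (h : p ≠ q) : 0 < Γ.dist p q := by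
  obtain ⟨w, hw⟩ := hΓ.connected.exists_walk_length_eq_dist p q
  rw [hΓ.dist_eq_sum_len w hw]
  refine List.sum_pos _ (fun x hx => ?_) ?_
  · obtain ⟨e, he, rfl⟩ := List.mem_map.1 hx
    exact hΓ.pos e (w.edges_subset_edgeSet he)
  · cases w with
    | nil => exact absurd rfl h
    | cons => simp

/-- Opposite sides of the square formed by `a`, `b`, their meet and their join have the same
weighted length. -/
theorem weighted_dist_isMeet_isJoin {a b m j : V} (hm : Γ.IsMeet a b m) (hj : Γ.IsJoin a b j) :
    Γ.dist m a = Γ.dist b j := by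
  have h1 := hΓ.dist_add_of_between (hΓ.isMeet_between hm)
  have h2 := hΓ.dist_add_of_between (hΓ.isJoin_between hj)
  have h3 := hΓ.dist_add_of_between (hΓ.dist_add_of_le hm.1 hj.1)
  have h4 := hΓ.dist_add_of_between (hΓ.dist_add_of_le hm.2.1 hj.2.1)
  have e1 := hΓ.dist_comm m a
  have e2 := hΓ.dist_comm b j
  linarith

end IsModularComplex

end ComplexData

end LConvexity

namespace LConvexity

/-! ### Meets, joins and distances in semilattices with a valuation -/

section Semilattice

variable {L : Type*} [Preorder L]

variable (L) in
/-- Meet-semilattices in which pairs with an upper bound have a join. -/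
structure IsBoundedJoinSemilattice : Prop where
  antisymm : ∀ a b : L, a ≤ b → b ≤ a → a = b
  exists_meet : ∀ a b : L, ∃ m, IsGLB {a, b} m
  exists_join : ∀ p a b : L, a ≤ p → b ≤ p → ∃ j, IsLUB {a, b} j

theorem IsModularSemilattice.toIsBoundedJoinSemilattice (h : IsModularSemilattice L) :
    IsBoundedJoinSemilattice L := ⟨h.antisymm, h.exists_meet, h.exists_join⟩

theorem bddAbove_pair {a b p : L} (ha : a ≤ p) (hb : b ≤ p) : BddAbove {a, b} :=
  ⟨p, by rintro x (rfl | rfl); exacts [ha, hb]⟩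

theorem bddAbove_pair_iff {a b : L} : BddAbove {a, b} ↔ ∃ p, a ≤ p ∧ b ≤ p :=
  ⟨fun ⟨p, hp⟩ => ⟨p, hp (by simp), hp (by simp)⟩, fun ⟨_, h1, h2⟩ => bddAbove_pair h1 h2⟩

theorem isGLB_pair {a b m : L} : IsGLB {a, b} m ↔ m ≤ a ∧ m ≤ b ∧ ∀ c, c ≤ a → c ≤ b → c ≤ m := by
  constructor
  · intro h
    refine ⟨h.1 (by simp), h.1 (by simp), fun c h1 h2 => h.2 ?_⟩
    rintro x (rfl | rfl)
    exacts [h1, h2]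
  · rintro ⟨h1, h2, h3⟩
    refine ⟨?_, fun c hc => h3 c (hc (by simp)) (hc (by simp))⟩
    rintro x (rfl | rfl)
    exacts [h1, h2]

theorem isLUB_pair' {a b m : L} :
    IsLUB {a, b} m ↔ a ≤ m ∧ b ≤ m ∧ ∀ c, a ≤ c → b ≤ c → m ≤ c := by
  constructor
  · intro h
    refine ⟨h.1 (by simp), h.1 (by simp), fun c h1 h2 => h.2 ?_⟩
    rintro x (rfl | rfl)
    exacts [h1, h2]
  · rintro ⟨h1, h2, h3⟩
    refine ⟨?_, fun c hc => h3 c (hc (by simp)) (hc (by simp))⟩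
    rintro x (rfl | rfl)
    exacts [h1, h2]

namespace IsBoundedJoinSemilattice

variable (H : IsBoundedJoinSemilattice L)
include H

theorem isGLB_meet (a b : L) : IsGLB {a, b} (meet a b) := by
  rw [meet, dif_pos (H.exists_meet a b)]
  exact (H.exists_meet a b).choose_spec

theorem meet_le_left (a b : L) : meet a b ≤ a := (isGLB_pair.1 (H.isGLB_meet a b)).1

theorem meet_le_right (a b : L) : meet a b ≤ b := (isGLB_pair.1 (H.isGLB_meet a b)).2.1

theorem le_meet {a b c : L} (h : c ≤ a) (h' : c ≤ b) : c ≤ meet a b :=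
  (isGLB_pair.1 (H.isGLB_meet a b)).2.2 c h h'

theorem meet_eq {a b m : L} (h : IsGLB {a, b} m) : meet a b = m := by
  obtain ⟨h1, h2, h3⟩ := isGLB_pair.1 h
  exact H.antisymm _ _ (h3 _ (H.meet_le_left a b) (H.meet_le_right a b)) (H.le_meet h1 h2)

theorem meet_comm (a b : L) : meet a b = meet b a :=
  H.meet_eq (by rw [Set.pair_comm]; exact H.isGLB_meet b a)

theorem meet_of_le {a b : L} (h : a ≤ b) : meet a b = a :=
  H.meet_eq (isGLB_pair.2 ⟨le_rfl, h, fun _ h _ => h⟩)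

theorem meet_mono {a b c e : L} (h : a ≤ c) (h' : b ≤ e) : meet a b ≤ meet c e :=
  H.le_meet ((H.meet_le_left a b).trans h) ((H.meet_le_right a b).trans h')

theorem isLUB_join {a b : L} (h : BddAbove {a, b}) : IsLUB {a, b} (join a b) := by
  obtain ⟨p, ha, hb⟩ := bddAbove_pair_iff.1 h
  rw [join, dif_pos (H.exists_join p a b ha hb)]
  exact (H.exists_join p a b ha hb).choose_spec

theorem le_join_left {a b : L} (h : BddAbove {a, b}) : a ≤ join a b :=
  (isLUB_pair'.1 (H.isLUB_join h)).1

theorem le_join_right {a b : L} (h : BddAbove {a, b}) : b ≤ join a b :=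
  (isLUB_pair'.1 (H.isLUB_join h)).2.1

theorem join_le {a b c : L} (h : a ≤ c) (h' : b ≤ c) : join a b ≤ c :=
  (isLUB_pair'.1 (H.isLUB_join (bddAbove_pair h h'))).2.2 c h h'

theorem join_eq {a b j : L} (h : IsLUB {a, b} j) : join a b = j := by
  obtain ⟨h1, h2, h3⟩ := isLUB_pair'.1 h
  have hb := bddAbove_pair h1 h2
  exact H.antisymm _ _ (H.join_le h1 h2) (h3 _ (H.le_join_left hb) (H.le_join_right hb))

variable {v : L → ℝ} (hv : IsValuation v)
include hv

theorem val_mono {a b : L} (h : a ≤ b) : v a ≤ v b := by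
  by_cases h' : b ≤ a
  · rw [H.antisymm a b h h']
  · linarith [hv.pos a b (lt_of_le_not_ge h h')]

theorem eq_of_le_of_val {a b : L} (h : a ≤ b) (h' : v b ≤ v a) : a = b := by
  by_contra hne
  have := hv.pos a b (lt_of_le_not_ge h fun h'' => hne (H.antisymm a b h h''))
  linarith

theorem val_isLUB {a b j : L} (h : IsLUB {a, b} j) : v a + v b = v (meet a b) + v j := by
  rw [hv.modular a b ⟨j, h.1⟩, H.join_eq h]

/-- The left side lies below the right side and the valuation agrees on them, so strict monotonicity
makes them equal. -/
theorem modular_law {p a b c : L} (ha : a ≤ p) (hb : b ≤ p) (hc : c ≤ p) (hac : a ≤ c) :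
    join a (meet b c) = meet (join a b) c := by
  have hab := bddAbove_pair ha hb
  have hbc := bddAbove_pair hb hc
  have h1 : BddAbove {a, meet b c} := bddAbove_pair ha ((H.meet_le_left b c).trans hb)
  have hjp : join a b ≤ p := H.join_le ha hb
  have e1 := H.val_isLUB hv (H.isLUB_join h1)
  have e2 := H.val_isLUB hv (H.isLUB_join (bddAbove_pair hjp hc))
  have e3 := H.val_isLUB hv (H.isLUB_join hab)
  have e4 := H.val_isLUB hv (H.isLUB_join hbc)
  have e5 : meet a (meet b c) = meet a b :=
    H.antisymm _ _ (H.meet_mono le_rfl (H.meet_le_left b c))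
      (H.le_meet (H.meet_le_left a b) (H.le_meet (H.meet_le_right a b)
        ((H.meet_le_left a b).trans hac)))
  have e6 : join (join a b) c = join b c := by
    have h2 := bddAbove_pair hjp hc
    refine H.antisymm _ _ (H.join_le (H.join_le ?_ ?_) ?_) (H.join_le ?_ ?_)
    · exact hac.trans (H.le_join_right hbc)
    · exact H.le_join_left hbc
    · exact H.le_join_right hbc
    · exact (H.le_join_right hab).trans (H.le_join_left h2)
    · exact H.le_join_right h2
  rw [e5] at e1
  rw [e6] at e2
  refine H.eq_of_le_of_val hv (H.le_meet ?_ ?_) (by linarith)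
  · exact H.join_le (H.le_join_left hab) ((H.meet_le_left b c).trans (H.le_join_right hab))
  · exact H.join_le hac (H.meet_le_right b c)

/-- The triangle inequality for `v a + v b - 2 v (a ∧ b)`. -/
theorem val_meet_add_le (p q r : L) :
    v (meet p r) + v (meet q r) ≤ v r + v (meet p q) := by
  have hb := bddAbove_pair (H.meet_le_right p r) (H.meet_le_right q r)
  have h1 := H.val_isLUB hv (H.isLUB_join hb)
  have h2 := H.val_mono hv (H.join_le (H.meet_le_right p r) (H.meet_le_right q r))
  have h3 := H.val_mono hv (H.meet_mono (H.meet_le_left p r) (H.meet_le_left q r))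
  linarith

/-- The equality case of `val_meet_add_le`: both monotone estimates in its proof become equalities.
-/
theorem isLUB_of_val_meet_add (p q r : L)
    (h : v r + v (meet p q) ≤ v (meet p r) + v (meet q r)) :
    IsLUB {meet p r, meet q r} r ∧ meet p q ≤ r := by
  have hb := bddAbove_pair (H.meet_le_right p r) (H.meet_le_right q r)
  have h1 := H.val_isLUB hv (H.isLUB_join hb)
  have h2' := H.join_le (H.meet_le_right p r) (H.meet_le_right q r)
  have h2 := H.val_mono hv h2'
  have h3' := H.meet_mono (H.meet_le_left p r) (H.meet_le_left q r)
  have h3 := H.val_mono hv h3'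
  have e1 := H.eq_of_le_of_val hv h2' (by linarith)
  have e2 := H.eq_of_le_of_val hv h3' (by linarith)
  refine ⟨?_, e2 ▸ (H.meet_le_left _ _).trans (H.meet_le_right p r)⟩
  have := H.isLUB_join hb
  rwa [e1] at this

/-! ### Distances and metric intervals in the covering graph. -/

theorem exists_walk_of_le [Finite L] {a b : L} (h : a ≤ b) :
    ∃ w : (SimpleGraph.hasse L).Walk a b, (w.edges.map
      (Sym2.lift ⟨fun a b => |v a - v b|, fun a b => abs_sub_comm (v a) (v b)⟩)).sum =
        v b - v a := by
  induction a using (Finite.to_wellFoundedGT (α := L)).wf.induction with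
  | _ a ih =>
    by_cases hab : b ≤ a
    · obtain rfl := H.antisymm a b h hab
      exact ⟨.nil, by simp⟩
    · obtain ⟨c, ⟨hac, hcb⟩, hmin⟩ := (Finite.to_wellFoundedLT (α := L)).wf.has_min
        {c | a < c ∧ c ≤ b} ⟨b, lt_of_le_not_ge h hab, le_rfl⟩
      have hcov : a ⋖ c := ⟨hac, fun d h1 h2 => hmin d ⟨h1, h2.le.trans hcb⟩ h2⟩
      obtain ⟨w, hw⟩ := ih c hac hcb
      have hadj : (SimpleGraph.hasse L).Adj a c := Or.inl hcov
      refine ⟨.cons hadj w, ?_⟩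
      have := hv.pos a c hac
      rw [SimpleGraph.Walk.edges_cons, List.map_cons, List.sum_cons, hw, Sym2.lift_mk]
      simp only
      rw [abs_of_neg (by linarith)]
      ring

/-- The walk down to p ∧ q and up again has this length. No walk is shorter, since the right side
satisfies the triangle inequality and gives each covering edge its length. -/
theorem latticeDist_eq [Finite L] (p q : L) :
    latticeDist v p q = v p + v q - 2 * v (meet p q) := by
  set ℓ : Sym2 L → ℝ :=
    Sym2.lift ⟨fun a b => |v a - v b|, fun a b => abs_sub_comm (v a) (v b)⟩ with hℓ
  have hnn : ∀ e, 0 ≤ ℓ e := fun e => by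
    induction e with
    | _ a b => rw [hℓ, Sym2.lift_mk]; exact abs_nonneg _
  have hlb : ∀ {a b : L} (w : (SimpleGraph.hasse L).Walk a b),
      v a + v b - 2 * v (meet a b) ≤ (w.edges.map ℓ).sum := by
    intro a b w
    induction w with
    | nil => simp [H.meet_of_le le_rfl, two_mul]
    | @cons a c b h w ih =>
      rw [SimpleGraph.Walk.edges_cons, List.map_cons, List.sum_cons]
      have h1 := H.val_meet_add_le hv a b c
      rw [H.meet_comm b c] at h1
      have h2 : ℓ s(a, c) = v a + v c - 2 * v (meet a c) := by
        rw [hℓ, Sym2.lift_mk]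
        simp only
        rcases h with h | h
        · have := hv.pos _ _ h.1
          rw [H.meet_of_le h.1.le, abs_of_neg (by linarith)]
          ring
        · have := hv.pos _ _ h.1
          rw [H.meet_comm, H.meet_of_le h.1.le, abs_of_pos (by linarith)]
          ring
      linarith
  obtain ⟨w1, h1⟩ := H.exists_walk_of_le hv (H.meet_le_left p q)
  obtain ⟨w2, h2⟩ := H.exists_walk_of_le hv (H.meet_le_right p q)
  rw [← hℓ] at h1 h2
  refine le_antisymm ?_ ?_
  · refine (weightedDist_le_of_walk (fun e _ => hnn e) (w1.reverse.append w2)).trans ?_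
    rw [SimpleGraph.Walk.edges_append, List.map_append, List.sum_append,
      SimpleGraph.Walk.edges_reverse, List.map_reverse, List.sum_reverse, h1, h2]
    linarith
  · have : Nonempty ((SimpleGraph.hasse L).Walk p q) := ⟨w1.reverse.append w2⟩
    exact le_ciInf fun w => hlb w

theorem mem_interval_iff [Finite L] {p q u : L} : u ∈ interval v p q ↔
    IsLUB {meet u p, meet u q} u ∧ meet p q ≤ u := by
  have e : u ∈ interval v p q ↔ latticeDist v p u + latticeDist v u q = latticeDist v p q :=
    Iff.rfl
  rw [e, H.latticeDist_eq hv, H.latticeDist_eq hv, H.latticeDist_eq hv, H.meet_comm u p,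
    H.meet_comm u q]
  constructor
  · intro h
    exact H.isLUB_of_val_meet_add hv p q u (by linarith)
  · rintro ⟨h1, h2⟩
    have h3 := H.val_isLUB hv h1
    have h4 : meet (meet p u) (meet q u) = meet p q :=
      H.antisymm _ _ (H.meet_mono (H.meet_le_left p u) (H.meet_le_left q u))
        (H.le_meet (H.le_meet (H.meet_le_left p q) h2) (H.le_meet (H.meet_le_right p q) h2))
    rw [h4] at h3
    linarith

/-- Elements of I(p,q) thus amount to pairs (a,b) in [p ∧ q, p] × [p ∧ q, q] with an upper bound,
and optimizing over I(p,q) means optimizing over such pairs. -/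
theorem isLUB_mem_interval [Finite L] {p q a b u : L} (ha : meet p q ≤ a) (hap : a ≤ p)
    (hb : meet p q ≤ b) (hbq : b ≤ q) (hu : IsLUB {a, b} u) :
    u ∈ interval v p q ∧ meet u p = a ∧ meet u q = b := by
  obtain ⟨hau, hbu, -⟩ := isLUB_pair'.1 hu
  have h1 := H.val_isLUB hv hu
  have h2 : meet a b = meet p q :=
    H.antisymm _ _ (H.meet_mono hap hbq) (H.le_meet ha hb)
  have h3 := H.val_meet_add_le hv p q u
  have hau' := H.le_meet hau hap
  have hbu' := H.le_meet hbu hbq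
  have h4 := H.val_mono hv hau'
  have h5 := H.val_mono hv hbu'
  rw [H.meet_comm p u, H.meet_comm q u] at h3
  rw [h2] at h1
  have e1 := H.eq_of_le_of_val hv hau' (by linarith)
  have e2 := H.eq_of_le_of_val hv hbu' (by linarith)
  exact ⟨(H.mem_interval_iff hv).2 ⟨by rwa [← e1, ← e2], ha.trans hau⟩, e1.symm, e2.symm⟩

end IsBoundedJoinSemilattice

end Semilattice

end LConvexity

namespace LConvexity

/-! ### Values of normal cones -/

/-- The function sin / (cos + sin) that measures cones runs continuously from 0 to 1 on [0, π/2].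
The direction of angle α normalizes to (1 - τ, τ). -/
theorem exists_angle {τ : ℝ} (h0 : 0 ≤ τ) (h1 : τ ≤ 1) : ∃ α, 0 ≤ α ∧ α ≤ Real.pi / 2 ∧
    0 < Real.cos α + Real.sin α ∧ Real.sin α = τ * (Real.cos α + Real.sin α) ∧
    Real.cos α = (1 - τ) * (Real.cos α + Real.sin α) := by
  have hpos : ∀ α ∈ Set.Icc 0 (Real.pi / 2), 0 < Real.cos α + Real.sin α := by
    intro α hα
    have c : 0 ≤ Real.cos α := Real.cos_nonneg_of_mem_Icc ⟨by linarith [hα.1, Real.pi_pos], hα.2⟩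
    have s : 0 ≤ Real.sin α :=
      Real.sin_nonneg_of_nonneg_of_le_pi hα.1 (by linarith [Real.pi_pos, hα.2])
    nlinarith [Real.sin_sq_add_cos_sq α]
  have hcont : ContinuousOn (fun α => Real.sin α / (Real.cos α + Real.sin α))
      (Set.Icc 0 (Real.pi / 2)) :=
    Real.continuous_sin.continuousOn.div (Real.continuous_cos.add
      Real.continuous_sin).continuousOn fun α hα => (hpos α hα).ne'
  have hle : (0 : ℝ) ≤ Real.pi / 2 := by linarith [Real.pi_pos]
  have := intermediate_value_Icc hle hcont
  simp only [Real.sin_zero, Real.cos_zero, zero_div, Real.sin_pi_div_two, Real.cos_pi_div_two,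
    zero_add, div_one] at this
  obtain ⟨α, hα, h⟩ := this ⟨h0, h1⟩
  have hp := hpos α hα
  simp only at h
  rw [div_eq_iff hp.ne'] at h
  exact ⟨α, hα.1, hα.2, hp, h, by linarith⟩

section Semilattice

variable {L : Type*} [Preorder L]

/-- The weight `(1 - t) v a + t v b` of a pair `(a,b)`. -/
def pairWeight (v : L → ℝ) (t : ℝ) (a b : L) : ℝ := (1 - t) * v a + t * v b

/-- The parameters `t` for which `u` maximizes the weight over the metric interval. -/
def optParams (v : L → ℝ) (p q u : L) : Set ℝ :=
  {t | t ∈ Set.Icc (0 : ℝ) 1 ∧ ∀ u' ∈ interval v p q,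
    pairWeight v t (meet u' p) (meet u' q) ≤ pairWeight v t (meet u p) (meet u q)}

/-- Scaling w to coordinate sum 1 gives (1 - t, t); the constant v(p ∧ q) in the vectors drops out
of the comparison. -/
theorem mem_normalCone_iff {v : L → ℝ} {p q u : L} {w : ℝ × ℝ} (h1 : 0 ≤ w.1) (h2 : 0 ≤ w.2)
    (h : 0 < w.1 + w.2) :
    w ∈ normalCone v p q u ↔ w.2 / (w.1 + w.2) ∈ optParams v p q u := by
  have e : 1 - w.2 / (w.1 + w.2) = w.1 / (w.1 + w.2) := by field_simp; ring
  have key : ∀ x y x' y' : ℝ, (w.1 / (w.1 + w.2) * x + w.2 / (w.1 + w.2) * y ≤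
      w.1 / (w.1 + w.2) * x' + w.2 / (w.1 + w.2) * y' ↔
      w.1 * x + w.2 * y ≤ w.1 * x' + w.2 * y') := by
    intro x y x' y'
    rw [div_mul_eq_mul_div, div_mul_eq_mul_div, div_mul_eq_mul_div, div_mul_eq_mul_div,
      ← add_div, ← add_div, div_le_div_iff_of_pos_right h]
  constructor
  · rintro ⟨-, -, h3⟩
    refine ⟨⟨by positivity, ?_⟩, fun u' hu' => ?_⟩
    · rw [div_le_one h]; linarith
    · rw [pairWeight, pairWeight, e, key]
      have := h3 u' hu'
      simp only [vec] at this
      linarith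
  · rintro ⟨-, h3⟩
    refine ⟨h1, h2, fun u' hu' => ?_⟩
    have := h3 u' hu'
    rw [pairWeight, pairWeight, e, key] at this
    simp only [vec]
    linarith

/-- The cone is the sector between the angles that belong to τ₀ and τ₁, and the value of a sector is
the difference of exactly these parameters. -/
theorem coneValue_normalCone_of_Icc {v : L → ℝ} {p q u : L} {τ₀ τ₁ : ℝ} (h : τ₀ ≤ τ₁)
    (hT : optParams v p q u = Set.Icc τ₀ τ₁) : coneValue (normalCone v p q u) = τ₁ - τ₀ := by
  have h0 : τ₀ ∈ optParams v p q u := hT ▸ ⟨le_rfl, h⟩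
  have h1 : τ₁ ∈ optParams v p q u := hT ▸ ⟨h, le_rfl⟩
  obtain ⟨α, a1, a2, a3, a4, a5⟩ := exists_angle h1.1.1 h1.1.2
  obtain ⟨β, b1, b2, b3, b4, b5⟩ := exists_angle h0.1.1 h0.1.2
  -- sin (β - α) is a positive multiple of τ₀ - τ₁, so angles are ordered like parameters.
  have hαβ : β ≤ α := by
    by_contra hlt
    push Not at hlt
    have : 0 < Real.sin (β - α) :=
      Real.sin_pos_of_pos_of_lt_pi (by linarith) (by linarith [Real.pi_pos])
    have e : Real.sin (β - α) = ((Real.cos α + Real.sin α) * (Real.cos β + Real.sin β)) *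
        (τ₀ - τ₁) := by
      rw [Real.sin_sub]
      linear_combination b4 * Real.cos α + τ₀ * (Real.cos β + Real.sin β) * a5 -
        b5 * Real.sin α - (1 - τ₀) * (Real.cos β + Real.sin β) * a4
    rw [e] at this
    nlinarith [mul_pos a3 b3]
  have hC : normalCone v p q u = sector α β := by
    ext w
    by_cases hw : 0 ≤ w.1 ∧ 0 ≤ w.2
    · obtain ⟨hw1, hw2⟩ := hw
      rcases (add_nonneg hw1 hw2).eq_or_lt with hs | hs
      · have e1 : w.1 = 0 := by linarith
        have e2 : w.2 = 0 := by linarith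
        simp [normalCone, sector, e1, e2]
      · rw [mem_normalCone_iff hw1 hw2 hs, hT, Set.mem_Icc, div_le_iff₀ hs, le_div_iff₀ hs]
        have k1 : -w.1 * Real.sin α + w.2 * Real.cos α ≤ 0 ↔ w.2 ≤ τ₁ * (w.1 + w.2) := by
          have : -w.1 * Real.sin α + w.2 * Real.cos α =
              (Real.cos α + Real.sin α) * (w.2 - τ₁ * (w.1 + w.2)) := by
            linear_combination -w.1 * a4 + w.2 * a5
          rw [this]
          constructor
          · intro h'; nlinarith
          · intro h'; nlinarith
        have k2 : 0 ≤ -w.1 * Real.sin β + w.2 * Real.cos β ↔ τ₀ * (w.1 + w.2) ≤ w.2 := by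
          have : -w.1 * Real.sin β + w.2 * Real.cos β =
              (Real.cos β + Real.sin β) * (w.2 - τ₀ * (w.1 + w.2)) := by
            linear_combination -w.1 * b4 + w.2 * b5
          rw [this]
          constructor
          · intro h'; nlinarith
          · intro h'; nlinarith
        simp only [sector, Set.mem_ofPred_eq, k1, k2, hw1, hw2, true_and]
        exact and_comm
    · constructor
      · intro h'; exact absurd ⟨h'.1, h'.2.1⟩ hw
      · intro h'; exact absurd ⟨h'.1, h'.2.1⟩ hw
  rw [hC, coneValue_sector b1 hαβ a2]
  have e1 : Real.sin α / (Real.cos α + Real.sin α) = τ₁ := by rw [div_eq_iff a3.ne']; exact a4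
  have e2 : Real.sin β / (Real.cos β + Real.sin β) = τ₀ := by rw [div_eq_iff b3.ne']; exact b4
  rw [e1, e2]

/-- Every sector contains the unit vector of angle α. A cone without nonzero directions is therefore
no sector and takes the default value. -/
theorem coneValue_normalCone_of_empty {v : L → ℝ} {p q u : L} (hT : optParams v p q u = ∅) :
    coneValue (normalCone v p q u) = 0 := by
  rw [coneValue, dif_neg]
  rintro ⟨t, h1, h2, h3, h4⟩
  have c : 0 ≤ Real.cos t.1 := Real.cos_nonneg_of_mem_Icc ⟨by linarith [Real.pi_pos], h3⟩
  have s : 0 ≤ Real.sin t.1 :=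
    Real.sin_nonneg_of_nonneg_of_le_pi (by linarith) (by linarith [Real.pi_pos])
  have hmem : (Real.cos t.1, Real.sin t.1) ∈ normalCone v p q u := by
    rw [h4]
    refine ⟨c, s, by simp only; linarith, ?_⟩
    have : 0 ≤ Real.sin (t.1 - t.2) :=
      Real.sin_nonneg_of_nonneg_of_le_pi (by linarith) (by linarith [Real.pi_pos])
    rw [Real.sin_sub] at this
    simp only
    linarith
  rw [mem_normalCone_iff c s (by nlinarith [Real.sin_sq_add_cos_sq t.1]), hT] at hmem
  exact hmem

/-- Each competitor imposes an affine inequality on t, so the set is a compact convex part of [0,1].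
-/
theorem optParams_eq_Icc {v : L → ℝ} {p q u : L} (hne : (optParams v p q u).Nonempty) :
    ∃ τ₀ τ₁, τ₀ ≤ τ₁ ∧ optParams v p q u = Set.Icc τ₀ τ₁ := by
  have hclosed : IsClosed (optParams v p q u) := by
    have : optParams v p q u = Set.Icc 0 1 ∩ ⋂ u' ∈ interval v p q,
        {t | pairWeight v t (meet u' p) (meet u' q) ≤
          pairWeight v t (meet u p) (meet u q)} := by
      ext t
      simp [optParams]
    rw [this]
    refine isClosed_Icc.inter (isClosed_biInter fun u' _ => isClosed_le ?_ ?_) <;>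
    · unfold pairWeight
      fun_prop
  have hcpt : IsCompact (optParams v p q u) :=
    isCompact_Icc.of_isClosed_subset hclosed fun t ht => ht.1
  have h0 := hcpt.sInf_mem hne
  have h1 := hcpt.sSup_mem hne
  refine ⟨sInf (optParams v p q u), sSup (optParams v p q u), csInf_le hcpt.bddBelow h1, Set.Subset.antisymm
    (fun t ht => ⟨csInf_le hcpt.bddBelow ht, le_csSup hcpt.bddAbove ht⟩) fun t ht => ?_⟩
  generalize sInf (optParams v p q u) = x at *
  generalize sSup (optParams v p q u) = y at *
  refine ⟨⟨h0.1.1.trans ht.1, ht.2.trans h1.1.2⟩, fun u' hu' => ?_⟩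
  have k0 := h0.2 u' hu'
  have k1 := h1.2 u' hu'
  rcases ht.1.eq_or_lt with rfl | hxt
  · exact k0
  · have hxy : 0 < y - x := by linarith [ht.2]
    unfold pairWeight at *
    have a1 : 0 ≤ y - t := by linarith [ht.2]
    have a2 : 0 ≤ t - x := by linarith [ht.1]
    have := add_le_add (mul_le_mul_of_nonneg_left k0 a1) (mul_le_mul_of_nonneg_left k1 a2)
    refine le_of_mul_le_mul_left ?_ hxy
    linear_combination this

/-- If `u` is optimal for two parameters, then it belongs to the envelope. -/
theorem mem_envelope {v : L → ℝ} {p q u : L} (hu : u ∈ interval v p q) {s t : ℝ} (hst : s < t)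
    (hs : s ∈ optParams v p q u) (ht : t ∈ optParams v p q u) : u ∈ envelope v p q := by
  have hconv : ∀ r ∈ optParams v p q u, ∀ z ∈ convInterval v p q,
      (1 - r) * z.1 + r * z.2 ≤ (1 - r) * (vec v p q u).1 + r * (vec v p q u).2 := by
    intro r hr z hz
    have hsub : convInterval v p q ⊆
        {z | (1 - r) * z.1 + r * z.2 ≤ (1 - r) * (vec v p q u).1 + r * (vec v p q u).2} := by
      refine convexHull_min ?_ ?_
      · rintro _ ⟨u', hu', rfl⟩
        have := hr.2 u' hu'
        simp only [pairWeight] at this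
        simp only [vec, Set.mem_ofPred_eq]
        linarith
      · intro x hx y hy a b ha hb hab
        simp only [Set.mem_ofPred_eq, Prod.fst_add, Prod.snd_add, Prod.smul_fst, Prod.smul_snd,
          smul_eq_mul] at *
        have := add_le_add (mul_le_mul_of_nonneg_left hx ha) (mul_le_mul_of_nonneg_left hy hb)
        rw [← add_mul, hab, one_mul] at this
        linarith
    exact hsub hz
  refine ⟨hu, ⟨subset_convexHull ℝ _ ⟨u, hu, rfl⟩, ?_⟩, fun ε h1 h2 hmem => ?_⟩
  · rintro x hx y hy ⟨a, b, ha, hb, hab, hxy⟩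
    have e1 := congrArg Prod.fst hxy
    have e2 := congrArg Prod.snd hxy
    simp only [Prod.fst_add, Prod.snd_add, Prod.smul_fst, Prod.smul_snd, smul_eq_mul] at e1 e2
    have key : ∀ r ∈ optParams v p q u,
        (1 - r) * x.1 + r * x.2 = (1 - r) * (vec v p q u).1 + r * (vec v p q u).2 := by
      intro r hr
      have h1 := hconv r hr x hx
      have h2 := hconv r hr y hy
      refine le_antisymm h1 (le_of_mul_le_mul_left ?_ ha)
      have h3 := mul_le_mul_of_nonneg_left h2 hb.le
      have hb' : b = 1 - a := by linarith
      rw [← e1, ← e2] at h3 ⊢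
      subst hb'
      linarith
    -- The points x and `vec v p q u` agree under the functionals of s and of t, a linear system
    -- with determinant t - s.
    have k1 := key s hs
    have k2 := key t ht
    have hne : t - s ≠ 0 := by linarith
    refine Prod.ext ?_ ?_
    · refine mul_left_cancel₀ hne ?_
      linear_combination t * k1 - s * k2
    · refine mul_left_cancel₀ hne ?_
      linear_combination (1 - s) * k2 - (1 - t) * k1
  · have h3 := hconv s hs _ hmem
    have h4 := hconv t ht _ hmem
    simp only [Prod.fst_add, Prod.snd_add] at h3 h4
    have hs0 : 0 ≤ s := hs.1.1
    -- As s < t ≤ 1, a shift by ε strictly raises the functional of s.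
    have hs1 : 0 < 1 - s := by linarith [ht.1.2]
    nlinarith [mul_pos hs1 h1, mul_nonneg hs0 h2.le]

end Semilattice

/-- Telescoping over finitely many intervals that tile `[0,b]`. -/
theorem sum_le_of_tiling {ι : Type*} [DecidableEq ι] {c₀ : ℝ} (G : ι → ℝ → ℝ) (τ₀ τ₁ : ι → ℝ)
    (S : Finset ι) (h0 : ∀ u ∈ S, 0 ≤ τ₀ u) (h1 : ∀ u ∈ S, τ₀ u < τ₁ u)
    (hdisj : ∀ u ∈ S, ∀ w ∈ S, u ≠ w → τ₁ u ≤ τ₀ w ∨ τ₁ w ≤ τ₀ u)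
    (hstart : ∀ u ∈ S, τ₀ u = 0 → c₀ ≤ G u 0)
    (hstep : ∀ u ∈ S, ∀ w ∈ S, τ₁ u = τ₀ w → G u (τ₁ u) ≤ G w (τ₁ u))
    {b c₁ : ℝ} (hb : 0 ≤ b) (hle : ∀ u ∈ S, τ₁ u ≤ b)
    (hcover : ∃ F : Set ℝ, F.Finite ∧ ∀ t ∈ Set.Icc 0 b, t ∉ F → ∃ u ∈ S, τ₀ u ≤ t ∧ t ≤ τ₁ u)
    (hzero : b = 0 → c₀ ≤ c₁) (hend : ∀ u ∈ S, τ₁ u = b → G u b ≤ c₁) :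
    ∑ u ∈ S, (G u (τ₁ u) - G u (τ₀ u)) ≤ c₁ - c₀ := by
  induction hn : S.card generalizing S b c₁ with
  | zero =>
    rw [Finset.card_eq_zero] at hn
    subst hn
    obtain ⟨F, hF, hcov⟩ := hcover
    -- No tile is left, and the finite set F cannot exhaust [0,b] unless b = 0.
    rcases hb.eq_or_lt with hb | hb
    · simpa using hzero hb.symm
    · obtain ⟨t, ht, htF⟩ := ((Set.Icc_infinite hb).sdiff hF).nonempty
      obtain ⟨u, hu, -⟩ := hcov t ht htF
      simp at hu
  | succ n ih =>
    obtain ⟨F, hF, hcov⟩ := hcover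
    have hSne : S.Nonempty := Finset.card_pos.1 (by omega)
    obtain ⟨u, hu, hmax⟩ := S.exists_max_image τ₁ hSne
    have hub : τ₁ u = b := by
      by_contra hne
      have hlt : τ₁ u < b := lt_of_le_of_ne (hle u hu) hne
      obtain ⟨t, ht, htF⟩ := ((Set.Ioo_infinite hlt).sdiff hF).nonempty
      have hu0 := h0 u hu
      have hu1 := h1 u hu
      obtain ⟨w, hw, -, hw2⟩ := hcov t ⟨by linarith [ht.1], ht.2.le⟩ htF
      linarith [hmax w hw, ht.1]
    have hlast : ∀ w ∈ S, w ≠ u → τ₁ w ≤ τ₀ u := by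
      intro w hw hne
      rcases hdisj u hu w hw (Ne.symm hne) with h | h
      · linarith [h1 w hw, hle w hw]
      · exact h
    have hmem : ∀ {w}, w ∈ S.erase u → w ∈ S := fun h => Finset.mem_of_mem_erase h
    -- Drop the last tile u and continue on [0, τ₀ u], with the value of G u at its left end as the
    -- new bound. The point τ₀ u joins F, since u may be the only tile that covers it.
    have := ih (S.erase u) (fun w hw => h0 w (hmem hw)) (fun w hw => h1 w (hmem hw))
      (fun w hw z hz => hdisj w (hmem hw) z (hmem hz)) (fun w hw => hstart w (hmem hw))
      (fun w hw z hz => hstep w (hmem hw) z (hmem hz)) (b := τ₀ u) (c₁ := G u (τ₀ u)) (h0 u hu)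
      (fun w hw => hlast w (hmem hw) (Finset.ne_of_mem_erase hw))
      ⟨insert (τ₀ u) F, hF.insert _, fun t ht htF => by
        rw [Set.mem_insert_iff, not_or] at htF
        obtain ⟨w, hw, hw1, hw2⟩ := hcov t ⟨ht.1, by
          linarith [ht.2, h1 u hu, hle u hu]⟩ htF.2
        refine ⟨w, Finset.mem_erase.2 ⟨?_, hw⟩, hw1, hw2⟩
        rintro rfl
        exact htF.1 (le_antisymm ht.2 hw1)⟩
      (fun h => by rw [h]; exact hstart u hu h)
      (fun w hw h => by
        have := hstep w (hmem hw) u hu h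
        rwa [h] at this)
      (by rw [Finset.card_erase_of_mem hu, hn]; rfl)
    rw [← Finset.add_sum_erase S _ hu]
    have := hend u hu hub
    rw [hub]
    linarith

end LConvexity

namespace LConvexity

/-! ### A local criterion for submodularity -/

section Semilattice

variable {L : Type*} [Preorder L]

/-- The exchange of a pair `(a',b')` for a pair `(a,b)` of the same weight, where no pair in
between has a larger weight. -/
structure IsOptimalExchange (v : L → ℝ) (t : ℝ) (a a' b b' : L) : Prop where
  le_fst : a ≤ a'
  le_snd : b' ≤ b
  bddAbove : BddAbove {a, b}
  bddAbove' : BddAbove {a', b'}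
  eq : pairWeight v t a b = pairWeight v t a' b'
  optimal : ∀ c e, a ≤ c → c ≤ a' → b' ≤ e → e ≤ b → BddAbove {c, e} →
    pairWeight v t c e ≤ pairWeight v t a b

/-- A local form of submodularity: submodularity on pairs with an upper bound, and a condition on
the optimal exchanges of pairs `(a,b)`. -/
structure IsLocallySubmodular (v f : L → ℝ) : Prop where
  bounded : ∀ a b m j : L, IsGLB {a, b} m → IsLUB {a, b} j → f m + f j ≤ f a + f b
  exchange : ∀ t ∈ Set.Icc (0 : ℝ) 1, ∀ a a' b b' : L, IsOptimalExchange v t a a' b b' →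
    (1 - t) * (f a - f a') ≤ t * (f b - f b')

theorem IsLocallySubmodular.add {v f g : L → ℝ} (hf : IsLocallySubmodular v f)
    (hg : IsLocallySubmodular v g) : IsLocallySubmodular v (fun x => f x + g x) where
  bounded a b m j hm hj := by
    have := hf.bounded a b m j hm hj
    have := hg.bounded a b m j hm hj
    linarith
  exchange t ht a a' b b' h := by
    have := hf.exchange t ht a a' b b' h
    have := hg.exchange t ht a a' b b' h
    linarith

theorem IsLocallySubmodular.const_mul {v f : L → ℝ} (hf : IsLocallySubmodular v f) {r : ℝ}
    (hr : 0 ≤ r) : IsLocallySubmodular v (fun x => r * f x) where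
  bounded a b m j hm hj := by
    have := mul_le_mul_of_nonneg_left (hf.bounded a b m j hm hj) hr
    linarith
  exchange t ht a a' b b' h := by
    have := mul_le_mul_of_nonneg_left (hf.exchange t ht a a' b b' h) hr
    linarith

theorem IsLocallySubmodular.sum {ι : Type*} {v : L → ℝ} {f : ι → L → ℝ} (s : Finset ι)
    (hf : ∀ i ∈ s, IsLocallySubmodular v (f i)) :
    IsLocallySubmodular v (fun x => ∑ i ∈ s, f i x) := by
  classical
  induction s using Finset.induction_on with
  | empty => exact ⟨by simp, by simp⟩
  | insert i s hi ih =>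
    simp only [Finset.sum_insert hi]
    exact (hf i (Finset.mem_insert_self i s)).add
      (ih fun j hj => hf j (Finset.mem_insert_of_mem hj))

namespace IsModularSemilattice

variable (H : IsModularSemilattice L)
include H

theorem exists_upper_bound {a b c : L} (h1 : BddAbove {a, b}) (h2 : BddAbove {b, c})
    (h3 : BddAbove {c, a}) : ∃ u, a ≤ u ∧ b ≤ u ∧ c ≤ u := by
  have H' := H.toIsBoundedJoinSemilattice
  obtain ⟨j, hj⟩ := H.exists_join_triple a b c ⟨_, H'.isLUB_join h1⟩ ⟨_, H'.isLUB_join h2⟩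
    ⟨_, H'.isLUB_join h3⟩
  exact ⟨j, hj.1 (by simp), hj.1 (by simp), hj.1 (by simp)⟩

variable [Finite L] {v : L → ℝ} (hv : IsValuation v)
include hv

theorem pairWeight_le {p q u a b : L} {t : ℝ} (ht : t ∈ optParams v p q u)
    (ha : meet p q ≤ a) (hap : a ≤ p) (hb : meet p q ≤ b) (hbq : b ≤ q) (h : BddAbove {a, b}) :
    pairWeight v t a b ≤ pairWeight v t (meet u p) (meet u q) := by
  have H' := H.toIsBoundedJoinSemilattice
  obtain ⟨h1, h2, h3⟩ := H'.isLUB_mem_interval hv ha hap hb hbq (H'.isLUB_join h)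
  have := ht.2 _ h1
  rwa [h2, h3] at this

theorem exists_mem_optParams (p q : L) {t : ℝ} (ht : t ∈ Set.Icc (0 : ℝ) 1) :
    ∃ u ∈ interval v p q, t ∈ optParams v p q u := by
  have H' := H.toIsBoundedJoinSemilattice
  have hne : (interval v p q).Nonempty :=
    ⟨_, (H'.isLUB_mem_interval hv le_rfl (H'.meet_le_left p q) le_rfl (H'.meet_le_right p q)
      (isLUB_pair'.2 ⟨le_rfl, le_rfl, fun _ h _ => h⟩)).1⟩
  obtain ⟨u, hu, hmax⟩ := Set.exists_max_image (interval v p q)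
    (fun u => pairWeight v t (meet u p) (meet u q)) (Set.toFinite _) hne
  exact ⟨u, hu, ht, hmax⟩

/-- The projections of optimal elements to `p` and `q` are monotone in the parameter. -/
theorem meet_le_of_optParams {p q u w : L} (hu : u ∈ interval v p q) (hw : w ∈ interval v p q)
    {s t : ℝ} (hst : s < t) (hs : s ∈ optParams v p q u) (ht : t ∈ optParams v p q w) :
    meet w p ≤ meet u p ∧ meet u q ≤ meet w q := by
  have H' := H.toIsBoundedJoinSemilattice
  obtain ⟨hu1, hu2⟩ := (H'.mem_interval_iff hv).1 hu
  obtain ⟨hw1, hw2⟩ := (H'.mem_interval_iff hv).1 hw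
  set a := meet u p with ha
  set b := meet u q with hb
  set c := meet w p with hc
  set e := meet w q with he
  have hap : a ≤ p := H'.meet_le_right u p
  have hbq : b ≤ q := H'.meet_le_right u q
  have hcp : c ≤ p := H'.meet_le_right w p
  have heq : e ≤ q := H'.meet_le_right w q
  have hma : meet p q ≤ a := H'.le_meet hu2 (H'.meet_le_left p q)
  have hmb : meet p q ≤ b := H'.le_meet hu2 (H'.meet_le_right p q)
  have hmc : meet p q ≤ c := H'.le_meet hw2 (H'.meet_le_left p q)
  have hme : meet p q ≤ e := H'.le_meet hw2 (H'.meet_le_right p q)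
  have hau : a ≤ u := H'.meet_le_left u p
  have hbu : b ≤ u := H'.meet_le_left u q
  have hcw : c ≤ w := H'.meet_le_left w p
  have hew : e ≤ w := H'.meet_le_left w q
  have hac := bddAbove_pair hap hcp
  have hbe := bddAbove_pair hbq heq
  -- The bounds p for a, c, w for c, b ∧ e and u for b ∧ e, a combine to a common one, so (a ∨ c, b
  -- ∧ e) competes with u at s. Symmetrically, (a ∧ c, b ∨ e) competes with w at t.
  have k1 : BddAbove {join a c, meet b e} := by
    obtain ⟨x, x1, x2, x3⟩ := H.exists_upper_bound hac
      (bddAbove_pair hcw ((H'.meet_le_right b e).trans hew))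
      (bddAbove_pair ((H'.meet_le_left b e).trans hbu) hau)
    exact bddAbove_pair (H'.join_le x1 x2) x3
  have k2 : BddAbove {meet a c, join b e} := by
    obtain ⟨x, x1, x2, x3⟩ := H.exists_upper_bound hbe
      (bddAbove_pair hew ((H'.meet_le_right a c).trans hcw))
      (bddAbove_pair ((H'.meet_le_left a c).trans hau) hbu)
    exact bddAbove_pair x3 (H'.join_le x1 x2)
  have o1 := H.pairWeight_le hv hs (hma.trans (H'.le_join_left hac)) (H'.join_le hap hcp)
    (H'.le_meet hmb hme) ((H'.meet_le_left b e).trans hbq) k1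
  have o2 := H.pairWeight_le hv ht (H'.le_meet hma hmc) ((H'.meet_le_left a c).trans hap)
    (hmb.trans (H'.le_join_left hbe)) (H'.join_le hbq heq) k2
  rw [← ha, ← hb] at o1
  rw [← hc, ← he] at o2
  have e1 := H'.val_isLUB hv (H'.isLUB_join hac)
  have e2 := H'.val_isLUB hv (H'.isLUB_join hbe)
  have m1 := H'.val_mono hv (H'.meet_le_right a c)
  have m2 := H'.val_mono hv (H'.meet_le_left b e)
  have hs0 := hs.1.1
  have ht1 := ht.1.2
  unfold pairWeight at o1 o2
  -- Optimality at s and at t bounds γ and β against each other in opposite senses; together (t - s)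
  -- γ ≤ 0, whence γ = β = 0.
  set γ := v c - v (meet a c) with hγ
  set β := v b - v (meet b e) with hβ
  have i1 : (1 - s) * γ ≤ s * β := by rw [hγ, hβ]; linear_combination o1 + (1 - s) * e1
  have i2 : t * β ≤ (1 - t) * γ := by rw [hγ, hβ]; linear_combination o2 + t * e2
  have hγ0 : 0 ≤ γ := by rw [hγ]; linarith
  have hβ0 : 0 ≤ β := by rw [hβ]; linarith
  have i3 : (t - s) * γ ≤ 0 := by nlinarith
  have hγ1 : γ ≤ 0 := by nlinarith
  have hβ1 : β ≤ 0 := by nlinarith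
  constructor
  · rw [← H'.eq_of_le_of_val hv (H'.meet_le_right a c) (by linarith)]
    exact H'.meet_le_left a c
  · rw [← H'.eq_of_le_of_val hv (H'.meet_le_left b e) (by linarith)]
    exact H'.meet_le_right b e

/-- Monotonicity in both directions makes the projections equal, and an element of the interval is
the join of its projections. Hence tiles overlap in at most a point. -/
theorem eq_of_optParams {p q u w : L} (hu : u ∈ interval v p q) (hw : w ∈ interval v p q)
    {s t : ℝ} (hst : s < t) (hus : s ∈ optParams v p q u) (hut : t ∈ optParams v p q u)
    (hws : s ∈ optParams v p q w) (hwt : t ∈ optParams v p q w) : u = w := by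
  have H' := H.toIsBoundedJoinSemilattice
  obtain ⟨h1, h2⟩ := H.meet_le_of_optParams hv hu hw hst hus hwt
  obtain ⟨h3, h4⟩ := H.meet_le_of_optParams hv hw hu hst hws hut
  have e1 := H'.antisymm _ _ h1 h3
  have e2 := H'.antisymm _ _ h2 h4
  have hu1 := ((H'.mem_interval_iff hv).1 hu).1
  have hw1 := ((H'.mem_interval_iff hv).1 hw).1
  rw [e1, ← e2] at hw1
  rw [← H'.join_eq hu1, H'.join_eq hw1]

/-- Telescoping the potential over the tiles bounds the weighted sum of f(u ∧ p) + f(u ∧ q) by f(p)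
+ f(q). Submodularity on the bounded pairs (u ∧ p, u ∧ q) then replaces each summand by f(u) + f(p ∧
q), and the weights add up to 1. -/
theorem isSubmodular_of_isLocallySubmodular {f : L → ℝ} (hf : IsLocallySubmodular v f) :
    IsSubmodular v f := by
  classical
  have H' := H.toIsBoundedJoinSemilattice
  refine ⟨H, hv, fun p q => ?_⟩
  -- The value of τ is arbitrary at elements that are never optimal; these stay outside S.
  have hends : ∀ u, ∃ τ : ℝ × ℝ, (optParams v p q u).Nonempty →
      τ.1 ≤ τ.2 ∧ optParams v p q u = Set.Icc τ.1 τ.2 := by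
    intro u
    by_cases hne : (optParams v p q u).Nonempty
    · obtain ⟨τ₀, τ₁, h1, h2⟩ := optParams_eq_Icc hne
      exact ⟨(τ₀, τ₁), fun _ => ⟨h1, h2⟩⟩
    · exact ⟨0, fun h => absurd h hne⟩
  choose τ hτ using hends
  have := Fintype.ofFinite L
  let S : Finset L := Finset.univ.filter fun u =>
    u ∈ interval v p q ∧ (optParams v p q u).Nonempty ∧ (τ u).1 < (τ u).2
  have memS : ∀ {u}, u ∈ S → u ∈ interval v p q ∧ optParams v p q u = Set.Icc (τ u).1 (τ u).2 ∧
      (τ u).1 < (τ u).2 ∧ (τ u).1 ∈ optParams v p q u ∧ (τ u).2 ∈ optParams v p q u := by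
    intro u hu
    obtain ⟨-, h1, h2, h3⟩ := Finset.mem_filter.1 hu
    have h4 := (hτ u h2).2
    refine ⟨h1, h4, h3, ?_, ?_⟩
    · rw [h4]; exact ⟨le_rfl, h3.le⟩
    · rw [h4]; exact ⟨h3.le, le_rfl⟩
  -- A tile of positive length puts its element in the envelope, and envelope elements without such
  -- a tile have cone value 0.
  have hfin : ∑ᶠ u ∈ envelope v p q, coneValue (normalCone v p q u) * f u =
      ∑ u ∈ S, ((τ u).2 - (τ u).1) * f u := by
    rw [finsum_mem_eq_sum_of_inter_support_eq (t := S)]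
    · refine Finset.sum_congr rfl fun u hu => ?_
      obtain ⟨-, h2, h3, -⟩ := memS hu
      rw [coneValue_normalCone_of_Icc h3.le h2]
    · ext u
      refine and_congr_left fun hsupp => ⟨fun hu => ?_, fun hu => ?_⟩
      · rw [Function.mem_support] at hsupp
        have hne : coneValue (normalCone v p q u) ≠ 0 := left_ne_zero_of_mul hsupp
        have h1 : (optParams v p q u).Nonempty := by
          by_contra h
          exact hne (coneValue_normalCone_of_empty (Set.not_nonempty_iff_eq_empty.1 h))
        obtain ⟨h2, h3⟩ := hτ u h1
        rw [coneValue_normalCone_of_Icc h2 h3] at hne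
        exact Finset.mem_coe.2 (Finset.mem_filter.2 ⟨Finset.mem_univ u, hu.1, h1,
          lt_of_le_of_ne h2 fun h => hne (by rw [h, sub_self])⟩)
      · obtain ⟨h1, h2, h3, h4, h5⟩ := memS hu
        exact mem_envelope h1 h3 h4 h5
  rw [hfin]
  have h0 : ∀ u ∈ S, 0 ≤ (τ u).1 := fun u hu => (memS hu).2.2.2.1.1.1
  have h1 : ∀ u ∈ S, (τ u).1 < (τ u).2 := fun u hu => (memS hu).2.2.1
  have hle : ∀ u ∈ S, (τ u).2 ≤ 1 := fun u hu => (memS hu).2.2.2.2.1.2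
  have hdisj : ∀ u ∈ S, ∀ w ∈ S, u ≠ w → (τ u).2 ≤ (τ w).1 ∨ (τ w).2 ≤ (τ u).1 := by
    intro u hu w hw hne
    by_contra hcon
    push Not at hcon
    obtain ⟨hu1, hu2, hu3, -⟩ := memS hu
    obtain ⟨hw1, hw2, hw3, -⟩ := memS hw
    have hlt : max (τ u).1 (τ w).1 < min (τ u).2 (τ w).2 :=
      max_lt (lt_min hu3 hcon.2) (lt_min hcon.1 hw3)
    refine hne (H.eq_of_optParams hv hu1 hw1 hlt ?_ ?_ ?_ ?_)
    · rw [hu2]; exact ⟨le_max_left _ _, hlt.le.trans (min_le_left _ _)⟩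
    · rw [hu2]; exact ⟨(le_max_left _ _).trans hlt.le, min_le_left _ _⟩
    · rw [hw2]; exact ⟨le_max_right _ _, hlt.le.trans (min_le_right _ _)⟩
    · rw [hw2]; exact ⟨(le_max_right _ _).trans hlt.le, min_le_right _ _⟩
  have hcover : ∃ F : Set ℝ, F.Finite ∧ ∀ t ∈ Set.Icc (0 : ℝ) 1, t ∉ F →
      ∃ u ∈ S, (τ u).1 ≤ t ∧ t ≤ (τ u).2 := by
    -- Away from the finitely many left ends, an optimality interval that contains t is not a point.
    refine ⟨Set.range fun u => (τ u).1, Set.finite_range _, fun t ht htF => ?_⟩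
    obtain ⟨u, hu, hut⟩ := H.exists_mem_optParams hv p q ht
    obtain ⟨h2, h3⟩ := hτ u ⟨t, hut⟩
    rw [h3] at hut
    refine ⟨u, Finset.mem_filter.2 ⟨Finset.mem_univ u, hu, ⟨t, h3 ▸ hut⟩,
      lt_of_le_of_ne h2 fun h => htF ⟨u, ?_⟩⟩, hut⟩
    exact le_antisymm hut.1 (hut.2.trans h.ge)
  -- The total length is bounded above and below by telescoping t and -t.
  have hone : ∑ u ∈ S, ((τ u).2 - (τ u).1) = 1 := by
    refine le_antisymm ?_ ?_
    · have := sum_le_of_tiling (c₀ := 0) (fun _ t => t) (fun u => (τ u).1) (fun u => (τ u).2) S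
        h0 h1 hdisj (fun _ _ _ => le_rfl) (fun _ _ _ _ _ => le_rfl) (b := 1) (c₁ := 1)
        zero_le_one hle hcover (fun h => absurd h one_ne_zero) (fun _ _ _ => le_rfl)
      simpa using this
    · have := sum_le_of_tiling (c₀ := 0) (fun _ t => -t) (fun u => (τ u).1) (fun u => (τ u).2) S
        h0 h1 hdisj (fun _ _ _ => by simp) (fun _ _ _ _ _ => le_rfl) (b := 1) (c₁ := -1)
        zero_le_one hle hcover (fun h => absurd h one_ne_zero) (fun _ _ _ => le_rfl)
      have h2 : ∑ u ∈ S, (-(τ u).2 - -(τ u).1) = -∑ u ∈ S, ((τ u).2 - (τ u).1) := by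
        rw [← Finset.sum_neg_distrib]
        exact Finset.sum_congr rfl fun _ _ => by ring
      rw [h2] at this
      linarith
  -- At parameter 0 optimality forces u ∧ p = p, and at 1 it forces u ∧ q = q; this gives the end
  -- values of the potential. Between neighboring tiles, the exchange condition applies.
  have hmain : ∑ u ∈ S, ((τ u).2 - (τ u).1) * (f (meet u p) + f (meet u q)) ≤ f q - -f p := by
    have := sum_le_of_tiling (c₀ := -f p)
      (fun u t => -(1 - t) * f (meet u p) + t * f (meet u q))
      (fun u => (τ u).1) (fun u => (τ u).2) S h0 h1 hdisj ?_ ?_ (b := 1) (c₁ := f q)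
      zero_le_one hle hcover (fun h => absurd h one_ne_zero) ?_
    · refine le_trans (le_of_eq (Finset.sum_congr rfl fun u _ => ?_)) this
      ring
    · intro u hu hu0
      obtain ⟨-, -, -, h4, -⟩ := memS hu
      rw [hu0] at h4
      have := H.pairWeight_le hv h4 (H'.meet_le_left p q) le_rfl le_rfl (H'.meet_le_right p q)
        (bddAbove_pair le_rfl (H'.meet_le_left p q))
      simp only [pairWeight, sub_zero, one_mul, zero_mul, add_zero] at this
      rw [H'.eq_of_le_of_val hv (H'.meet_le_right u p) this]
      simp
    · intro u hu w hw huw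
      obtain ⟨hu1, -, hu3, hu4, hu5⟩ := memS hu
      obtain ⟨hw1, -, hw3, hw4, hw5⟩ := memS hw
      obtain ⟨k1, k2⟩ := H.meet_le_of_optParams hv hu1 hw1 (by linarith) hu4 hw5
      rw [← huw] at hw4
      obtain ⟨-, hu6⟩ := (H'.mem_interval_iff hv).1 hu1
      obtain ⟨-, hw6⟩ := (H'.mem_interval_iff hv).1 hw1
      have := hf.exchange (τ u).2 hu5.1 (meet w p) (meet u p) (meet w q) (meet u q)
        ⟨k1, k2, bddAbove_pair (H'.meet_le_left w p) (H'.meet_le_left w q),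
        bddAbove_pair (H'.meet_le_left u p) (H'.meet_le_left u q),
        le_antisymm (hu5.2 w hw1) (hw4.2 u hu1), fun c e hc1 hc2 he1 he2 hce =>
          H.pairWeight_le hv hw4 ((H'.le_meet hw6 (H'.meet_le_left p q)).trans hc1)
            (hc2.trans (H'.meet_le_right u p))
            ((H'.le_meet hu6 (H'.meet_le_right p q)).trans he1)
            (he2.trans (H'.meet_le_right w q)) hce⟩
      linarith
    · intro u hu hu1
      obtain ⟨-, -, -, -, h4⟩ := memS hu
      rw [hu1] at h4
      have := H.pairWeight_le hv h4 le_rfl (H'.meet_le_left p q) (H'.meet_le_right p q) le_rfl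
        (bddAbove_pair (H'.meet_le_right p q) le_rfl)
      simp only [pairWeight, sub_self, one_mul, zero_mul, zero_add] at this
      rw [H'.eq_of_le_of_val hv (H'.meet_le_right u q) this]
      simp
  have hlocal : ∀ u ∈ S, ((τ u).2 - (τ u).1) * f u ≤
      ((τ u).2 - (τ u).1) * (f (meet u p) + f (meet u q)) -
        ((τ u).2 - (τ u).1) * f (meet p q) := by
    intro u hu
    obtain ⟨hu1, -, hu3, -⟩ := memS hu
    obtain ⟨k1, k2⟩ := (H'.mem_interval_iff hv).1 hu1
    have hm : meet (meet u p) (meet u q) = meet p q :=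
      H'.antisymm _ _ (H'.meet_mono (H'.meet_le_right u p) (H'.meet_le_right u q))
        (H'.le_meet (H'.le_meet k2 (H'.meet_le_left p q)) (H'.le_meet k2 (H'.meet_le_right p q)))
    have h2 := hf.bounded _ _ _ _ (hm ▸ H'.isGLB_meet (meet u p) (meet u q)) k1
    rw [← mul_sub]
    exact mul_le_mul_of_nonneg_left (by linarith) (by linarith)
  have := Finset.sum_le_sum hlocal
  rw [Finset.sum_sub_distrib, ← Finset.sum_mul, hone, one_mul] at this
  linarith

end IsModularSemilattice

end Semilattice

end LConvexity

namespace LConvexity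

/-- Some geodesic from x in S to z passes through y and then through b; its part from x to b passes
through y. -/
theorem IsGate.gate_gate {V : Type*} {G : SimpleGraph V} (hG : G.Connected) {S B : Set V}
    {z y b : V} (hz : z ∈ B) (hy : IsGate G S z y) (hb : IsGate G B y b) : IsGate G S b y := by
  refine ⟨hy.1, fun x hx => ?_⟩
  have h1 := hy.2 x hx
  have h2 := hb.2 z hz
  have h3 := hG.dist_triangle (u := x) (v := b) (w := z)
  have h4 := hG.dist_triangle (u := x) (v := y) (w := b)
  have e1 : G.dist z b = G.dist b z := SimpleGraph.dist_comm
  have e2 : G.dist y b = G.dist b y := SimpleGraph.dist_comm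
  have e3 : G.dist y z = G.dist z y := SimpleGraph.dist_comm
  omega

namespace ComplexData

variable {V : Type*} {Γ : ComplexData V}

/-! ### Moving Boolean pairs towards each other -/

namespace IsModularComplex

variable (hΓ : Γ.IsModularComplex)
include hΓ

/-- If `[b₁,b₂]` and `[y₁,y₂]` are mutual gates in `B` and `S`, then the gates of the elements
of `[y₁,y₂]` in `B` have their gates in `S` at the original elements. -/
theorem isGate_of_parallel {S B : Set V} (hS : IsConvexSet Γ.graph S) (hB : IsConvexSet Γ.graph B)
    {y₁ y₂ b₁ b₂ y b : V} (hy : y ∈ Γ.Icc y₁ y₂) (h1 : IsGate Γ.graph S b₁ y₁)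
    (h2 : IsGate Γ.graph S b₂ y₂) (h1' : IsGate Γ.graph B y₁ b₁) (h2' : IsGate Γ.graph B y₂ b₂)
    (hb : IsGate Γ.graph B y b) : IsGate Γ.graph S b y := by
  have hyd := hΓ.dist_add_of_le hy.1 hy.2
  have hyS : y ∈ S := hS _ h1.1 _ h2.1 y hyd
  obtain ⟨y', hy'⟩ := hΓ.modular.exists_isGate hS ⟨y, hyS⟩ b
  have hb' := hb.gate_gate hΓ.connected hyS hy'
  have hbd := hΓ.dist_add_of_le (hΓ.isGate_mono hB hy.1 h1' hb) (hΓ.isGate_mono hB hy.2 hb h2')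
  have hy'd := hΓ.dist_add_of_le
    (hΓ.isGate_mono hS (hΓ.isGate_mono hB hy.1 h1' hb) h1 hy')
    (hΓ.isGate_mono hS (hΓ.isGate_mono hB hy.2 hb h2') hy' h2)
  have k1 := h1.2 y hyS
  have k2 := h2.2 y hyS
  have k3 := h1.2 y' hy'.1
  have k4 := h2.2 y' hy'.1
  have k5 := hb.2 _ h1'.1
  have k6 := hb.2 _ h2'.1
  have k7 := hb'.2 _ h1'.1
  have k8 := hb'.2 _ h2'.1
  have k9 := h1.2 _ h2.1
  have k10 := h2.2 _ h1.1
  have k11 := h1'.2 _ h2'.1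
  have k12 := h2'.2 _ h1'.1
  have k13 := hy'.2 y hyS
  have c : ∀ u v, Γ.graph.dist u v = Γ.graph.dist v u := fun u v => SimpleGraph.dist_comm
  have := c y y₁
  have := c y' y₁
  have := c b b₁
  have := c b y
  have := c b y'
  have := c b₁ y
  have := c b₁ y'
  have := c b₂ y
  have := c b₂ y'
  have := c b₂ b
  have := c b₂ b₁
  have := c y₂ y₁
  have := c y₁ b₁
  have := c y₂ b₂
  have := c y₁ b₂
  have := c y₂ b₁
  have := c y' b
  have h0 : Γ.graph.dist y y' = 0 := by omega
  rw [hΓ.connected.dist_eq_zero_iff.1 h0]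
  exact hy'

/-- The gates of the two ends of a Boolean pair in a convex set form a Boolean pair. -/
theorem isBoolean_gates {S : Set V} (hS : IsConvexSet Γ.graph S) {z₁ z₂ y₁ y₂ : V}
    (hz : Γ.IsBoolean z₁ z₂) (h1 : IsGate Γ.graph S z₁ y₁) (h2 : IsGate Γ.graph S z₂ y₂) :
    Γ.IsBoolean y₁ y₂ := by
  have hzle := hΓ.le_of_isBoolean hz
  have hyle := hΓ.isGate_mono hS hzle h1 h2
  set B := Γ.Icc z₁ z₂ with hBdef
  have hB : IsConvexSet Γ.graph B := hΓ.isConvexSet_Icc z₁ z₂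
  have hz1 : z₁ ∈ B := ⟨le_refl _, hzle⟩
  have hz2 : z₂ ∈ B := ⟨hzle, le_refl _⟩
  choose ψ hψ using hΓ.modular.exists_isGate hB ⟨z₁, hz1⟩
  choose φ hφ using hΓ.modular.exists_isGate hS ⟨y₁, h1.1⟩
  have g1 : IsGate Γ.graph S (ψ y₁) y₁ := h1.gate_gate hΓ.connected hz1 (hψ y₁)
  have g2 : IsGate Γ.graph S (ψ y₂) y₂ := h2.gate_gate hΓ.connected hz2 (hψ y₂)
  have hψm : ∀ {x y}, Γ.le x y → Γ.le (ψ x) (ψ y) := fun h => hΓ.isGate_mono hB h (hψ _) (hψ _)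
  have hφm : ∀ {x y}, Γ.le x y → Γ.le (φ x) (φ y) := fun h => hΓ.isGate_mono hS h (hφ _) (hφ _)
  have e1 : φ (ψ y₁) = y₁ := (hφ _).eq hΓ.connected g1
  have e2 : φ (ψ y₂) = y₂ := (hφ _).eq hΓ.connected g2
  -- φ and ψ restrict to mutually inverse order isomorphisms between [y₁,y₂] and [ψ y₁, ψ y₂]. The
  -- latter is part of a Boolean interval, and its complements are carried over.
  have hφψ : ∀ y ∈ Γ.Icc y₁ y₂, φ (ψ y) = y := fun y hy =>
    (hφ _).eq hΓ.connected (hΓ.isGate_of_parallel hS hB hy g1 g2 (hψ _) (hψ _) (hψ y))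
  have hψφ : ∀ b ∈ Γ.Icc (ψ y₁) (ψ y₂), ψ (φ b) = b := fun b hb =>
    (hψ _).eq hΓ.connected (hΓ.isGate_of_parallel hB hS hb (hψ _) (hψ _) g1 g2 (hφ b))
  have hb : Γ.IsComplemented (ψ y₁) (ψ y₂) := hΓ.isBoolean_iff_isComplemented.1
    (hΓ.isBoolean_of_mem_Icc hz (hψ y₁).1.1 (hψm hyle) (hψ y₂).1.2)
  refine hΓ.isBoolean_iff_isComplemented.2 ⟨hyle, fun r hr => ?_⟩
  obtain ⟨c, hc, hm, hj⟩ := hb.2 (ψ r) ⟨hψm hr.1, hψm hr.2⟩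
  have hy1 : Γ.le y₁ (φ c) := e1 ▸ hφm hc.1
  have hy2 : Γ.le (φ c) y₂ := e2 ▸ hφm hc.2
  refine ⟨φ c, ⟨hy1, hy2⟩, ?_, ?_⟩
  · obtain ⟨m, hm', -⟩ := hΓ.exists_isMeet hr.1 hy1
    have hm1 := hm'.2.2 y₁ hr.1 hy1
    have h3 : Γ.le m y₁ := by
      rw [← hφψ m ⟨hm1, le_trans hm'.1 hr.2⟩, ← e1]
      refine hφm (hm.2.2 _ (hψm hm'.1) ?_)
      have := hψm hm'.2.1
      rwa [hψφ c hc] at this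
    rwa [← hΓ.le_antisymm h3 hm1]
  · obtain ⟨j, hj'⟩ := hΓ.exists_isJoin hr.2 hy2
    have hj1 := hj'.2.2 y₂ hr.2 hy2
    have h3 : Γ.le y₂ j := by
      rw [← hφψ j ⟨le_trans hr.1 hj'.1, hj1⟩, ← e2]
      refine hφm (hj.2.2 _ (hψm hj'.1) ?_)
      have := hψm hj'.2.1
      rwa [hψφ c hc] at this
    rwa [← hΓ.le_antisymm hj1 h3]

/-- A step pp' towards z₁ has a parallel step qs towards z₂. If it leads up, then s = q ∨ p' and
(p,s) is Boolean; if it leads down, then p' = p ∧ s and (p',q) is Boolean. So one end can move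
alone. -/
theorem exists_step_of_parallel {p q z₁ z₂ : V} (hpq : Γ.IsBoolean p q)
    (h1 : IsGate Γ.graph (Γ.Icc p q) z₁ p)
    (h2 : IsGate Γ.graph (Γ.Icc p q) z₂ q) (h1' : IsGate Γ.graph (Γ.Icc z₁ z₂) p z₁)
    (h2' : IsGate Γ.graph (Γ.Icc z₁ z₂) q z₂) (hne : p ≠ z₁) :
    (∃ p', Γ.graph.Adj p p' ∧ Γ.IsBoolean p' q ∧ Γ.graph.dist p' z₁ + 1 = Γ.graph.dist p z₁) ∨
    (∃ q', Γ.graph.Adj q q' ∧ Γ.IsBoolean p q' ∧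
      Γ.graph.dist q' z₂ + 1 = Γ.graph.dist q z₂) := by
  have hle := hΓ.le_of_isBoolean hpq
  obtain ⟨p', ha, hd⟩ := exists_adj_dist_add_one hΓ.connected hne
  have c : ∀ u v, Γ.graph.dist u v = Γ.graph.dist v u := fun u v => SimpleGraph.dist_comm
  have k1 := h1.2 _ h2.1
  have k2 := h2.2 _ h1.1
  have k3 := h1'.2 _ h2'.1
  have k4 := h2'.2 _ h1'.1
  have k5 := hΓ.connected.dist_triangle (u := p') (v := z₁) (w := z₂)
  have k6 := hΓ.modular.dist_adj ha z₂
  have k7 : Γ.graph.dist p' q = Γ.graph.dist p q + 1 := by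
    -- A step of p into [p,q] would lead away from z₁, since p is the gate.
    rcases hΓ.modular.dist_adj ha q with h | h
    · have hap := SimpleGraph.dist_eq_one_iff_adj.2 ha
      have h3 := hΓ.le_of_between hle (r := p') (by omega)
      have := h1.2 p' h3
      omega
    · exact h
  obtain ⟨s, m1, m2, m3⟩ := hΓ.modular.2 p' q z₂
  have t1 := hΓ.connected.dist_triangle (u := p) (v := s) (w := z₂)
  have t2 := hΓ.connected.dist_triangle (u := p) (v := q) (w := s)
  have := c z₁ p
  have := c z₂ q
  have := c z₂ z₁
  have := c z₂ p
  have := c z₁ q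
  have := c q p
  have := c s q
  have := c s z₂
  have := c s p'
  have := c z₂ p'
  have e1 : Γ.graph.dist q s = 1 := by omega
  have hqs := SimpleGraph.dist_eq_one_iff_adj.1 e1
  have hap := SimpleGraph.dist_eq_one_iff_adj.2 ha
  have := c p p'
  have hl := hΓ.modular.ladder hΓ.admissible.2 ha hqs (by omega) (by omega) (by omega)
  rcases hΓ.arc_or_arc ha with h | h
  · have hqs' := hl.1 h
    have hps : Γ.le p s := hle.tail hqs'
    have hp's := (hΓ.le_of_between hps (r := p') (by omega)).2
    refine Or.inr ⟨s, hqs, hΓ.isBoolean_of_isJoin hpq (hΓ.isBoolean_of_arc h)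
      (hΓ.isJoin_of_between (le_of_arc hqs') hp's ?_), by omega⟩
    have := c q p'
    omega
  · have hqs' : Γ.arc s q := (hΓ.arc_or_arc hqs).resolve_left fun h' =>
      hΓ.not_arc h (hl.2 h')
    have hp'q : Γ.le p' q := le_trans (le_of_arc h) hle
    have hp's := (hΓ.le_of_between hp'q (r := s) (by omega)).1
    refine Or.inl ⟨p', ha, hΓ.isBoolean_of_isMeet hpq (hΓ.isBoolean_of_arc hqs')
      (hΓ.isMeet_of_between (le_of_arc h) hp's (by omega)), by omega⟩

/-- If p is not the gate of z₁, an atom of [p,q] below the gate is a step of p towards z₁, and it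
only shrinks the Boolean interval. The same holds dually for q and z₂. -/
theorem exists_step_or_gates {p q : V} (z₁ z₂ : V) (hpq : Γ.IsBoolean p q) :
    (∃ p', Γ.graph.Adj p p' ∧ Γ.IsBoolean p' q ∧ Γ.graph.dist p' z₁ + 1 = Γ.graph.dist p z₁) ∨
    (∃ q', Γ.graph.Adj q q' ∧ Γ.IsBoolean p q' ∧ Γ.graph.dist q' z₂ + 1 = Γ.graph.dist q z₂) ∨
    (IsGate Γ.graph (Γ.Icc p q) z₁ p ∧ IsGate Γ.graph (Γ.Icc p q) z₂ q) := by
  have hle := hΓ.le_of_isBoolean hpq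
  have hc := hΓ.isConvexSet_Icc p q
  obtain ⟨g₁, hg₁⟩ := hΓ.modular.exists_isGate hc ⟨p, le_refl p, hle⟩ z₁
  obtain ⟨g₂, hg₂⟩ := hΓ.modular.exists_isGate hc ⟨p, le_refl p, hle⟩ z₂
  by_cases h1 : p = g₁
  · by_cases h2 : q = g₂
    · subst h1 h2
      exact Or.inr (Or.inr ⟨hg₁, hg₂⟩)
    · obtain ⟨b, h3, h4⟩ := exists_arc_of_le (op_le.2 hg₂.1.2) h2
      have h5 := op_le.1 h4
      have h6 : b ∈ Γ.Icc p q := ⟨le_trans hg₂.1.1 h5, le_of_arc h3⟩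
      have k1 := hg₂.2 q ⟨hle, le_refl q⟩
      have k2 := hg₂.2 b h6
      have k3 := hΓ.dist_arc_right h5 h3
      have e1 : Γ.graph.dist q g₂ = Γ.graph.dist g₂ q := SimpleGraph.dist_comm
      have e2 : Γ.graph.dist b g₂ = Γ.graph.dist g₂ b := SimpleGraph.dist_comm
      exact Or.inr (Or.inl ⟨b, (hΓ.adj_of_arc h3).symm,
        hΓ.isBoolean_of_mem_Icc hpq (le_refl p) h6.1 h6.2, by omega⟩)
  · obtain ⟨a, h3, h4⟩ := exists_arc_of_le hg₁.1.1 h1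
    have h6 : a ∈ Γ.Icc p q := ⟨le_of_arc h3, le_trans h4 hg₁.1.2⟩
    have k1 := hg₁.2 p ⟨le_refl p, hle⟩
    have k2 := hg₁.2 a h6
    have k3 := hΓ.dist_add_of_le (le_of_arc h3) h4
    rw [hΓ.dist_of_arc h3] at k3
    exact Or.inl ⟨a, hΓ.adj_of_arc h3, hΓ.isBoolean_of_mem_Icc hpq h6.1 h6.2 (le_refl q),
      by omega⟩

/-- The quadrangle condition for two changes of the upper element of a Boolean pair. -/
theorem isBoolean_of_square_hi {p q q' q'' s : V} (h' : Γ.IsBoolean p q')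
    (h'' : Γ.IsBoolean p q'') (hs : IsFourCycle Γ.graph q q' s q'') : Γ.IsBoolean p s := by
  have hs' : IsFourCycle Γ.graph q q'' s q' :=
    ⟨hs.2.2.2.1.symm, hs.2.2.1.symm, hs.2.1.symm, hs.1.symm, hs.2.2.2.2.1, hs.2.2.2.2.2.symm⟩
  have a1 := hΓ.admissible.2 _ _ _ _ hs
  have a2 := hΓ.admissible.2 _ _ _ _ hs'
  have hp' := hΓ.le_of_isBoolean h'
  have hp'' := hΓ.le_of_isBoolean h''
  have down1 : ¬ Γ.arc q q' → Γ.arc s q'' := fun h =>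
    (hΓ.arc_or_arc hs.2.2.1).resolve_right fun h4 => h (a1.2 h4)
  have down2 : ¬ Γ.arc q q'' → Γ.arc s q' := fun h =>
    (hΓ.arc_or_arc hs'.2.2.1).resolve_right fun h4 => h (a2.2 h4)
  by_cases h1 : Γ.arc q q'
  · by_cases h2 : Γ.arc q q''
    · exact hΓ.isBoolean_of_isJoin h' h'' (op_isMeet.1
        (hΓ.op.isMeet_atoms (p := s) (a2.1 h2) (a1.1 h1) hs.2.2.2.2.2))
    · exact hΓ.isBoolean_of_mem_Icc h' (le_refl p) (hp''.tail (a1.1 h1)) (le_of_arc (down2 h2))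
  · by_cases h2 : Γ.arc q q''
    · exact hΓ.isBoolean_of_mem_Icc h'' (le_refl p) (hp'.tail (a2.1 h2)) (le_of_arc (down1 h1))
    · exact hΓ.isBoolean_of_mem_Icc h' (le_refl p)
        ((hΓ.isMeet_atoms (down2 h2) (down1 h1) hs.2.2.2.2.2).2.2 p hp' hp'')
        (le_of_arc (down2 h2))

theorem isBoolean_of_square_lo {q p p' p'' s : V} (h' : Γ.IsBoolean p' q)
    (h'' : Γ.IsBoolean p'' q) (hs : IsFourCycle Γ.graph p p' s p'') : Γ.IsBoolean s q :=
  hΓ.op_isBoolean.1 (hΓ.op.isBoolean_of_square_hi (hΓ.op_isBoolean.2 h')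
    (hΓ.op_isBoolean.2 h'') hs)

/-- The issue is p' ⪯ q'. The gate of z₁ in [p,q] is above p' by the distance condition, and below
q' since `arc_of_closer`, with z₁ ⪯ z₂, forces z₁ to be closer to q' than to q. -/
theorem isBoolean_of_shrink {p q p' q' z₁ z₂ : V} (hpq : Γ.IsBoolean p q) (hz : Γ.le z₁ z₂)
    (hp : Γ.arc p p') (hq : Γ.arc q' q) (hp'q : Γ.le p' q) (hpq' : Γ.le p q')
    (hd₁ : Γ.graph.dist p' z₁ + 1 = Γ.graph.dist p z₁)
    (hd₂ : Γ.graph.dist q' z₂ + 1 = Γ.graph.dist q z₂) : Γ.IsBoolean p' q' := by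
  have hle := hΓ.le_of_isBoolean hpq
  obtain ⟨g, hg⟩ := hΓ.modular.exists_isGate (hΓ.isConvexSet_Icc p q) ⟨p, le_refl p, hle⟩ z₁
  have k1 := hg.2 p ⟨le_refl p, hle⟩
  have k2 := hg.2 p' ⟨le_of_arc hp, hp'q⟩
  have k3 := hg.2 q ⟨hle, le_refl q⟩
  have k4 := hg.2 q' ⟨hpq', le_of_arc hq⟩
  have k5 := hΓ.dist_of_arc hp
  have k6 := hΓ.dist_of_arc hq
  have c : ∀ u v, Γ.graph.dist u v = Γ.graph.dist v u := fun u v => SimpleGraph.dist_comm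
  have := c q z₁
  have := c q' z₁
  have := c q z₂
  have := c q' z₂
  have := c q g
  have := c q' g
  have h1 : Γ.le p' g := (hΓ.le_of_between hg.1.1 (r := p') (by omega)).2
  have h2 : Γ.graph.dist z₁ q = Γ.graph.dist z₁ q' + 1 := by
    rcases hΓ.modular.dist_adj' (hΓ.adj_of_arc hq).symm z₁ with h | h
    · exact h
    · exact absurd (hΓ.arc_of_closer hz (hΓ.adj_of_arc hq).symm h.symm (by omega))
        (hΓ.not_arc hq)
  have h3 : Γ.le g q' := (hΓ.le_of_between hg.1.2 (r := q') (by omega)).1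
  exact hΓ.isBoolean_of_mem_Icc hpq (le_of_arc hp) (le_trans h1 h3) (le_of_arc hq)

/-- Some atom e of the Boolean interval [p, p ∨ c] is not below q, as otherwise c would be. Then e ∧
c covers p', and e = p ∨ (e ∧ c) shows that it is not below q either. -/
theorem exists_atom_not_le {p p' q q' c : V} (hp : Γ.arc p' p) (hpq' : Γ.IsBoolean p q')
    (hpq : Γ.le p q) (hc : c ∈ Γ.Icc p' q') (hpc : ¬ Γ.le p c) (hcq : ¬ Γ.le c q) :
    ∃ a, Γ.arc p' a ∧ Γ.le a q' ∧ ¬ Γ.le a q := by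
  have hpq'le := hΓ.le_of_isBoolean hpq'
  have hm := hΓ.isMeet_atom hp hc.1 hpc
  obtain ⟨j, hj⟩ := hΓ.exists_isJoin hpq'le hc.2
  have hjq' := hj.2.2 q' hpq'le hc.2
  have hjb := hΓ.isBoolean_of_mem_Icc hpq' (le_refl p) hj.1 hjq'
  obtain ⟨e, he, hej, heq⟩ : ∃ e, Γ.arc p e ∧ Γ.le e j ∧ ¬ Γ.le e q := by
    by_contra hcon
    push Not at hcon
    obtain ⟨u, hu, -⟩ := hΓ.exists_isMeet hj.1 hpq
    have h1 := (hΓ.isAtomJoin_of_isBoolean hjb).2 u (hu.2.2 p hj.1 hpq) hu.1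
      fun a h1 h2 => hu.2.2 a h2 (hcon a h1 h2)
    exact hcq (le_trans hj.2.1 (h1 ▸ hu.2.1))
  have hp'e : Γ.le p' e := le_trans (le_of_arc hp) (le_of_arc he)
  obtain ⟨a, ha, -⟩ := hΓ.exists_isMeet hp'e hc.1
  have hp'a := ha.2.2 p' hp'e hc.1
  have hj' : Γ.IsJoin e c j :=
    ⟨hej, hj.2.1, fun x h1 h2 => hj.2.2 x (le_trans (le_of_arc he) h1) h2⟩
  have d1 := (hΓ.dist_isMeet_isJoin ha hj').2
  have d2 := (hΓ.dist_isMeet_isJoin hm hj).2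
  have d3 := hΓ.dist_add_of_le (le_of_arc he) hej
  have d4 := hΓ.dist_add_of_le hp'a ha.2.1
  have d5 := hΓ.dist_of_arc he
  have harc : Γ.arc p' a := hΓ.arc_of_le hp'a (by omega)
  refine ⟨a, harc, le_trans ha.2.1 hc.2, fun haq => heq ?_⟩
  have hpa : ¬ Γ.le p a := fun h => hpc (le_trans h ha.2.1)
  obtain ⟨k, hk⟩ := hΓ.exists_isJoin (le_of_arc he) ha.1
  have hke := hk.2.2 e (le_of_arc he) ha.1
  rcases hΓ.eq_or_eq_of_arc he hk.1 hke with h | rfl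
  · rcases hΓ.eq_or_eq_of_arc hp hp'a (h ▸ hk.2.1) with rfl | rfl
    · exact absurd rfl (hΓ.adj_of_arc harc).ne
    · exact absurd (le_refl _) hpa
  · exact hk.2.2 q hpq haq

/-- An atom a of [p',q'] not below q suffices, for then q' = a ∨ q. By `exists_atom_not_le` it is
enough to find c in [p',q'] neither above p nor below q. The distance conditions say that the gate
g₁ of z₁ is not above p and the gate g₂ of z₂ is not below q; so c is g₂, or a complement of p ∨ g₁
in the Boolean interval [g₁,g₂]. -/
theorem isBoolean_of_extend {p q p' q' z₁ z₂ : V} (hz : Γ.IsBoolean z₁ z₂)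
    (hpq' : Γ.IsBoolean p q') (hp'q : Γ.IsBoolean p' q) (hpq : Γ.le p q)
    (hp : Γ.arc p' p) (hq : Γ.arc q q')
    (hd₁ : Γ.graph.dist p' z₁ + 1 = Γ.graph.dist p z₁)
    (hd₂ : Γ.graph.dist q' z₂ + 1 = Γ.graph.dist q z₂) : Γ.IsBoolean p' q' := by
  have hle : Γ.le p' q' := le_trans (le_of_arc hp) (hpq.tail hq)
  have hc := hΓ.isConvexSet_Icc p' q'
  obtain ⟨g₁, hg₁⟩ := hΓ.modular.exists_isGate hc ⟨p', le_refl p', hle⟩ z₁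
  obtain ⟨g₂, hg₂⟩ := hΓ.modular.exists_isGate hc ⟨p', le_refl p', hle⟩ z₂
  have hgle := hΓ.isGate_mono hc (hΓ.le_of_isBoolean hz) hg₁ hg₂
  have hpg : ¬ Γ.le p g₁ := fun h => by
    have k1 := hg₁.2 p' ⟨le_refl p', hle⟩
    have k2 := hg₁.2 p ⟨le_of_arc hp, hpq.tail hq⟩
    have k3 := hΓ.dist_add_of_le (le_of_arc hp) h
    omega
  have hgq : ¬ Γ.le g₂ q := fun h => by
    have k1 := hg₂.2 q' ⟨hle, le_refl q'⟩
    have k2 := hg₂.2 q ⟨le_trans (le_of_arc hp) hpq, le_of_arc hq⟩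
    have k3 := hΓ.dist_add_of_le h (le_of_arc hq)
    have e1 : Γ.graph.dist q g₂ = Γ.graph.dist g₂ q := SimpleGraph.dist_comm
    have e2 : Γ.graph.dist q' g₂ = Γ.graph.dist g₂ q' := SimpleGraph.dist_comm
    omega
  obtain ⟨c, hcI, hpc, hcq⟩ : ∃ c ∈ Γ.Icc p' q', ¬ Γ.le p c ∧ ¬ Γ.le c q := by
    by_cases hpg₂ : Γ.le p g₂
    · have hb := hΓ.isBoolean_iff_isComplemented.1 (hΓ.isBoolean_gates hc hz hg₁ hg₂)
      obtain ⟨j, hj⟩ := hΓ.exists_isJoin hpg₂ hgle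
      obtain ⟨y, hy, hm, hj'⟩ := hb.2 j ⟨hj.2.1, hj.2.2 g₂ hpg₂ hgle⟩
      refine ⟨y, ⟨le_trans hg₁.1.1 hy.1, le_trans hy.2 hg₂.1.2⟩, fun h => hpg ?_, fun h => hgq ?_⟩
      · exact le_trans hj.1 (hm.2.2 j (le_refl j) (hj.2.2 y h hy.1))
      · exact hj'.2.2 q (hj.2.2 q hpq (le_trans hy.1 h)) h
    · exact ⟨g₂, hg₂.1, hpg₂, hgq⟩
  obtain ⟨a, ha, haq', haq⟩ := hΓ.exists_atom_not_le hp hpq' hpq hcI hpc hcq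
  obtain ⟨j, hj⟩ := hΓ.exists_isJoin haq' (le_of_arc hq)
  have hjq' := hj.2.2 q' haq' (le_of_arc hq)
  rcases hΓ.eq_or_eq_of_arc hq hj.2.1 hjq' with rfl | rfl
  · exact absurd hj.1 haq
  · exact hΓ.isBoolean_of_isJoin (hΓ.isBoolean_of_arc ha) hp'q hj

/-- The quadrangle condition for a change of the lower and a change of the upper element of a
Boolean pair. -/
theorem isBoolean_of_square_mixed {p q p' q' z₁ z₂ : V} (hz : Γ.IsBoolean z₁ z₂)
    (hpq : Γ.IsBoolean p q) (hpq' : Γ.IsBoolean p q') (hp'q : Γ.IsBoolean p' q)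
    (hp : Γ.graph.Adj p p') (hq : Γ.graph.Adj q q')
    (hd₁ : Γ.graph.dist p' z₁ + 1 = Γ.graph.dist p z₁)
    (hd₂ : Γ.graph.dist q' z₂ + 1 = Γ.graph.dist q z₂) : Γ.IsBoolean p' q' := by
  rcases hΓ.arc_or_arc hp with h1 | h1 <;> rcases hΓ.arc_or_arc hq with h2 | h2
  · exact hΓ.isBoolean_of_mem_Icc hpq' (le_of_arc h1)
      ((hΓ.le_of_isBoolean hp'q).tail h2) (le_refl _)
  · exact hΓ.isBoolean_of_shrink hpq (hΓ.le_of_isBoolean hz) h1 h2 (hΓ.le_of_isBoolean hp'q)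
      (hΓ.le_of_isBoolean hpq') hd₁ hd₂
  · exact hΓ.isBoolean_of_extend hz hpq' hp'q (hΓ.le_of_isBoolean hpq) h1 h2 hd₁ hd₂
  · exact hΓ.isBoolean_of_mem_Icc hp'q (le_refl _)
      (le_trans (le_of_arc h1) (hΓ.le_of_isBoolean hpq')) (le_of_arc h2)

end IsModularComplex

end ComplexData

end LConvexity

namespace LConvexity

theorem isOrbitInvariant_of_isFourCycle {V : Type*} {G : SimpleGraph V} {h : Sym2 V → ℝ}
    (hh : ∀ u v v' u', IsFourCycle G u v v' u' → h s(u, v) = h s(u', v')) :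
    IsOrbitInvariant G h := by
  intro e _ e' _ hp
  induction hp with
  | refl => rfl
  | tail h1 h2 ih =>
    obtain ⟨u, v, v', u', hc, rfl, rfl⟩ := h2
    exact (ih hc.1).trans (hh u v v' u' hc)

namespace ComplexData

variable {V : Type*} {Γ : ComplexData V}

/-! ### The 2-subdivision is a modular complex -/

theorem subdivision_adj {x y : Γ.BooleanPair} : Γ.subdivision.graph.Adj x y ↔
    (x.lo = y.lo ∧ Γ.graph.Adj x.hi y.hi) ∨ (x.hi = y.hi ∧ Γ.graph.Adj x.lo y.lo) := Iff.rfl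

theorem subdivision_arc {x y : Γ.BooleanPair} : Γ.subdivision.arc x y ↔
    (x.lo = y.lo ∧ Γ.arc x.hi y.hi) ∨ (x.hi = y.hi ∧ Γ.arc y.lo x.lo) := Iff.rfl

theorem subdivision_len_of_lo {x y : Γ.BooleanPair} (h : x.lo = y.lo) :
    Γ.subdivision.len s(x, y) = Γ.len s(x.hi, y.hi) / 2 := if_pos h

theorem subdivision_len_of_hi {x y : Γ.BooleanPair} (h : x.lo ≠ y.lo) :
    Γ.subdivision.len s(x, y) = Γ.len s(x.lo, y.lo) / 2 := if_neg h

/-- An edge of Γ* changes exactly one of the two ends. Around a 4-cycle the kinds of change are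
constant or alternate; all other patterns identify two of its vertices. -/
theorem subdivision_isFourCycle {u v v' u' : Γ.BooleanPair}
    (h : IsFourCycle Γ.subdivision.graph u v v' u') :
    (u.lo = v.lo ∧ u'.lo = v'.lo ∧ IsFourCycle Γ.graph u.hi v.hi v'.hi u'.hi) ∨
    (u.hi = v.hi ∧ u'.hi = v'.hi ∧ IsFourCycle Γ.graph u.lo v.lo v'.lo u'.lo) ∨
    (u.lo = v.lo ∧ u'.lo = v'.lo ∧ u.hi = u'.hi ∧ v.hi = v'.hi) ∨
    (u.hi = v.hi ∧ u'.hi = v'.hi ∧ u.lo = u'.lo ∧ v.lo = v'.lo) := by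
  obtain ⟨h1, h2, h3, h4, h5, h6⟩ := h
  rw [subdivision_adj] at h1 h2 h3 h4
  have h5' : u.lo = v'.lo → u.hi = v'.hi → False := fun a b => h5 (BooleanPair.ext a b)
  have h6' : v.lo = u'.lo → v.hi = u'.hi → False := fun a b => h6 (BooleanPair.ext a b)
  rcases h1 with ⟨a1, b1⟩ | ⟨a1, b1⟩ <;> rcases h2 with ⟨a2, b2⟩ | ⟨a2, b2⟩ <;>
    rcases h3 with ⟨a3, b3⟩ | ⟨a3, b3⟩ <;> rcases h4 with ⟨a4, b4⟩ | ⟨a4, b4⟩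
  · exact Or.inl ⟨a1, a3.symm, b1, b2, b3, b4, fun h => h5' (a1.trans a2) h,
      fun h => h6' (a2.trans a3) h⟩
  · exact absurd (a1.trans (a2.trans a3)) b4.ne'
  · exact absurd (a2.symm.trans (a1.symm.trans a4.symm)) b3.ne
  · exact (h5' (a1.trans a2) (a4.symm.trans a3.symm)).elim
  · exact absurd (a1.symm.trans (a4.symm.trans a3.symm)) b2.ne
  · exact Or.inr (Or.inr (Or.inl ⟨a1, a3.symm, a4.symm, a2⟩))
  · exact (h6' (a1.symm.trans a4.symm) (a2.trans a3)).elim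
  · exact absurd (a2.trans (a3.trans a4)) b1.ne'
  · exact absurd (a2.trans (a3.trans a4)) b1.ne'
  · exact (h6' (a2.trans a3) (a1.symm.trans a4.symm)).elim
  · exact Or.inr (Or.inr (Or.inr ⟨a1, a3.symm, a4.symm, a2⟩))
  · exact absurd (a1.symm.trans (a4.symm.trans a3.symm)) b2.ne
  · exact (h5' (a4.symm.trans a3.symm) (a1.trans a2)).elim
  · exact absurd (a2.symm.trans (a1.symm.trans a4.symm)) b3.ne
  · exact absurd (a1.trans (a2.trans a3)) b4.ne'
  · exact Or.inr (Or.inl ⟨a1, a3.symm, b1, b2, b3, b4, fun h => h5' h (a1.trans a2),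
      fun h => h6' h (a2.trans a3)⟩)

namespace IsModularComplex

variable (hΓ : Γ.IsModularComplex)
include hΓ

/-- If the gates allow no step of x, a step of z towards x reduces to the induction hypothesis. If
they allow neither, the two intervals are parallel and `exists_step_of_parallel` moves x. -/
theorem exists_subdivision_step : ∀ (n : ℕ) (x z : Γ.BooleanPair),
    Γ.graph.dist x.lo z.lo + Γ.graph.dist x.hi z.hi = n → x ≠ z →
    ∃ y, Γ.subdivision.graph.Adj x y ∧
      Γ.graph.dist y.lo z.lo + Γ.graph.dist y.hi z.hi + 1 =
        Γ.graph.dist x.lo z.lo + Γ.graph.dist x.hi z.hi := by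
  intro n
  induction n with
  | zero =>
    intro x z hn hne
    exact absurd (BooleanPair.ext (hΓ.connected.dist_eq_zero_iff.1 (by omega))
      (hΓ.connected.dist_eq_zero_iff.1 (by omega))) hne
  | succ n ih =>
    intro x z hn hne
    have c : ∀ u v, Γ.graph.dist u v = Γ.graph.dist v u := fun u v => SimpleGraph.dist_comm
    have fromx : ((∃ p', Γ.graph.Adj x.lo p' ∧ Γ.IsBoolean p' x.hi ∧
        Γ.graph.dist p' z.lo + 1 = Γ.graph.dist x.lo z.lo) ∨
        (∃ q', Γ.graph.Adj x.hi q' ∧ Γ.IsBoolean x.lo q' ∧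
        Γ.graph.dist q' z.hi + 1 = Γ.graph.dist x.hi z.hi)) →
        ∃ y, Γ.subdivision.graph.Adj x y ∧
          Γ.graph.dist y.lo z.lo + Γ.graph.dist y.hi z.hi + 1 =
          Γ.graph.dist x.lo z.lo + Γ.graph.dist x.hi z.hi := by
      rintro (⟨p', h1, h2, h3⟩ | ⟨q', h1, h2, h3⟩)
      · exact ⟨⟨p', x.hi, h2⟩, Or.inr ⟨rfl, h1⟩, by simp only; omega⟩
      · exact ⟨⟨x.lo, q', h2⟩, Or.inl ⟨rfl, h1⟩, by simp only; omega⟩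
    -- A step of x towards z' is also one towards z, since moving z by one edge alters each distance
    -- by at most 1.
    have fromz : ∀ z' : Γ.BooleanPair, Γ.subdivision.graph.Adj z z' →
        Γ.graph.dist x.lo z'.lo + Γ.graph.dist x.hi z'.hi = n →
        (∀ w : Γ.BooleanPair, Γ.graph.dist w.lo z.lo + Γ.graph.dist w.hi z.hi ≤
          Γ.graph.dist w.lo z'.lo + Γ.graph.dist w.hi z'.hi + 1) →
        ∃ y, Γ.subdivision.graph.Adj x y ∧
          Γ.graph.dist y.lo z.lo + Γ.graph.dist y.hi z.hi + 1 =
          Γ.graph.dist x.lo z.lo + Γ.graph.dist x.hi z.hi := by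
      intro z' hz' hd hlip
      by_cases hxz' : x = z'
      · subst hxz'
        refine ⟨z, hz'.symm, ?_⟩
        have := hlip x
        simp at *
        omega
      · obtain ⟨y, hy, hyd⟩ := ih x z' hd hxz'
        refine ⟨y, hy, ?_⟩
        have h1 := hlip y
        have h2 : Γ.graph.dist x.lo z.lo + Γ.graph.dist x.hi z.hi ≤
            Γ.graph.dist y.lo z.lo + Γ.graph.dist y.hi z.hi + 1 := by
          rcases hy with ⟨e, ha⟩ | ⟨e, ha⟩
          · have := hΓ.modular.dist_adj ha z.hi
            rw [e]
            omega
          · have := hΓ.modular.dist_adj ha z.lo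
            rw [e]
            omega
        omega
    rcases hΓ.exists_step_or_gates z.lo z.hi x.isBoolean with h | h | ⟨h1, h2⟩
    · exact fromx (Or.inl h)
    · exact fromx (Or.inr h)
    rcases hΓ.exists_step_or_gates x.lo x.hi z.isBoolean with h | h | ⟨h1', h2'⟩
    · obtain ⟨p', h3, h4, h5⟩ := h
      refine fromz ⟨p', z.hi, h4⟩ (Or.inr ⟨rfl, h3⟩) ?_ fun w => ?_
      · have := c x.lo p'
        have := c x.lo z.lo
        simp only
        omega
      · have := hΓ.modular.dist_adj' h3 w.lo
        simp only
        omega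
    · obtain ⟨q', h3, h4, h5⟩ := h
      refine fromz ⟨z.lo, q', h4⟩ (Or.inl ⟨rfl, h3⟩) ?_ fun w => ?_
      · have := c x.hi q'
        have := c x.hi z.hi
        simp only
        omega
      · have := hΓ.modular.dist_adj' h3 w.hi
        simp only
        omega
    · refine fromx (hΓ.exists_step_of_parallel x.isBoolean h1 h2 h1' h2' fun he => ?_)
      have k1 := h1.2 _ h2.1
      have k2 := h2.2 _ h1.1
      have k3 := h1'.2 _ h2'.1
      have k4 := h2'.2 _ h1'.1
      have k5 : Γ.graph.dist x.lo z.lo = 0 := by rw [he, SimpleGraph.dist_self]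
      have := c x.hi x.lo
      have := c z.hi z.lo
      have := c z.hi x.lo
      have := c z.hi x.hi
      have := c z.lo x.hi
      have := c z.lo x.lo
      exact hne (BooleanPair.ext he (hΓ.connected.dist_eq_zero_iff.1 (by omega)))

theorem reachable_and_subdivision_dist (x z : Γ.BooleanPair) :
    Γ.subdivision.graph.Reachable x z ∧ Γ.subdivision.graph.dist x z =
      Γ.graph.dist x.lo z.lo + Γ.graph.dist x.hi z.hi := by
  refine reachable_and_dist_eq_of_descent
    (δ := fun x : Γ.BooleanPair => Γ.graph.dist x.lo z.lo + Γ.graph.dist x.hi z.hi)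
    (fun x h => ?_) ?_ ?_ (fun x hx => hΓ.exists_subdivision_step _ x z rfl hx) x
  · exact BooleanPair.ext (hΓ.connected.dist_eq_zero_iff.1 (by omega))
      (hΓ.connected.dist_eq_zero_iff.1 (by omega))
  · simp
  · rintro x y (⟨e, ha⟩ | ⟨e, ha⟩)
    · have := hΓ.modular.dist_adj ha z.hi
      rw [e]
      omega
    · have := hΓ.modular.dist_adj ha z.lo
      rw [e]
      omega

theorem subdivision_graph_dist (x z : Γ.BooleanPair) : Γ.subdivision.graph.dist x z =
    Γ.graph.dist x.lo z.lo + Γ.graph.dist x.hi z.hi :=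
  (hΓ.reachable_and_subdivision_dist x z).2

theorem subdivision_isModularGraph : IsModularGraph Γ.subdivision.graph := by
  obtain ⟨p⟩ := hΓ.connected.nonempty
  have hconn : Γ.subdivision.graph.Connected :=
    { preconnected := fun x z => (hΓ.reachable_and_subdivision_dist x z).1
      nonempty := ⟨Γ.vertexPair p⟩ }
  refine isModularGraph_of_quadrangle hconn ?_ ?_
  · rintro u v z (⟨e, ha⟩ | ⟨e, ha⟩)
    · have := hΓ.modular.dist_adj ha z.hi
      rw [hΓ.subdivision_graph_dist, hΓ.subdivision_graph_dist, e]
      omega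
    · have := hΓ.modular.dist_adj ha z.lo
      rw [hΓ.subdivision_graph_dist, hΓ.subdivision_graph_dist, e]
      omega
  · intro u v w z hu hv huv hdu hdv
    rw [hΓ.subdivision_graph_dist, hΓ.subdivision_graph_dist] at hdu hdv
    rcases hu with ⟨e1, a1⟩ | ⟨e1, a1⟩ <;> rcases hv with ⟨e2, a2⟩ | ⟨e2, a2⟩
    · rw [e1] at hdu
      rw [e2] at hdv
      have hne : u.hi ≠ v.hi := fun h => huv (BooleanPair.ext (e1.symm.trans e2) h)
      obtain ⟨s, s1, s2, s3⟩ := hΓ.modular.quadrangle a1 a2 hne (z := z.hi) (by omega) (by omega)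
      have hws : w.hi ≠ s := fun h => by
        rw [h] at hdu
        omega
      have hb := hΓ.isBoolean_of_square_hi (p := w.lo) (q := w.hi) (e1 ▸ u.isBoolean)
        (e2 ▸ v.isBoolean) ⟨a1, s1, s2.symm, a2.symm, hws, hne⟩
      refine ⟨⟨w.lo, s, hb⟩, Or.inl ⟨e1.symm, s1⟩, Or.inl ⟨e2.symm, s2⟩, ?_⟩
      rw [hΓ.subdivision_graph_dist, hΓ.subdivision_graph_dist]
      simp only
      rw [e1]
      omega
    · rw [e1] at hdu
      rw [e2] at hdv
      have hb := hΓ.isBoolean_of_square_mixed z.isBoolean w.isBoolean (e1 ▸ u.isBoolean)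
        (e2 ▸ v.isBoolean) a2 a1 (by omega) (by omega)
      refine ⟨⟨v.lo, u.hi, hb⟩, Or.inr ⟨rfl, e1 ▸ a2⟩, Or.inl ⟨rfl, e2 ▸ a1⟩, ?_⟩
      rw [hΓ.subdivision_graph_dist, hΓ.subdivision_graph_dist]
      simp only
      rw [← e1]
      omega
    · rw [e1] at hdu
      rw [e2] at hdv
      have hb := hΓ.isBoolean_of_square_mixed z.isBoolean w.isBoolean (e2 ▸ v.isBoolean)
        (e1 ▸ u.isBoolean) a1 a2 (by omega) (by omega)
      refine ⟨⟨u.lo, v.hi, hb⟩, Or.inl ⟨rfl, e1 ▸ a2⟩, Or.inr ⟨rfl, e2 ▸ a1⟩, ?_⟩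
      rw [hΓ.subdivision_graph_dist, hΓ.subdivision_graph_dist]
      simp only
      rw [← e1]
      omega
    · rw [e1] at hdu
      rw [e2] at hdv
      have hne : u.lo ≠ v.lo := fun h => huv (BooleanPair.ext h (e1.symm.trans e2))
      obtain ⟨s, s1, s2, s3⟩ := hΓ.modular.quadrangle a1 a2 hne (z := z.lo) (by omega) (by omega)
      have hws : w.lo ≠ s := fun h => by
        rw [h] at hdu
        omega
      have hb := hΓ.isBoolean_of_square_lo (q := w.hi) (p := w.lo) (e1 ▸ u.isBoolean)
        (e2 ▸ v.isBoolean) ⟨a1, s1, s2.symm, a2.symm, hws, hne⟩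
      refine ⟨⟨s, w.hi, hb⟩, Or.inr ⟨e1.symm, s1⟩, Or.inr ⟨e2.symm, s2⟩, ?_⟩
      rw [hΓ.subdivision_graph_dist, hΓ.subdivision_graph_dist]
      simp only
      rw [e1]
      omega

theorem subdivision : Γ.subdivision.IsModularComplex where
  modular := hΓ.subdivision_isModularGraph
  admissible := by
    refine ⟨⟨?_, ?_⟩, ?_⟩
    · rintro x y (⟨e, h⟩ | ⟨e, h⟩)
      · exact Or.inl ⟨e, hΓ.adj_of_arc h⟩
      · exact Or.inr ⟨e, (hΓ.adj_of_arc h).symm⟩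
    · rintro x y (⟨e, h⟩ | ⟨e, h⟩)
      · have h1 : Γ.subdivision.arc x y ↔ Γ.arc x.hi y.hi :=
          ⟨fun h' => h'.elim (·.2) fun h'' => absurd h''.1 h.ne, fun h' => Or.inl ⟨e, h'⟩⟩
        have h2 : Γ.subdivision.arc y x ↔ Γ.arc y.hi x.hi :=
          ⟨fun h' => h'.elim (·.2) fun h'' => absurd h''.1 h.ne', fun h' => Or.inl ⟨e.symm, h'⟩⟩
        rw [h1, h2]
        exact hΓ.admissible.1.2 _ _ h
      · have h1 : Γ.subdivision.arc x y ↔ Γ.arc y.lo x.lo :=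
          ⟨fun h' => h'.elim (fun h'' => absurd h''.1 h.ne) (·.2), fun h' => Or.inr ⟨e, h'⟩⟩
        have h2 : Γ.subdivision.arc y x ↔ Γ.arc x.lo y.lo :=
          ⟨fun h' => h'.elim (fun h'' => absurd h''.1 h.ne') (·.2), fun h' => Or.inr ⟨e.symm, h'⟩⟩
        rw [h1, h2]
        exact hΓ.admissible.1.2 _ _ h.symm
    · intro u v v' u' hc
      have huv := hc.1
      have huv' := hc.2.2.1
      rw [subdivision_arc, subdivision_arc]
      rcases subdivision_isFourCycle hc with ⟨e, e', h⟩ | ⟨e, e', h⟩ | ⟨e, e', h, h'⟩ |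
        ⟨e, e', h, h'⟩
      · have h1 := h.1.ne
        have h2 := h.2.2.1.ne'
        simp only [e, e', h1, h2, true_and, false_and, or_false]
        exact hΓ.admissible.2 _ _ _ _ h
      · have h1 := h.1.ne
        have h2 := h.2.2.1.ne'
        simp only [e, e', h1, h2, true_and, false_and, false_or]
        exact hΓ.op.admissible.2 _ _ _ _ h
      · rw [h, h', e, e']
        have h1 : u'.hi ≠ v'.hi := fun h1 => huv.ne (BooleanPair.ext e (h.trans (h1.trans h'.symm)))
        simp [h1]
      · rw [h, h', e, e']
        have h1 : u'.lo ≠ v'.lo := fun h1 => huv.ne (BooleanPair.ext (h.trans (h1.trans h'.symm)) e)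
        simp [h1]
  orbitInvariant := by
    refine isOrbitInvariant_of_isFourCycle fun u v v' u' hc => ?_
    have huv := hc.1
    rcases subdivision_isFourCycle hc with ⟨e, e', h⟩ | ⟨e, e', h⟩ | ⟨e, e', h, h'⟩ |
      ⟨e, e', h, h'⟩
    · rw [subdivision_len_of_lo e, subdivision_len_of_lo e', hΓ.len_opposite h]
    · rw [subdivision_len_of_hi h.1.ne, subdivision_len_of_hi h.2.2.1.ne', hΓ.len_opposite h]
    · rw [subdivision_len_of_lo e, subdivision_len_of_lo e', h, h']
    · have h1 : u.lo ≠ v.lo := fun h1 => huv.ne (BooleanPair.ext h1 e)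
      rw [subdivision_len_of_hi h1, subdivision_len_of_hi (by rwa [← h, ← h']), h, h']
  pos := by
    intro e he
    induction e with
    | _ x y =>
      rcases he with ⟨e, h⟩ | ⟨e, h⟩
      · rw [subdivision_len_of_lo e]
        exact half_pos (hΓ.len_pos h)
      · rw [subdivision_len_of_hi h.ne]
        exact half_pos (hΓ.len_pos h)

theorem subdivision_dist (x z : Γ.BooleanPair) :
    Γ.subdivision.dist x z = (Γ.dist x.lo z.lo + Γ.dist x.hi z.hi) / 2 := by
  refine hΓ.subdivision.dist_eq_of_step
    (f := fun x : Γ.BooleanPair => (Γ.dist x.lo z.lo + Γ.dist x.hi z.hi) / 2) ?_ ?_ x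
  · simp [hΓ.dist_self]
  · rintro x y h hd
    rw [hΓ.subdivision_graph_dist, hΓ.subdivision_graph_dist] at hd
    rcases h with ⟨e, h⟩ | ⟨e, h⟩
    · rw [e] at hd
      rw [subdivision_len_of_lo e, hΓ.dist_step h (z := z.hi) (by omega), e]
      ring
    · rw [e] at hd
      rw [subdivision_len_of_hi h.ne, hΓ.dist_step h (z := z.lo) (by omega), e]
      ring

end IsModularComplex

end ComplexData

end LConvexity

namespace LConvexity

/-! ### Locally submodular functions on products -/

section Product

theorem IsLocallySubmodular.comp_orderIso {M M' : Type*} [Preorder M] [Preorder M']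
    {v f : M' → ℝ} (hf : IsLocallySubmodular v f) (e : M ≃o M') :
    IsLocallySubmodular (fun x => v (e x)) (fun x => f (e x)) where
  bounded a b m j hm hj := by
    refine hf.bounded _ _ _ _ ?_ ?_
    · have := (e.isGLB_image' (s := {a, b}) (x := m)).2 hm
      rwa [Set.image_pair] at this
    · have := (e.isLUB_image' (s := {a, b}) (x := j)).2 hj
      rwa [Set.image_pair] at this
  exchange t ht a a' b b' h := by
    have hb : ∀ {x y : M}, BddAbove {x, y} → BddAbove {e x, e y} := fun hxy => by
      obtain ⟨p, h1, h2⟩ := bddAbove_pair_iff.1 hxy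
      exact bddAbove_pair (e.monotone h1) (e.monotone h2)
    refine hf.exchange t ht _ _ _ _ ⟨e.monotone h.le_fst, e.monotone h.le_snd, hb h.bddAbove,
      hb h.bddAbove', h.eq, fun c d h1 h2 h3 h4 h5 => ?_⟩
    obtain ⟨p, h6, h7⟩ := bddAbove_pair_iff.1 h5
    have := h.optimal (e.symm c) (e.symm d) (e.le_symm_apply.2 h1) (e.symm_apply_le.2 h2)
      (e.le_symm_apply.2 h3) (e.symm_apply_le.2 h4)
      (bddAbove_pair (e.symm.monotone h6) (e.symm.monotone h7))
    simpa [pairWeight] using this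

section Coordinate

variable {L : Type*} [Preorder L] (H : IsModularSemilattice L) {v : L → ℝ} (hv : IsValuation v)
include H hv

/-- The exchange inequality for a distance `v x - 2 v (x ∧ c)`, up to a constant. -/
theorem IsModularSemilattice.exchange_gate {t : ℝ} {a a' b b' : L}
    (h : IsOptimalExchange v t a a' b b') {c e : L} (hce : BddAbove {c, e}) :
    (1 - t) * ((v a - 2 * v (meet a c)) - (v a' - 2 * v (meet a' c))) ≤
      t * ((v b - 2 * v (meet b e)) - (v b' - 2 * v (meet b' e))) := by
  have H' := H.toIsBoundedJoinSemilattice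
  obtain ⟨r, hcr, her⟩ := bddAbove_pair_iff.1 hce
  obtain ⟨p, hap, hbp⟩ := bddAbove_pair_iff.1 h.bddAbove
  obtain ⟨p', hap', hbp'⟩ := bddAbove_pair_iff.1 h.bddAbove'
  set x := meet a' c
  set y := meet b e
  have hxa : x ≤ a' := H'.meet_le_left a' c
  have hxc : x ≤ c := H'.meet_le_right a' c
  have hyb : y ≤ b := H'.meet_le_left b e
  have hye : y ≤ e := H'.meet_le_right b e
  have hax := bddAbove_pair h.le_fst hxa
  have hby := bddAbove_pair h.le_snd hyb
  have haxa : join a x ≤ a' := H'.join_le h.le_fst hxa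
  have hbyb : join b' y ≤ b := H'.join_le h.le_snd hyb
  -- Two uses of the triple property: first for a, x, y, then for a ∨ x, b', y. The resulting pair
  -- competes with (a,b), and valuation identities turn its weight bound into the claim.
  have hbdd : BddAbove {join a x, join b' y} := by
    obtain ⟨u, u1, u2, u3⟩ := H.exists_upper_bound hax
      (bddAbove_pair (hxc.trans hcr) (hye.trans her)) (bddAbove_pair (hyb.trans hbp) hap)
    obtain ⟨w, w1, w2, w3⟩ := H.exists_upper_bound (a := join a x) (b := b') (c := y)
      (bddAbove_pair (haxa.trans hap') hbp') hby (bddAbove_pair u3 (H'.join_le u1 u2))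
    exact bddAbove_pair w1 (H'.join_le w2 w3)
  have o := h.optimal _ _ (H'.le_join_left hax) haxa (H'.le_join_left hby) hbyb hbdd
  have o' := h.eq
  have e1 := H'.val_isLUB hv (H'.isLUB_join hax)
  have e2 := H'.val_isLUB hv (H'.isLUB_join hby)
  have e3 : meet a x = meet a c := H'.antisymm _ _ (H'.meet_mono le_rfl hxc)
    (H'.le_meet (H'.meet_le_left a c) (H'.meet_mono h.le_fst le_rfl))
  have e4 : meet b' y = meet b' e := H'.antisymm _ _ (H'.meet_mono le_rfl hye)
    (H'.le_meet (H'.meet_le_left b' e) (H'.meet_mono h.le_snd le_rfl))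
  rw [e3] at e1
  rw [e4] at e2
  unfold pairWeight at o o'
  linear_combination 2 * o + o' + 2 * (1 - t) * e1 + 2 * t * e2

/-- Submodularity of a distance `v x - 2 v (x ∧ c)` on pairs with an upper bound, where the gate
may grow along the chain from `m` to `j`. -/
theorem IsModularSemilattice.bounded_gate {a b m j c c' : L} (hm : IsGLB {a, b} m)
    (hj : IsLUB {a, b} j) (hc : c' ≤ c) :
    (v j - 2 * v (meet j c)) - (v a - 2 * v (meet a c)) ≤
      (v b - 2 * v (meet b c')) - (v m - 2 * v (meet m c')) := by
  have H' := H.toIsBoundedJoinSemilattice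
  obtain ⟨haj, hbj, -⟩ := isLUB_pair'.1 hj
  have e1 := H'.val_isLUB hv hj
  rw [H'.meet_eq hm] at e1
  have k1 : meet a c ≤ meet j c := H'.meet_mono haj le_rfl
  have k2 : meet b c' ≤ meet j c := H'.meet_mono hbj hc
  have e2 := H'.val_isLUB hv (H'.isLUB_join (bddAbove_pair k1 k2))
  have e3 := H'.val_mono hv (H'.join_le k1 k2)
  have e4 : meet (meet a c) (meet b c') ≤ meet m c' :=
    H'.le_meet ((isGLB_pair.1 hm).2.2 _ ((H'.meet_le_left _ _).trans (H'.meet_le_left a c))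
      ((H'.meet_le_right _ _).trans (H'.meet_le_left b c')))
      ((H'.meet_le_right _ _).trans (H'.meet_le_right b c'))
  have e5 := H'.val_mono hv e4
  linarith

end Coordinate

/-- `F` is a distance between two semilattices which is given by monotone gates in the first
semilattice. -/
def HasGates {L L' : Type*} [Preorder L] [Preorder L'] (v : L → ℝ) (F : L → L' → ℝ) : Prop :=
  ∃ (g : L' → L) (k : L' → ℝ), Monotone g ∧ ∀ x z, F x z = v x - 2 * v (meet x (g z)) + k z

variable {ι : Type*} {L : ι → Type*}

/-- The sum of the valuations of the coordinates. -/
noncomputable def piVal [Fintype ι] (v : ∀ i, L i → ℝ) (x : ∀ i, L i) : ℝ := ∑ i, v i (x i)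

theorem piVal_update [Fintype ι] [DecidableEq ι] (v : ∀ i, L i → ℝ) (x : ∀ i, L i) (i : ι) (y : L i) :
    piVal v (Function.update x i y) = piVal v x - v i (x i) + v i y := by
  unfold piVal
  rw [← Finset.add_sum_erase _ _ (Finset.mem_univ i),
    ← Finset.add_sum_erase _ (fun i => v i (x i)) (Finset.mem_univ i),
    Function.update_self]
  have : ∑ j ∈ Finset.univ.erase i, v j (Function.update x i y j) =
      ∑ j ∈ Finset.univ.erase i, v j (x j) :=
    Finset.sum_congr rfl fun j hj => by rw [Function.update_of_ne (Finset.ne_of_mem_erase hj)]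
  rw [this]
  ring

variable [∀ i, Preorder (L i)]

theorem isGLB_pair_apply {a b m : ∀ i, L i} (h : IsGLB {a, b} m) (i : ι) :
    IsGLB {a i, b i} (m i) := by
  have := isGLB_pi.1 h i
  rwa [Set.image_pair] at this

theorem isLUB_pair_apply {a b m : ∀ i, L i} (h : IsLUB {a, b} m) (i : ι) :
    IsLUB {a i, b i} (m i) := by
  have := isLUB_pi.1 h i
  rwa [Set.image_pair] at this

variable [Fintype ι]

theorem IsOptimalExchange.apply {v : ∀ i, L i → ℝ} {t : ℝ} {a a' b b' : ∀ i, L i}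
    (h : IsOptimalExchange (piVal v) t a a' b b') (i : ι) :
    IsOptimalExchange (v i) t (a i) (a' i) (b i) (b' i) := by
  classical
  obtain ⟨p, hap, hbp⟩ := bddAbove_pair_iff.1 h.bddAbove
  obtain ⟨p', hap', hbp'⟩ := bddAbove_pair_iff.1 h.bddAbove'
  have hopt : ∀ c e, a i ≤ c → c ≤ a' i → b' i ≤ e → e ≤ b i → BddAbove {c, e} →
      pairWeight (v i) t c e ≤ pairWeight (v i) t (a i) (b i) := by
    intro c e h1 h2 h3 h4 h5
    obtain ⟨q, hcq, heq⟩ := bddAbove_pair_iff.1 h5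
    have := h.optimal (Function.update a i c) (Function.update b i e)
      (le_update_iff.2 ⟨h1, fun _ _ => le_rfl⟩) (update_le_iff.2 ⟨h2, fun j _ => h.le_fst j⟩)
      (le_update_iff.2 ⟨h3, fun j _ => h.le_snd j⟩) (update_le_iff.2 ⟨h4, fun _ _ => le_rfl⟩)
      (bddAbove_pair (p := Function.update p i q) (update_le_update_iff.2
        ⟨hcq, fun j _ => hap j⟩) (update_le_update_iff.2 ⟨heq, fun j _ => hbp j⟩))
    unfold pairWeight at this ⊢
    rw [piVal_update, piVal_update] at this
    linarith
  have h1 := hopt (a' i) (b' i) (h.le_fst i) le_rfl le_rfl (h.le_snd i)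
    (bddAbove_pair (hap' i) (hbp' i))
  refine ⟨h.le_fst i, h.le_snd i, bddAbove_pair (hap i) (hbp i), bddAbove_pair (hap' i) (hbp' i),
    le_antisymm ?_ h1, hopt⟩
  -- For the reverse comparison, the i-th entries of (a',b') are replaced by those of (a,b). The new
  -- pair weighs at most as much as (a,b), hence as (a',b').
  have := h.optimal (Function.update a' i (a i)) (Function.update b' i (b i))
    (le_update_iff.2 ⟨le_rfl, fun j _ => h.le_fst j⟩)
    (update_le_iff.2 ⟨h.le_fst i, fun _ _ => le_rfl⟩)
    (le_update_iff.2 ⟨h.le_snd i, fun _ _ => le_rfl⟩)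
    (update_le_iff.2 ⟨le_rfl, fun j _ => h.le_snd j⟩)
    (bddAbove_pair (p := Function.update p' i (p i)) (update_le_update_iff.2
      ⟨hap i, fun j _ => hap' j⟩) (update_le_update_iff.2 ⟨hbp i, fun j _ => hbp' j⟩))
  have h2 := h.eq
  unfold pairWeight at this h2 ⊢
  rw [piVal_update, piVal_update] at this
  linarith

variable (H : ∀ i, IsModularSemilattice (L i)) {v : ∀ i, L i → ℝ} (hv : ∀ i, IsValuation (v i))
include H hv

theorem isLocallySubmodular_gate (i : ι) (c : L i) (k : ℝ) :
    IsLocallySubmodular (piVal v) (fun x => v i (x i) - 2 * v i (meet (x i) c) + k) where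
  bounded a b m j hm hj := by
    have := (H i).bounded_gate (hv i) (isGLB_pair_apply hm i) (isLUB_pair_apply hj i)
      (le_refl c)
    linarith
  exchange t _ a a' b b' h := by
    have := (H i).exchange_gate (hv i) (h.apply i) (bddAbove_pair (le_refl c) (le_refl c))
    linarith

theorem isLocallySubmodular_of_hasGates {i j : ι} {F : L i → L j → ℝ} (hF : HasGates (v i) F)
    (hF' : HasGates (v j) fun z x => F x z) :
    IsLocallySubmodular (piVal v) (fun x => F (x i) (x j)) := by
  obtain ⟨g, k, hg, hgF⟩ := hF
  obtain ⟨g', k', hg', hgF'⟩ := hF'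
  have hbdd : ∀ {x y : ∀ i, L i} (l), BddAbove {x, y} → BddAbove {x l, y l} := by
    intro x y l h
    obtain ⟨p, h1, h2⟩ := bddAbove_pair_iff.1 h
    exact bddAbove_pair (h1 l) (h2 l)
  have hbddg : ∀ {l l' : ι} {f : L l → L l'} {x y}, Monotone f → BddAbove {x, y} →
      BddAbove {f x, f y} := by
    intro l l' f x y hf h
    obtain ⟨p, h1, h2⟩ := bddAbove_pair_iff.1 h
    exact bddAbove_pair (hf h1) (hf h2)
  constructor
  · intro a b m u hm hu
    -- The arguments of F change one at a time: the first against u j and b j, then the second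
    -- against a i and m i. The gates compare because b j ≤ u j and m i ≤ a i.
    have k1 := (H i).bounded_gate (hv i) (isGLB_pair_apply hm i) (isLUB_pair_apply hu i)
      (hg ((isLUB_pair'.1 hu).2.1 j))
    have k2 := (H j).bounded_gate (hv j) (isGLB_pair_apply hm j) (isLUB_pair_apply hu j)
      (hg' ((isGLB_pair.1 hm).1 i))
    have e1 := hgF (u i) (u j)
    have e2 := hgF (a i) (u j)
    have e3 := hgF (b i) (b j)
    have e4 := hgF (m i) (b j)
    have e5 := hgF' (u j) (a i)
    have e6 := hgF' (a j) (a i)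
    have e7 := hgF' (b j) (m i)
    have e8 := hgF' (m j) (m i)
    simp only at e5 e6 e7 e8
    linarith
  · intro t _ a a' b b' h
    -- Again one argument at a time: the first with gates of a' j and b' j, then the second with
    -- gates of a i and b i. Monotone gate maps keep these pairs bounded above.
    have k1 := (H i).exchange_gate (hv i) (h.apply i) (hbddg hg (hbdd j h.bddAbove'))
    have k2 := (H j).exchange_gate (hv j) (h.apply j) (hbddg hg' (hbdd i h.bddAbove))
    have e1 := hgF (a i) (a' j)
    have e2 := hgF (a' i) (a' j)
    have e3 := hgF (b i) (b' j)
    have e4 := hgF (b' i) (b' j)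
    have e5 := hgF' (a j) (a i)
    have e6 := hgF' (a' j) (a i)
    have e7 := hgF' (b j) (b i)
    have e8 := hgF' (b' j) (b i)
    simp only at e5 e6 e7 e8
    have k1' : (1 - t) * (F (a i) (a' j) - F (a' i) (a' j)) ≤
        t * (F (b i) (b' j) - F (b' i) (b' j)) := by rw [e1, e2, e3, e4]; linarith
    have k2' : (1 - t) * (F (a i) (a j) - F (a i) (a' j)) ≤
        t * (F (b i) (b j) - F (b i) (b' j)) := by rw [e5, e6, e7, e8]; linarith
    linarith

end Product

/-! ### The semilattice of the Boolean pairs at a vertex -/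

namespace ComplexData

variable {V : Type*} {Γ : ComplexData V}

/-- The elements `q` for which `(p,q)` is a Boolean pair. -/
def Star (Γ : ComplexData V) (p : V) : Type _ := {q : V // Γ.IsBoolean p q}

instance (p : V) : Preorder (Γ.Star p) where
  le x y := Γ.le x.1 y.1
  le_refl _ := Relation.ReflTransGen.refl
  le_trans _ _ _ h h' := Relation.ReflTransGen.trans h h'

theorem isGLB_star {p : V} {a b m : Γ.Star p} (h : Γ.IsMeet a.1 b.1 m.1) : IsGLB {a, b} m :=
  isGLB_pair.2 ⟨h.1, h.2.1, fun c h1 h2 => h.2.2 c.1 h1 h2⟩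

theorem isLUB_star {p : V} {a b j : Γ.Star p} (h : Γ.IsJoin a.1 b.1 j.1) : IsLUB {a, b} j :=
  isLUB_pair'.2 ⟨h.1, h.2.1, fun c h1 h2 => h.2.2 c.1 h1 h2⟩

namespace IsModularComplex

variable (hΓ : Γ.IsModularComplex)
include hΓ

/-- A vertex r between x and y is the join of x ∧ r and r ∧ y, which are Boolean over p as elements
of [p,x] and [p,y]. -/
theorem isConvexSet_star (p : V) : IsConvexSet Γ.graph {x | Γ.IsBoolean p x} := by
  intro x hx y hy r hr
  have hpx := hΓ.le_of_isBoolean hx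
  have hpy := hΓ.le_of_isBoolean hy
  have hpr := hΓ.isConvexSet_filter p x hpx y hpy r hr
  obtain ⟨a, ha, hda⟩ := hΓ.exists_isMeet hpx hpr
  obtain ⟨b, hb, hdb⟩ := hΓ.exists_isMeet hpr hpy
  have h1 := hΓ.connected.dist_triangle (u := x) (v := a) (w := y)
  have h2 := hΓ.connected.dist_triangle (u := a) (v := b) (w := y)
  have h3 := hΓ.connected.dist_triangle (u := a) (v := r) (w := b)
  have hj := hΓ.isJoin_of_between ha.2.1 hb.1 (by omega)
  exact hΓ.isBoolean_of_isJoin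
    (hΓ.isBoolean_of_mem_Icc hx (le_refl p) (ha.2.2 p hpx hpr) ha.1)
    (hΓ.isBoolean_of_mem_Icc hy (le_refl p) (hb.2.2 p hpr hpy) hb.2.1) hj

theorem exists_isMeet_star {p : V} (a b : Γ.Star p) : ∃ m : Γ.Star p, Γ.IsMeet a.1 b.1 m.1 := by
  have ha := hΓ.le_of_isBoolean a.2
  have hb := hΓ.le_of_isBoolean b.2
  obtain ⟨m, hm, -⟩ := hΓ.exists_isMeet ha hb
  exact ⟨⟨m, hΓ.isBoolean_of_mem_Icc a.2 (le_refl p) (hm.2.2 p ha hb) hm.1⟩, hm⟩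

theorem exists_isJoin_star {p u : V} (a b : Γ.Star p) (ha : Γ.le a.1 u) (hb : Γ.le b.1 u) :
    ∃ j : Γ.Star p, Γ.IsJoin a.1 b.1 j.1 := by
  obtain ⟨j, hj⟩ := hΓ.exists_isJoin ha hb
  exact ⟨⟨j, hΓ.isBoolean_of_isJoin a.2 b.2 hj⟩, hj⟩

theorem star_isBoundedJoinSemilattice (p : V) : IsBoundedJoinSemilattice (Γ.Star p) where
  antisymm a b h h' := Subtype.ext (hΓ.le_antisymm h h')
  exists_meet a b := by
    obtain ⟨m, hm⟩ := hΓ.exists_isMeet_star a b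
    exact ⟨m, isGLB_star hm⟩
  exists_join u a b ha hb := by
    obtain ⟨j, hj⟩ := hΓ.exists_isJoin_star (u := u.1) a b ha hb
    exact ⟨j, isLUB_star hj⟩

theorem isMeet_star {p : V} (a b : Γ.Star p) : Γ.IsMeet a.1 b.1 (meet a b).1 := by
  obtain ⟨m, hm⟩ := hΓ.exists_isMeet_star a b
  rwa [(hΓ.star_isBoundedJoinSemilattice p).meet_eq (isGLB_star hm)]

theorem isJoin_star {p : V} {a b : Γ.Star p} (h : BddAbove {a, b}) :
    Γ.IsJoin a.1 b.1 (join a b).1 := by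
  obtain ⟨u, ha, hb⟩ := bddAbove_pair_iff.1 h
  obtain ⟨j, hj⟩ := hΓ.exists_isJoin_star (u := u.1) a b ha hb
  rwa [(hΓ.star_isBoundedJoinSemilattice p).join_eq (isLUB_star hj)]

theorem dist_star_of_le {p : V} {a b : Γ.Star p} (h : a ≤ b) :
    Γ.dist p a.1 + Γ.dist a.1 b.1 = Γ.dist p b.1 :=
  hΓ.dist_add_of_between (hΓ.dist_add_of_le (hΓ.le_of_isBoolean a.2) h)

theorem star_isValuation (p : V) : IsValuation fun x : Γ.Star p => Γ.dist x.1 p where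
  pos a b h := by
    have hne : a.1 ≠ b.1 := fun h' => h.not_ge (by rw [Subtype.ext h'])
    have h1 := hΓ.dist_star_of_le h.le
    have h2 := hΓ.dist_pos hne
    rw [hΓ.dist_comm _ p, hΓ.dist_comm _ p]
    linarith
  modular a b h := by
    have hm := hΓ.isMeet_star a b
    have hj := hΓ.isJoin_star h
    have h1 := hΓ.weighted_dist_isMeet_isJoin hm hj
    have h2 := hΓ.dist_star_of_le (a := meet a b) (b := a) hm.1
    have h3 := hΓ.dist_star_of_le (a := b) (b := join a b) hj.2.1
    simp only [hΓ.dist_comm _ p]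
    linarith

/-- The modular law comes from the valuation and triple joins from the median argument in
`exists_upper_bound`, since joins of elements of a star stay in it. -/
theorem star_isModularSemilattice (p : V) : IsModularSemilattice (Γ.Star p) := by
  have H := hΓ.star_isBoundedJoinSemilattice p
  refine ⟨H.antisymm, H.exists_meet, H.exists_join,
    fun q a b c ha hb hc hac => H.modular_law (hΓ.star_isValuation p) ha hb hc hac, ?_⟩
  rintro a b c ⟨x, hx⟩ ⟨y, hy⟩ ⟨z, hz⟩
  obtain ⟨hx1, hx2, -⟩ := isLUB_pair'.1 hx
  obtain ⟨hy1, hy2, -⟩ := isLUB_pair'.1 hy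
  obtain ⟨hz1, hz2, -⟩ := isLUB_pair'.1 hz
  obtain ⟨u, h1, h2, h3⟩ := hΓ.exists_upper_bound hx1 hx2 hy1 hy2 hz1 hz2
  obtain ⟨j, hj⟩ := hΓ.exists_isJoin_star a b h1 h2
  obtain ⟨k, hk⟩ := hΓ.exists_isJoin_star j c (hj.2.2 u h1 h2) h3
  refine ⟨k, ?_, fun w hw => ?_⟩
  · rintro w (rfl | rfl | rfl)
    · exact le_trans hj.1 hk.1
    · exact le_trans hj.2.1 hk.1
    · exact hk.2.1
  · exact hk.2.2 w.1 (hj.2.2 w.1 (hw (by simp)) (hw (by simp))) (hw (by simp))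

/-- Split d(x,z) at the gate of z in the star, then split the distance from x to the gate at their
meet; the last bracket depends on z only. -/
theorem exists_gate_star (p : V) : ∃ g : V → Γ.Star p, (∀ z z', Γ.le z z' → g z ≤ g z') ∧
    ∀ (x : Γ.Star p) z, Γ.dist x.1 z =
      Γ.dist x.1 p - 2 * Γ.dist (meet x (g z)).1 p + (Γ.dist (g z).1 p + Γ.dist (g z).1 z) := by
  have hc := hΓ.isConvexSet_star p
  choose g hg using hΓ.modular.exists_isGate hc ⟨p, Γ.isBoolean_refl p⟩
  refine ⟨fun z => ⟨g z, (hg z).1⟩, fun z z' h => hΓ.isGate_mono hc h (hg z) (hg z'),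
    fun x z => ?_⟩
  set y : Γ.Star p := ⟨g z, (hg z).1⟩
  have h1 := hΓ.dist_add_of_between ((hg z).2 x.1 x.2)
  have hm := hΓ.isMeet_star x y
  have h2 := hΓ.dist_add_of_between (hΓ.isMeet_between hm)
  have h3 := hΓ.dist_star_of_le (a := meet x y) (b := x) hm.1
  have h4 := hΓ.dist_star_of_le (a := meet x y) (b := y) hm.2.1
  have e1 := hΓ.dist_comm x.1 (meet x y).1
  have e2 : y.1 = g z := rfl
  rw [e2] at h2 h4 ⊢
  rw [hΓ.dist_comm _ p, hΓ.dist_comm _ p, hΓ.dist_comm _ p]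
  linarith

theorem hasGates_star (p p' : V) :
    HasGates (fun x : Γ.Star p => Γ.dist x.1 p) (fun x (z : Γ.Star p') => Γ.dist x.1 z.1) := by
  obtain ⟨g, hg, h⟩ := hΓ.exists_gate_star p
  exact ⟨fun z => g z.1, fun z => Γ.dist (g z.1).1 p + Γ.dist (g z.1).1 z.1,
    fun z z' hz => hg _ _ hz, fun x z => h x z.1⟩

end IsModularComplex

end ComplexData

end LConvexity

namespace LConvexity

namespace ComplexData

variable {V : Type*} {Γ : ComplexData V} {n : ℕ}

/-! ### Cartesian powers -/

/-- Phrased without subtraction, to serve both natural and real distances. -/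
theorem sum_add_eq_of_eq_off {ι M : Type*} [Fintype ι] [AddCommMonoid M] {a b : ι → M} {i : ι}
    (h : ∀ j, j ≠ i → a j = b j) : ∑ j, a j + b i = ∑ j, b j + a i := by
  classical
  rw [← Finset.add_sum_erase _ a (Finset.mem_univ i), ← Finset.add_sum_erase _ b (Finset.mem_univ i),
    Finset.sum_congr rfl fun j hj => h j (Finset.ne_of_mem_erase hj)]
  ac_rfl

theorem pow_arc_of_eq_off {ρ σ : Fin n → V} {i : Fin n} (h : ∀ j, j ≠ i → ρ j = σ j)
    (hne : ρ i ≠ σ i) : (Γ.pow n).arc ρ σ ↔ Γ.arc (ρ i) (σ i) := by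
  refine ⟨fun ⟨k, hk, hk'⟩ => ?_, fun h' => ⟨i, h', h⟩⟩
  by_cases hki : i = k
  · rwa [hki]
  · exact absurd (hk' i hki) hne

theorem pow_len_of_eq_off {ρ σ : Fin n → V} {i : Fin n} (h : ∀ j, j ≠ i → ρ j = σ j)
    (hne : ρ i ≠ σ i) : (Γ.pow n).len s(ρ, σ) = Γ.len s(ρ i, σ i) := by
  classical
  change ∑ j, (if ρ j = σ j then 0 else Γ.len s(ρ j, σ j)) = _
  rw [Finset.sum_eq_single i (fun j _ hj => if_pos (h j hj)) (by simp), if_neg hne]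

/-- The coordinates changed along the cycle are i, i, i, i or i, j, i, j; any other sequence makes
two of its vertices coincide. -/
theorem pow_isFourCycle {u v v' u' : Fin n → V} (h : IsFourCycle (Γ.pow n).graph u v v' u') :
    ∃ i, (∀ j, j ≠ i → u j = v j) ∧ (∀ j, j ≠ i → u' j = v' j) ∧ u i ≠ v i ∧ u' i ≠ v' i ∧
      (IsFourCycle Γ.graph (u i) (v i) (v' i) (u' i) ∨ (u i = u' i ∧ v i = v' i)) := by
  obtain ⟨⟨i, a1, b1⟩, ⟨j, a2, b2⟩, ⟨k, a3, b3⟩, ⟨l, a4, b4⟩, h5, h6⟩ := h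
  by_cases hij : i = j
  · subst hij
    by_cases hik : i = k
    · subst hik
      by_cases hil : i = l
      · subst hil
        refine ⟨i, b1, fun j hj => (b3 j hj).symm, a1.ne, a3.ne', Or.inl ⟨a1, a2, a3, a4, ?_, ?_⟩⟩
        · intro h
          refine h5 (funext fun j => ?_)
          by_cases hj : j = i
          · rw [hj, h]
          · rw [b1 j hj, b2 j hj]
        · intro h
          refine h6 (funext fun j => ?_)
          by_cases hj : j = i
          · rw [hj, h]
          · rw [b2 j hj, b3 j hj]
      · have hl := Ne.symm hil
        exact absurd ((b3 l hl).symm.trans ((b2 l hl).symm.trans (b1 l hl).symm)) a4.ne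
    · have hk := Ne.symm hik
      have hlk : k = l := by
        by_contra hkl
        exact a3.ne ((b2 k hk).symm.trans ((b1 k hk).symm.trans (b4 k hkl).symm))
      subst hlk
      refine absurd (funext fun j => ?_) h5
      by_cases hj : j = i
      · rw [hj, ← b4 i hik, b3 i hik]
      · rw [b1 j hj, b2 j hj]
  · by_cases hik : i = k
    · subst hik
      by_cases hjl : j = l
      · subst hjl
        exact ⟨i, b1, fun j hj => (b3 j hj).symm, a1.ne, a3.ne',
          Or.inr ⟨(b4 i hij).symm, b2 i hij⟩⟩
      · have hj := Ne.symm hij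
        exact absurd ((b1 j hj).symm.trans ((b4 j hjl).symm.trans (b3 j hj).symm)) a2.ne
    · have hil : i = l := by
        by_contra hil
        exact a1.ne ((b4 i hil).symm.trans ((b3 i hik).symm.trans (b2 i hij).symm))
      subst hil
      refine absurd (funext fun m => ?_) h6
      by_cases hm : m = i
      · rw [hm, b2 i hij, b3 i hik]
      · rw [b4 m hm, b1 m hm]

namespace IsModularComplex

variable (hΓ : Γ.IsModularComplex)
include hΓ

theorem reachable_and_pow_graph_dist (ρ σ : Fin n → V) :
    (Γ.pow n).graph.Reachable ρ σ ∧
      (Γ.pow n).graph.dist ρ σ = ∑ i, Γ.graph.dist (ρ i) (σ i) := by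
  refine reachable_and_dist_eq_of_descent
    (δ := fun ρ : Fin n → V => ∑ i, Γ.graph.dist (ρ i) (σ i)) (fun ρ h => ?_) (by simp) ?_ ?_ ρ
  · simp only [Finset.sum_eq_zero_iff, Finset.mem_univ, true_imp_iff] at h
    exact funext fun i => hΓ.connected.dist_eq_zero_iff.1 (h i)
  · rintro ρ τ ⟨i, h, h'⟩
    have h1 := sum_add_eq_of_eq_off (i := i) (a := fun j => Γ.graph.dist (ρ j) (σ j))
      (b := fun j => Γ.graph.dist (τ j) (σ j)) fun j hj => by simp only [h' j hj]
    have := hΓ.modular.dist_adj h (σ i)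
    omega
  · intro ρ hρ
    obtain ⟨i, hi⟩ := Function.ne_iff.1 hρ
    obtain ⟨y, hy, hd⟩ := exists_adj_dist_add_one hΓ.connected hi
    have h' : ∀ j, j ≠ i → ρ j = Function.update ρ i y j := fun j hj => by
      rw [Function.update_of_ne hj]
    refine ⟨Function.update ρ i y, ⟨i, by rwa [Function.update_self], h'⟩, ?_⟩
    have h1 := sum_add_eq_of_eq_off (i := i) (a := fun j => Γ.graph.dist (ρ j) (σ j))
      (b := fun j => Γ.graph.dist (Function.update ρ i y j) (σ j))
      fun j hj => by simp only [← h' j hj]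
    simp only [Function.update_self] at h1 ⊢
    omega

theorem pow_graph_dist (ρ σ : Fin n → V) :
    (Γ.pow n).graph.dist ρ σ = ∑ i, Γ.graph.dist (ρ i) (σ i) :=
  (hΓ.reachable_and_pow_graph_dist ρ σ).2

theorem pow (n : ℕ) : (Γ.pow n).IsModularComplex where
  modular := by
    obtain ⟨p⟩ := hΓ.connected.nonempty
    refine ⟨{ preconnected := fun ρ σ => (hΓ.reachable_and_pow_graph_dist ρ σ).1
              nonempty := ⟨fun _ => p⟩ }, fun a b c => ?_⟩
    choose m hm using fun i => hΓ.modular.2 (a i) (b i) (c i)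
    refine ⟨m, ?_, ?_, ?_⟩ <;>
      rw [hΓ.pow_graph_dist, hΓ.pow_graph_dist, hΓ.pow_graph_dist, ← Finset.sum_add_distrib]
    · exact Finset.sum_congr rfl fun i _ => (hm i).1
    · exact Finset.sum_congr rfl fun i _ => (hm i).2.1
    · exact Finset.sum_congr rfl fun i _ => (hm i).2.2
  admissible := by
    refine ⟨⟨fun ρ σ ⟨i, h, h'⟩ => ⟨i, hΓ.adj_of_arc h, h'⟩, ?_⟩, fun u v v' u' hc => ?_⟩
    · rintro ρ σ ⟨i, h, h'⟩
      rw [pow_arc_of_eq_off h' h.ne, pow_arc_of_eq_off (fun j hj => (h' j hj).symm) h.ne']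
      exact hΓ.admissible.1.2 _ _ h
    · obtain ⟨i, h1, h2, h3, h4, h⟩ := pow_isFourCycle hc
      rw [pow_arc_of_eq_off h1 h3, pow_arc_of_eq_off h2 h4]
      rcases h with h | ⟨h, h'⟩
      · exact hΓ.admissible.2 _ _ _ _ h
      · rw [h, h']
  orbitInvariant := by
    refine isOrbitInvariant_of_isFourCycle fun u v v' u' hc => ?_
    obtain ⟨i, h1, h2, h3, h4, h⟩ := pow_isFourCycle hc
    rw [pow_len_of_eq_off h1 h3, pow_len_of_eq_off h2 h4]
    rcases h with h | ⟨h, h'⟩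
    · exact hΓ.len_opposite h
    · rw [h, h']
  pos := by
    intro e he
    induction e with
    | _ ρ σ =>
      obtain ⟨i, h, h'⟩ := he
      rw [pow_len_of_eq_off h' h.ne]
      exact hΓ.len_pos h

theorem pow_dist (ρ σ : Fin n → V) : (Γ.pow n).dist ρ σ = ∑ i, Γ.dist (ρ i) (σ i) := by
  refine (hΓ.pow n).dist_eq_of_step (f := fun ρ : Fin n → V => ∑ i, Γ.dist (ρ i) (σ i)) ?_ ?_ ρ
  · simp [hΓ.dist_self]
  · rintro ρ τ ⟨i, h, h'⟩ hd
    rw [hΓ.pow_graph_dist, hΓ.pow_graph_dist] at hd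
    have h1 := sum_add_eq_of_eq_off (i := i) (a := fun j => Γ.graph.dist (ρ j) (σ j))
      (b := fun j => Γ.graph.dist (τ j) (σ j)) fun j hj => by simp only [h' j hj]
    have h2 := sum_add_eq_of_eq_off (i := i) (a := fun j => Γ.dist (ρ j) (σ j))
      (b := fun j => Γ.dist (τ j) (σ j)) fun j hj => by simp only [h' j hj]
    have h3 := hΓ.dist_step h (z := σ i) (by omega)
    rw [pow_len_of_eq_off h' h.ne]
    linarith

end IsModularComplex

/-! ### Order, meets, joins and Boolean pairs of a power. -/

theorem pow_le {ρ σ : Fin n → V} : (Γ.pow n).le ρ σ ↔ ∀ i, Γ.le (ρ i) (σ i) := by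
  classical
  constructor
  · intro h
    induction h with
    | refl => exact fun i => le_refl _
    | tail _ h2 ih =>
      obtain ⟨i, h, h'⟩ := h2
      intro j
      by_cases hj : j = i
      · exact le_trans (ih j) (hj ▸ le_of_arc h)
      · exact h' j hj ▸ ih j
  · intro h
    -- Coordinates are raised from ρ to σ one at a time.
    have key : ∀ S : Finset (Fin n), (Γ.pow n).le ρ (S.piecewise σ ρ) := by
      intro S
      induction S using Finset.induction_on with
      | empty =>
        rw [Finset.piecewise_empty]
        exact le_refl _
      | insert i S hi ih =>
        refine le_trans ih ?_
        rw [Finset.piecewise_insert]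
        set τ := S.piecewise σ ρ with hτ
        have e : τ = Function.update τ i (ρ i) := by
          rw [← Finset.piecewise_eq_of_notMem S σ ρ hi, ← hτ, Function.update_eq_self]
        rw [e, Function.update_idem]
        refine Relation.ReflTransGen.lift (fun x => Function.update τ i x) (fun x y hxy => ?_) _ _ (h i)
        exact ⟨i, by simpa using hxy, fun j hj => by simp [Function.update_of_ne hj]⟩
    simpa using key Finset.univ

theorem pow_le_update {ρ σ : Fin n → V} (h : (Γ.pow n).le ρ σ) {i : Fin n} {x y : V}
    (hxy : Γ.le x y) : (Γ.pow n).le (Function.update ρ i x) (Function.update σ i y) := by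
  refine pow_le.2 fun j => ?_
  by_cases hj : j = i
  · subst hj
    rwa [Function.update_self, Function.update_self]
  · rw [Function.update_of_ne hj, Function.update_of_ne hj]
    exact pow_le.1 h j

theorem pow_isMeet {a b m : Fin n → V} :
    (Γ.pow n).IsMeet a b m ↔ ∀ i, Γ.IsMeet (a i) (b i) (m i) := by
  constructor
  · intro ⟨h1, h2, h3⟩ i
    refine ⟨pow_le.1 h1 i, pow_le.1 h2 i, fun z hz hz' => ?_⟩
    have := h3 (Function.update m i z) (by simpa using pow_le_update (i := i) h1 hz)
      (by simpa using pow_le_update (i := i) h2 hz')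
    simpa using pow_le.1 this i
  · intro h
    exact ⟨pow_le.2 fun i => (h i).1, pow_le.2 fun i => (h i).2.1, fun z hz hz' =>
      pow_le.2 fun i => (h i).2.2 _ (pow_le.1 hz i) (pow_le.1 hz' i)⟩

theorem pow_isJoin {a b j : Fin n → V} :
    (Γ.pow n).IsJoin a b j ↔ ∀ i, Γ.IsJoin (a i) (b i) (j i) := by
  constructor
  · intro ⟨h1, h2, h3⟩ i
    refine ⟨pow_le.1 h1 i, pow_le.1 h2 i, fun z hz hz' => ?_⟩
    have := h3 (Function.update j i z) (by simpa using pow_le_update (i := i) h1 hz)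
      (by simpa using pow_le_update (i := i) h2 hz')
    simpa using pow_le.1 this i
  · intro h
    exact ⟨pow_le.2 fun i => (h i).1, pow_le.2 fun i => (h i).2.1, fun z hz hz' =>
      pow_le.2 fun i => (h i).2.2 _ (pow_le.1 hz i) (pow_le.1 hz' i)⟩

theorem pow_isComplemented {p q : Fin n → V} :
    (Γ.pow n).IsComplemented p q ↔ ∀ i, Γ.IsComplemented (p i) (q i) := by
  constructor
  · rintro ⟨h, h'⟩ i
    refine ⟨pow_le.1 h i, fun r ⟨h1, h2⟩ => ?_⟩
    obtain ⟨y, ⟨h3, h4⟩, h5, h6⟩ := h' (Function.update p i r)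
      ⟨by simpa using pow_le_update (i := i) (le_refl p) h1,
        by simpa using pow_le_update (i := i) h h2⟩
    have h5' := pow_isMeet.1 h5 i
    have h6' := pow_isJoin.1 h6 i
    rw [Function.update_self] at h5' h6'
    exact ⟨y i, ⟨pow_le.1 h3 i, pow_le.1 h4 i⟩, h5', h6'⟩
  · intro h
    refine ⟨pow_le.2 fun i => (h i).1, fun r ⟨h1, h2⟩ => ?_⟩
    choose y hy hm hj using fun i => (h i).2 (r i) ⟨pow_le.1 h1 i, pow_le.1 h2 i⟩
    exact ⟨y, ⟨pow_le.2 fun i => (hy i).1, pow_le.2 fun i => (hy i).2⟩, pow_isMeet.2 hm,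
      pow_isJoin.2 hj⟩

/-- Complementedness, unlike the existence of a cube, splits into coordinates at once, because meets
and joins do. -/
theorem IsModularComplex.pow_isBoolean (hΓ : Γ.IsModularComplex) {p q : Fin n → V} :
    (Γ.pow n).IsBoolean p q ↔ ∀ i, Γ.IsBoolean (p i) (q i) := by
  rw [(hΓ.pow n).isBoolean_iff_isComplemented, pow_isComplemented]
  exact forall_congr' fun i => hΓ.isBoolean_iff_isComplemented.symm

/-! ### The 2-subdivision of a Cartesian power -/

theorem IsBoolean.map {W : Type*} {Δ : ComplexData W} {f : V → W} (hf : Function.Injective f)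
    (harc : ∀ x y, Γ.arc x y → Δ.arc (f x) (f y)) {p q : V} (h : Γ.IsBoolean p q) :
    Δ.IsBoolean (f p) (f q) := by
  obtain ⟨k, g, hg, hg', rfl, rfl⟩ := h
  exact ⟨k, f ∘ g, hf.comp hg, fun S T hST => harc _ _ (hg' S T hST), rfl, rfl⟩

namespace IsModularComplex

variable (hΓ : Γ.IsModularComplex)
include hΓ

/-- Boolean pairs of a Cartesian power are families of Boolean pairs. -/
def powPair (n : ℕ) : (Γ.pow n).BooleanPair ≃ (Fin n → Γ.BooleanPair) where
  toFun x i := ⟨x.lo i, x.hi i, hΓ.pow_isBoolean.1 x.isBoolean i⟩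
  invFun y := ⟨fun i => (y i).lo, fun i => (y i).hi, hΓ.pow_isBoolean.2 fun i => (y i).isBoolean⟩
  left_inv _ := rfl
  right_inv _ := rfl

theorem powPair_arc {x y : (Γ.pow n).BooleanPair} :
    (Γ.subdivision.pow n).arc (hΓ.powPair n x) (hΓ.powPair n y) ↔
      (Γ.pow n).subdivision.arc x y := by
  constructor
  · rintro ⟨i, h, h'⟩
    have hlo : ∀ j, j ≠ i → x.lo j = y.lo j := fun j hj => congrArg BooleanPair.lo (h' j hj)
    have hhi : ∀ j, j ≠ i → x.hi j = y.hi j := fun j hj => congrArg BooleanPair.hi (h' j hj)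
    rcases h with ⟨e, h⟩ | ⟨e, h⟩
    · refine Or.inl ⟨funext fun j => ?_, i, h, hhi⟩
      by_cases hj : j = i
      · exact hj ▸ e
      · exact hlo j hj
    · refine Or.inr ⟨funext fun j => ?_, i, h, fun j hj => (hlo j hj).symm⟩
      by_cases hj : j = i
      · exact hj ▸ e
      · exact hhi j hj
  · rintro (⟨e, i, h, h'⟩ | ⟨e, i, h, h'⟩)
    · exact ⟨i, Or.inl ⟨congrFun e i, h⟩, fun j hj => BooleanPair.ext (congrFun e j) (h' j hj)⟩
    · exact ⟨i, Or.inr ⟨congrFun e i, h⟩, fun j hj =>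
        BooleanPair.ext (h' j hj).symm (congrFun e j)⟩

theorem powPair_le {x y : (Γ.pow n).BooleanPair} :
    (∀ i, Γ.subdivision.le (hΓ.powPair n x i) (hΓ.powPair n y i)) ↔
      (Γ.pow n).subdivision.le x y := by
  rw [← pow_le]
  constructor
  · intro h
    have := Relation.ReflTransGen.lift (p := (Γ.pow n).subdivision.arc) (hΓ.powPair n).symm
      (fun a b hab => by
        rw [← (hΓ.powPair n).apply_symm_apply a, ← (hΓ.powPair n).apply_symm_apply b] at hab
        exact hΓ.powPair_arc.1 hab) _ _ h
    rwa [Function.onFun, Equiv.symm_apply_apply, Equiv.symm_apply_apply] at this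
  · exact Relation.ReflTransGen.lift (hΓ.powPair n) (fun a b => hΓ.powPair_arc.2) x y

theorem powPair_isBoolean {x y : (Γ.pow n).BooleanPair} :
    (∀ i, Γ.subdivision.IsBoolean (hΓ.powPair n x i) (hΓ.powPair n y i)) ↔
      (Γ.pow n).subdivision.IsBoolean x y := by
  rw [← hΓ.subdivision.pow_isBoolean]
  constructor
  · intro h
    have := h.map (Δ := (Γ.pow n).subdivision) (hΓ.powPair n).symm.injective (fun a b hab => by
      rw [← (hΓ.powPair n).apply_symm_apply a, ← (hΓ.powPair n).apply_symm_apply b] at hab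
      exact hΓ.powPair_arc.1 hab)
    simpa only [Equiv.symm_apply_apply] using this
  · exact fun h => h.map (hΓ.powPair n).injective fun a b => hΓ.powPair_arc.2

/-- The neighborhood semilattice of a Cartesian power is a product of neighborhood
semilattices. -/
def neighborhoodPow (ρ : Fin n → V) :
    (Γ.pow n).Neighborhood ρ ≃o ∀ i, Γ.subdivision.Star (Γ.vertexPair (ρ i)) where
  toFun x i := ⟨hΓ.powPair n x.1 i, hΓ.powPair_isBoolean.2 x.2 i⟩
  invFun y := ⟨(hΓ.powPair n).symm fun i => (y i).1, hΓ.powPair_isBoolean.1 fun i => (y i).2⟩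
  left_inv _ := rfl
  right_inv _ := rfl
  map_rel_iff' := hΓ.powPair_le

theorem nbhdValuation_pow (ρ : Fin n → V) (x : (Γ.pow n).Neighborhood ρ) :
    (Γ.pow n).nbhdValuation ρ x =
      piVal (fun i (y : Γ.subdivision.Star (Γ.vertexPair (ρ i))) =>
        Γ.subdivision.dist y.1 (Γ.vertexPair (ρ i))) (hΓ.neighborhoodPow ρ x) := by
  simp only [nbhdValuation, piVal, (hΓ.pow n).subdivision_dist, hΓ.subdivision_dist, hΓ.pow_dist]
  rw [← Finset.sum_add_distrib, Finset.sum_div]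
  rfl

/-! ### The multifacility location function -/

theorem isLocallySubmodular_multifacility [Fintype V] (c : Sym2 (V ⊕ Fin n) → ℚ≥0)
    (ρ : Fin n → V) : IsLocallySubmodular
      (piVal fun i (y : Γ.subdivision.Star (Γ.vertexPair (ρ i))) =>
        Γ.subdivision.dist y.1 (Γ.vertexPair (ρ i)))
      fun y => (∑ s : V, ∑ j : Fin n, (c s(Sum.inl s, Sum.inr j) : ℝ) *
          Γ.subdivision.dist (y j).1 (Γ.vertexPair s)) +
        ∑ j : Fin n, ∑ i ∈ Finset.Iio j, (c s(Sum.inr i, Sum.inr j) : ℝ) *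
          Γ.subdivision.dist (y i).1 (y j).1 := by
  have hs := hΓ.subdivision
  have H := fun i => hs.star_isModularSemilattice (Γ.vertexPair (ρ i))
  have hv := fun i => hs.star_isValuation (Γ.vertexPair (ρ i))
  refine .add (.sum _ fun s _ => .sum _ fun j _ => .const_mul ?_ (by positivity))
    (.sum _ fun j _ => .sum _ fun i _ => .const_mul ?_ (by positivity))
  · obtain ⟨g, -, hg⟩ := hs.exists_gate_star (Γ.vertexPair (ρ j))
    rw [funext fun y : ∀ i, Γ.subdivision.Star (Γ.vertexPair (ρ i)) => hg (y j) (Γ.vertexPair s)]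
    exact isLocallySubmodular_gate H hv j _ _
  · refine isLocallySubmodular_of_hasGates H hv
      (F := fun x y => Γ.subdivision.dist x.1 y.1) (hs.hasGates_star _ _) ?_
    have e : (fun (z : Γ.subdivision.Star (Γ.vertexPair (ρ j)))
        (x : Γ.subdivision.Star (Γ.vertexPair (ρ i))) => Γ.subdivision.dist x.1 z.1) =
        fun z x => Γ.subdivision.dist z.1 x.1 :=
      funext fun z => funext fun x => hs.dist_comm _ _
    rw [e]
    exact hs.hasGates_star _ _

/-- The extension averages over the two ends of a Boolean pair, and so does the metric of Γ*; each
distance thus becomes one of Γ*, with s replaced by s/s. -/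
theorem extend_multifacility [Fintype V] (c : Sym2 (V ⊕ Fin n) → ℚ≥0) (ρ : Fin n → V)
    (x : (Γ.pow n).Neighborhood ρ) : (Γ.pow n).extend (Γ.multifacility c) ρ x =
      (∑ s : V, ∑ j : Fin n, (c s(Sum.inl s, Sum.inr j) : ℝ) *
          Γ.subdivision.dist (hΓ.neighborhoodPow ρ x j).1 (Γ.vertexPair s)) +
        ∑ j : Fin n, ∑ i ∈ Finset.Iio j, (c s(Sum.inr i, Sum.inr j) : ℝ) *
          Γ.subdivision.dist (hΓ.neighborhoodPow ρ x i).1 (hΓ.neighborhoodPow ρ x j).1 := by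
  have e : ∀ k r s : ℝ, k * ((r + s) / 2) = (k * r + k * s) / 2 := fun k r s => by ring
  simp only [hΓ.subdivision_dist, e, ← Finset.sum_div, Finset.sum_add_distrib]
  simp only [hΓ.dist_comm _ (Γ.vertexPair _).lo, hΓ.dist_comm _ (Γ.vertexPair _).hi]
  rw [← add_div, add_add_add_comm]
  rfl

theorem isLConvex_multifacility [Fintype V] (c : Sym2 (V ⊕ Fin n) → ℚ≥0) :
    (Γ.pow n).IsLConvex (Γ.multifacility c) := by
  intro ρ
  have hs := (hΓ.pow n).subdivision
  have hfin : Finite ((Γ.pow n).subdivision.Star ((Γ.pow n).vertexPair ρ)) := by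
    refine Finite.of_injective (fun x => (x.1.lo, x.1.hi)) fun x y h => ?_
    exact Subtype.ext (BooleanPair.ext (congrArg Prod.fst h) (congrArg Prod.snd h))
  -- The neighborhood of ρ is by definition the star of ρ/ρ in the 2-subdivision of the power.
  refine (hs.star_isModularSemilattice ((Γ.pow n).vertexPair ρ)).isSubmodular_of_isLocallySubmodular
    (hs.star_isValuation ((Γ.pow n).vertexPair ρ)) ?_
  have h := (hΓ.isLocallySubmodular_multifacility c ρ).comp_orderIso (hΓ.neighborhoodPow ρ)
  simp only [← hΓ.nbhdValuation_pow, ← hΓ.extend_multifacility] at h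
  exact h

end IsModularComplex

end ComplexData

end LConvexity

theorem mainTheorem10 {V : Type*} [Fintype V] (Γ : LConvexity.ComplexData V)
    (hΓ : Γ.IsModularComplex) (n : ℕ) (c : Sym2 (V ⊕ Fin n) → ℚ≥0) :
    (Γ.pow n).IsModularComplex ∧ (Γ.pow n).IsLConvex (Γ.multifacility c) :=
  ⟨hΓ.pow n, hΓ.isLConvex_multifacility c⟩
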